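/- All graphs are finite and simple. Let $G$ be a connected graph with at least two vertices. The following statements are equivalent. 1. $G$ is distance hereditary and its split decomposition tree $T_G$ is a path. 2. $G$ has linear rank-width $1$. 3. $G$ is locally equivalent to a caterpillar. 4. $G$ is a vertex-minor of a path. 5. None of co-$(3K_2)$ (the complement of three disjoint edges), the Net (a triangle with one pendant vertex attached to each of its vertices) and the $5$-cycle $C_5$ is a vertex-minor of $G$. Here the following terminology is used. The paths are the graphs $P_n$ on $n$ vertices, including the one-vertex graph; a caterpillar is a tree such that the removal of its leaves (nodes of degree $1$) results in a path or in the graph without vertices. $G$ is distance hereditary if every induced path of $G$ is isometric in $G$. For $X\subseteq V(G)$ let $\rho_G(X)$ be the rank over $GF(2)$ of the submatrix of the adjacency matrix of $G$ with rows in $X$ and columns in $V(G)\setminus X$. The linear rank-width of $G$ is the minimum, over all linear orderings $x_1,\dots,x_n$ of $V(G)$, of $\max_{1\le i\le n}\rho_G(\{x_1,\dots,x_i\})$. The local complementation of $G$ at a vertex $x$ replaces the subgraph induced on the neighbours of $x$ by its complement. Graphs are locally equivalent if one is obtained from the other by a sequence of local complementations; $H$ is a vertex-minor of $G$ if $H$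 is isomorphic to an induced subgraph of a graph locally equivalent to $G$. A split of $G$ is a bipartition $\{X,Y\}$ of $V(G)$ with $|X|,|Y|\ge 2$ and $\rho_G(X)=1$; a graph without a split is prime. For a split $\{X,Y\}$, the graph $G^X$ arises from $G[X]$ by adding a new marker vertex $h_X$ adjacent to those vertices of $X$ that have a neighbour in $Y$, and $G^Y$, $h_Y$ are defined likewise; $h_X$ and $h_Y$ are neighbour markers. A decomposition of $G$ is a collection of graphs (blocks) obtained from $\{G\}$ by repeatedly replacing a block $H$ that has a split $\{X,Y\}$ by $H^X$ and $H^Y$; two blocks are neighbours if they contain neighbour markers. It is canonical if each block is prime, a clique with at least three vertices or a star with at least three vertices; no two clique blocks are neighbours; and, whenever two star blocks are neighbours, their neighbour markers are either both centres or both not centres. The split decomposition tree $T_G$ has as nodes the blocks of the canonical decomposition of $G$ (which exists and is unique up to isomorphism), and as edges the pairs of neighbour blocks. -/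

import Mathlib

universe u v

namespace SimpleGraph

/-- A path: a graph isomorphic to some `pathGraph n`. The one-vertex graph counts as a path (so
that stars are caterpillars and a one-node split decomposition tree is a path), and so does the
graph without vertices (so that the graph with a single edge is a caterpillar). -/
def IsPathGraph {V : Type u} (G : SimpleGraph V) : Prop :=
  ∃ n : ℕ, Nonempty (G ≃g pathGraph n)

/-- A caterpillar: a tree such that the removal of its leaves results in a path. -/
def IsCaterpillar {V : Type u} (G : SimpleGraph V) : Prop :=
  G.IsTree ∧ (G.induce {x | (G.neighborSet x).ncard ≠ 1}).IsPathGraph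

/-- A graph is distance hereditary if its induced paths are isometric. -/
def IsDistanceHereditary {V : Type u} (G : SimpleGraph V) : Prop :=
  ∀ (n : ℕ) (f : pathGraph n ↪g G) (i j : Fin n), G.dist (f i) (f j) = (pathGraph n).dist i j

open Classical in
/-- The rank over the two-element field of the submatrix of the adjacency matrix of `G` with rows
in `X` and columns outside `X`. -/
noncomputable def cutRank {V : Type u} (G : SimpleGraph V) (X : Set V) : ℕ :=
  ((G.adjMatrix (ZMod 2)).submatrix (Subtype.val : ↥X → V) (Subtype.val : ↥Xᶜ → V)).eRank.toNat

/-- The cutrank of a linear ordering of the vertices: the maximum of the cut-ranks of its initial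
segments. -/
noncomputable def orderCutRank {V : Type u} [Fintype V] (G : SimpleGraph V)
    (e : Fin (Fintype.card V) ≃ V) : ℕ :=
  Finset.univ.sup fun i => G.cutRank {x | e.symm x ≤ i}

/-- The linear rank-width: the minimum of the cutranks of the linear orderings. -/
noncomputable def linearRankWidth {V : Type u} [Fintype V] (G : SimpleGraph V) : ℕ :=
  ⨅ e : Fin (Fintype.card V) ≃ V, G.orderCutRank e

/-- Local complementation at `x`: the subgraph induced on the neighbours of `x` is replaced by
its complement. -/
def localComplement {V : Type u} (G : SimpleGraph V) (x : V) : SimpleGraph V where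
  Adj a b := a ≠ b ∧ Xor (G.Adj a b) (G.Adj x a ∧ G.Adj x b)
  symm := ⟨fun a b h => ⟨h.1.symm, by simpa only [G.adj_comm b a, and_comm] using h.2⟩⟩
  loopless := ⟨fun a h => h.1 rfl⟩

/-- `G.LocallyEquivalent H`: `H` arises from `G` by a sequence of local complementations. -/
def LocallyEquivalent {V : Type u} (G H : SimpleGraph V) : Prop :=
  Relation.ReflTransGen (fun A B : SimpleGraph V => ∃ x, B = A.localComplement x) G H

/-- `H.IsVertexMinor G`: `H` is isomorphic to an induced subgraph of a graph that is locally
equivalent to `G`. -/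
def IsVertexMinor {W : Type v} {V : Type u} (H : SimpleGraph W) (G : SimpleGraph V) : Prop :=
  ∃ G' : SimpleGraph V, G.LocallyEquivalent G' ∧ Nonempty (H ↪g G')

/-- The complement of three disjoint edges `01`, `23`, `45`. -/
def co3K2 : SimpleGraph (Fin 6) :=
  (fromEdgeSet {s(0, 1), s(2, 3), s(4, 5)})ᶜ

/-- The net: the triangle `012` with one pendant vertex attached to each of its vertices. -/
def netGraph : SimpleGraph (Fin 6) :=
  fromEdgeSet {s(0, 1), s(1, 2), s(0, 2), s(0, 3), s(1, 4), s(2, 5)}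

/-- `{X, Xᶜ}` is a split of `G`. -/
def IsSplit {V : Type u} (G : SimpleGraph V) (X : Set V) : Prop :=
  2 ≤ X.ncard ∧ 2 ≤ Xᶜ.ncard ∧ G.cutRank X = 1

/-- A graph is prime if it has no split. -/
def IsPrime {V : Type u} (G : SimpleGraph V) : Prop :=
  ∀ X : Set V, ¬ G.IsSplit X

/-- A clique with at least three vertices. -/
def IsBigClique {V : Type u} (G : SimpleGraph V) : Prop :=
  3 ≤ Nat.card V ∧ G = ⊤

/-- A star with at least three vertices, centred at `c`. -/
def IsBigStarAt {V : Type u} (G : SimpleGraph V) (c : V) : Prop :=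
  3 ≤ Nat.card V ∧ G = starGraph c

/-- A star with at least three vertices. -/
def IsBigStar {V : Type u} (G : SimpleGraph V) : Prop :=
  ∃ c, G.IsBigStarAt c

/-- The graph `G^X` of a split `{X, Xᶜ}`: the subgraph induced on `X` together with a new marker
vertex `none`, which is adjacent to those vertices of `X` that have a neighbour outside `X`. -/
def splitPart {V : Type u} (G : SimpleGraph V) (X : Set V) : SimpleGraph (Option ↥X) where
  Adj a b := match a, b with
    | some x, some y => G.Adj x y
    | some x, none => ∃ z ∈ Xᶜ, G.Adj x z
    | none, some y => ∃ z ∈ Xᶜ, G.Adj y z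
    | none, none => False
  symm := ⟨by rintro (_ | x) (_ | y) h <;> first | exact h | exact SimpleGraph.Adj.symm h⟩
  loopless := ⟨by rintro (_ | x) h <;> first | exact h | exact G.irrefl h⟩

/-- The decompositions of a graph `G`: either `G` itself is the only block, or `G` is split along
some split `{X, Xᶜ}` and the two graphs that arise are decomposed further. -/
inductive SplitDecomposition : {V : Type u} → SimpleGraph V → Type (u + 1)
  | single {V : Type u} (G : SimpleGraph V) : SplitDecomposition G
  | split {V : Type u} (G : SimpleGraph V) (X : Set V) (hX : G.IsSplit X)
      (D₁ : SplitDecomposition (G.splitPart X)) (D₂ : SplitDecomposition (G.splitPart Xᶜ)) :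
      SplitDecomposition G

namespace SplitDecomposition

/-- The vertices of all the blocks: the vertices of `G` and the marker vertices. -/
def Vert : {V : Type u} → {G : SimpleGraph V} → SplitDecomposition G → Type u
  | V, _, single _ => V
  | _, _, split _ _ _ D₁ D₂ => D₁.Vert ⊕ D₂.Vert

open Classical in
/-- The place of a vertex of `G` among the vertices of the blocks. -/
noncomputable def emb : {V : Type u} → {G : SimpleGraph V} → (D : SplitDecomposition G) →
    V → D.Vert
  | _, _, single _, x => x
  | _, _, split _ X _ D₁ D₂, x =>
      if h : x ∈ X then Sum.inl (D₁.emb (some ⟨x, h⟩)) else Sum.inr (D₂.emb (some ⟨x, h⟩))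

/-- The graph of the solid edges: the disjoint union of the blocks. -/
def solid : {V : Type u} → {G : SimpleGraph V} → (D : SplitDecomposition G) →
    SimpleGraph D.Vert
  | _, G, single _ => G
  | _, _, split _ _ _ D₁ D₂ => SimpleGraph.sum D₁.solid D₂.solid

/-- The graph of the marked edges: each split adds an edge between its two new markers. -/
noncomputable def marked : {V : Type u} → {G : SimpleGraph V} → (D : SplitDecomposition G) →
    SimpleGraph D.Vert
  | _, _, single _ => ⊥
  | _, _, split _ _ _ D₁ D₂ =>
      SimpleGraph.sum D₁.marked D₂.marked ⊔
        SimpleGraph.edge (Sum.inl (D₁.emb none)) (Sum.inr (D₂.emb none))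

/-- The index type of the blocks. -/
def Block : {V : Type u} → {G : SimpleGraph V} → SplitDecomposition G → Type
  | _, _, single _ => Unit
  | _, _, split _ _ _ D₁ D₂ => D₁.Block ⊕ D₂.Block

/-- The block that contains a given vertex. -/
def blockOf : {V : Type u} → {G : SimpleGraph V} → (D : SplitDecomposition G) →
    D.Vert → D.Block
  | _, _, single _, _ => ()
  | _, _, split _ _ _ D₁ D₂, x => Sum.map D₁.blockOf D₂.blockOf x

/-- The block with index `b`, as a graph. -/
def blockGraph {V : Type u} {G : SimpleGraph V} (D : SplitDecomposition G) (b : D.Block) :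
    SimpleGraph ↥{x : D.Vert | D.blockOf x = b} :=
  D.solid.induce {x : D.Vert | D.blockOf x = b}

/-- A decomposition is canonical if each block is prime, a clique with at least three vertices or
a star with at least three vertices, no two clique blocks are neighbours, and of two neighbour
markers in star blocks either both are centres or none is. -/
def IsCanonical {V : Type u} {G : SimpleGraph V} (D : SplitDecomposition G) : Prop :=
  (∀ b, (D.blockGraph b).IsPrime ∨ (D.blockGraph b).IsBigClique ∨ (D.blockGraph b).IsBigStar) ∧
  (∀ x y, D.marked.Adj x y →
    ¬ ((D.blockGraph (D.blockOf x)).IsBigClique ∧ (D.blockGraph (D.blockOf y)).IsBigClique)) ∧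
  (∀ x y, D.marked.Adj x y →
    (D.blockGraph (D.blockOf x)).IsBigStar → (D.blockGraph (D.blockOf y)).IsBigStar →
    ((D.blockGraph (D.blockOf x)).IsBigStarAt ⟨x, rfl⟩ ↔
      (D.blockGraph (D.blockOf y)).IsBigStarAt ⟨y, rfl⟩))

/-- The tree of a decomposition: each block is contracted to a node, and the marked edges remain.
For a canonical decomposition this is the split decomposition tree of `G`. -/
def tree {V : Type u} {G : SimpleGraph V} (D : SplitDecomposition G) : SimpleGraph D.Block where
  Adj b c := b ≠ c ∧ ∃ x y, D.marked.Adj x y ∧ D.blockOf x = b ∧ D.blockOf y = c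
  symm := ⟨fun _ _ ⟨h, x, y, hxy, hx, hy⟩ => ⟨h.symm, y, x, hxy.symm, hy, hx⟩⟩
  loopless := ⟨fun _ h => h.1 rfl⟩

end SplitDecomposition

end SimpleGraph

-- Everything passes through thin orders: linear orders of the vertices all of whose initial cuts
-- have rank at most one, that is, the edges across each cut form a complete bipartite graph. For a
-- connected graph with at least two vertices, such an order exists exactly when the linear
-- rank-width is one. Thinness of a cut survives local complementation and passes to induced
-- subgraphs, so thin orders are inherited by vertex-minors. Paths and caterpillars have them. The
-- three obstructions do not, because in each of them no vertex set of a suitable size gives a thin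
-- cut.
--
-- Conversely, a connected graph with a thin order is turned into a caterpillar from the last vertex
-- backwards. Up to exchanging the first two vertices, the vertex to be added is pendant on the head
-- of the caterpillar already built or a twin of it, and a twin can be made pendant
-- (`ThinList.exists_listsCaterpillar`). A caterpillar is a vertex-minor of a path, since a pivot
-- near the end of a longer path produces a leaf (`ListsCaterpillar.exists_path`).
--
-- On the side of split decompositions, every block is a quotient of `G` with thin classes, hence
-- isomorphic to an induced subgraph. Excluding the 5-cycle as a vertex-minor excludes bad paths;
-- without these, `G` is distance hereditary and prime blocks have at most three vertices, so all
-- cuts of all blocks are thin (`IsBrittle`). If the tree of the decomposition is a path, each block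
-- has at most two markers, and orders of the blocks that put the markers at the ends can be
-- concatenated to a thin order of `G` (`Slim.hasThinOrder`). If the tree is not a path, some block
-- has three markers. A pair of vertices is taken behind each of them, and canonicity restricts the
-- shapes of these pairs so far that co-(3K₂) or the net is a vertex-minor
-- (`IsCanonical.isVertexMinor_of_not_slim`).
--
-- The condition on the tree appears for some and for every canonical decomposition. Passing from
-- "every" to "some" uses existence (`exists_isCanonical`): one splits along splits that no thin cut
-- crosses, and a connected graph in which each split is crossed has only thin cuts or is prime.
-- Uniqueness is never used.

universe w

namespace SimpleGraph

/-! ### Thin cuts, thin orders and vertex-minors. -/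

section Cut

variable {V : Type u} {W : Type v} {K : Type w}

/-- The edges of `G` between `X` and its complement form a complete bipartite graph: the
combinatorial form of "the cut-rank of `X` is at most one". -/
def ThinCut (G : SimpleGraph V) (X : Set V) : Prop :=
  ∀ ⦃a a' b b' : V⦄, a ∈ X → a' ∈ X → b ∉ X → b' ∉ X → G.Adj a b → G.Adj a' b' → G.Adj a b'

theorem ThinCut.compl {G : SimpleGraph V} {X : Set V} (h : G.ThinCut X) : G.ThinCut Xᶜ := by
  intro a a' b b' ha ha' hb hb' hab hab'
  exact (h (not_not.1 hb') (not_not.1 hb) ha' ha hab'.symm hab.symm).symm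

theorem thinCut_compl {G : SimpleGraph V} {X : Set V} : G.ThinCut Xᶜ ↔ G.ThinCut X :=
  ⟨fun h => by simpa using h.compl, fun h => h.compl⟩

theorem thinCut_of_subsingleton {G : SimpleGraph V} {X : Set V} (h : X.Subsingleton) :
    G.ThinCut X := by
  intro a a' b b' ha ha' _ _ _ hab'
  rwa [h ha ha']

theorem ThinCut.preimage {G : SimpleGraph V} {H : SimpleGraph W} (e : H ↪g G) {X : Set V}
    (h : G.ThinCut X) : H.ThinCut (e ⁻¹' X) := by
  intro a a' b b' ha ha' hb hb' hab hab'
  exact e.map_adj_iff.1 (h ha ha' hb hb' (e.map_adj_iff.2 hab) (e.map_adj_iff.2 hab'))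

theorem localComplement_adj {G : SimpleGraph V} {x a b : V} : (G.localComplement x).Adj a b ↔
    a ≠ b ∧ Xor (G.Adj a b) (G.Adj x a ∧ G.Adj x b) := Iff.rfl

/-- Suppose the cut joins all of `A ⊆ X` to all of `B ⊆ Xᶜ`, and `x ∈ X`. Across the cut, the
neighbours of `x` in `X` have their adjacency to `N(x) \ X` toggled. This set is empty or all of
`B`, so such vertices only enter or leave `A`. The case `x ∉ X` is symmetric. Only finitely many
instances of thinness, among `a`, `a'`, `b`, `b'`, `x`, are involved. -/
theorem ThinCut.localComplement {G : SimpleGraph V} {X : Set V} (h : G.ThinCut X) (x : V) :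
    (G.localComplement x).ThinCut X := by
  intro a a' b b' ha ha' hb hb' hab hab'
  have hne : a ≠ b' := fun e => hb' (e ▸ ha)
  rw [localComplement_adj] at *
  refine ⟨hne, ?_⟩
  replace hab := hab.2
  replace hab' := hab'.2
  have s := G.adj_comm
  by_cases hx : x ∈ X
  · have h1 := @h a a' b b' ha ha' hb hb'
    have h2 := @h a x b b' ha hx hb hb'
    have h3 := @h a x b' b ha hx hb' hb
    have h4 := @h x a' b b' hx ha' hb hb'
    have h5 := @h x a b b' hx ha hb hb'
    have h6 := @h x a b' b hx ha hb' hb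
    have h7 := @h a' x b' b ha' hx hb' hb
    have h8 := @h a a' b' b ha ha' hb' hb
    have h9 := @h a' x b b' ha' hx hb hb'
    have h10 := @h a' a b' b ha' ha hb' hb
    have h11 := @h x a' b' b hx ha' hb' hb
    have h12 := @h a' a b b' ha' ha hb hb'
    clear h
    unfold Xor at *
    grind
  · have h1 := @h a a' b b' ha ha' hb hb'
    have h2 := @h a a' b x ha ha' hb hx
    have h3 := @h a a' x b' ha ha' hx hb'
    have h4 := @h a' a b' x ha' ha hb' hx
    have h5 := @h a' a x b ha' ha hx hb
    have h6 := @h a a' b' x ha ha' hb' hx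
    have h7 := @h a a' x b ha ha' hx hb
    have h8 := @h a' a b x ha' ha hb hx
    have h9 := @h a' a x b' ha' ha hx hb'
    have h10 := @h a a' b' b ha ha' hb' hb
    have h11 := @h a' a b' b ha' ha hb' hb
    have h12 := @h a' a b b' ha' ha hb hb'
    clear h
    unfold Xor at *
    grind

theorem ThinCut.of_locallyEquivalent {G H : SimpleGraph V} {X : Set V} (h : G.ThinCut X)
    (hGH : G.LocallyEquivalent H) : H.ThinCut X := by
  induction hGH with
  | refl => exact h
  | tail _ hs ih =>
    obtain ⟨x, rfl⟩ := hs
    exact ih.localComplement x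

theorem Connected.exists_adj_mem_notMem {G : SimpleGraph V} (hG : G.Connected) {X : Set V}
    {a b : V} (ha : a ∈ X) (hb : b ∉ X) : ∃ x ∈ X, ∃ y ∉ X, G.Adj x y := by
  obtain ⟨p⟩ := hG.preconnected a b
  obtain ⟨d, _, h1, h2⟩ := p.exists_boundary_dart X ha hb
  exact ⟨_, h1, _, h2, d.adj⟩

/-- This is submodularity of cut-rank: the ranks of `X ∩ Y` and `X ∪ Y` add up to at most two, and
by connectedness the union has rank at least one. The edge `cs` leaving the union plays that role
here. -/
theorem ThinCut.inter {G : SimpleGraph V} (hG : G.Connected) {X Y : Set V} (hX : G.ThinCut X)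
    (hY : G.ThinCut Y) {r : V} (hrX : r ∉ X) (hrY : r ∉ Y) : G.ThinCut (X ∩ Y) := by
  rintro a a' b b' ⟨haX, haY⟩ ⟨haX', haY'⟩ hb hb' hab hab'
  obtain ⟨c, hc, s, hs, hcs⟩ := hG.exists_adj_mem_notMem (X := X ∪ Y) (Or.inl haX)
    (fun h => h.elim hrX hrY : r ∉ X ∪ Y)
  have hsX : s ∉ X := fun h => hs (Or.inl h)
  have hsY : s ∉ Y := fun h => hs (Or.inr h)
  -- If `X` or `Y` misses both `b` and `b'`, its thinness suffices. Otherwise `b` and `b'` lie in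
  -- different differences, and the adjacency is obtained in two stages through `s`, which lies
  -- outside both sets.
  by_cases hbX : b ∈ X
  · have hbY : b ∉ Y := fun h => hb ⟨hbX, h⟩
    by_cases hbY' : b' ∈ Y
    · have hbX' : b' ∉ X := fun h => hb' ⟨h, hbY'⟩
      have has : G.Adj a s := by
        rcases hc with hc | hc
        · exact hY haY haY' hbY hsY hab (hX haX' hc hbX' hsX hab' hcs)
        · exact hY haY hc hbY hsY hab hcs
      exact hX haX haX' hsX hbX' has hab'
    · exact hY haY haY' hbY hbY' hab hab'
  · by_cases hbX' : b' ∈ X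
    · have hbY' : b' ∉ Y := fun h => hb' ⟨hbX', h⟩
      by_cases hbY : b ∈ Y
      · have has : G.Adj a s := by
          rcases hc with hc | hc
          · exact hX haX hc hbX hsX hab hcs
          · exact hX haX haX' hbX hsX hab (hY haY' hc hbY' hsY hab' hcs)
        exact hY haY haY' hsY hbY' has hab'
      · exact hY haY haY' hbY hbY' hab hab'
    · exact hX haX haX' hbX hbX' hab hab'

theorem ThinCut.union {G : SimpleGraph V} (hG : G.Connected) {X Y : Set V} (hX : G.ThinCut X)
    (hY : G.ThinCut Y) {r : V} (hrX : r ∈ X) (hrY : r ∈ Y) : G.ThinCut (X ∪ Y) := by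
  have := hX.compl.inter hG hY.compl (not_not.2 hrX) (not_not.2 hrY)
  rwa [← Set.compl_union, thinCut_compl] at this

theorem ThinCut.sdiff {G : SimpleGraph V} (hG : G.Connected) {X Y : Set V} (hX : G.ThinCut X)
    (hY : G.ThinCut Y) {r : V} (hrX : r ∉ X) (hrY : r ∈ Y) : G.ThinCut (X \ Y) :=
  hX.inter hG hY.compl hrX (not_not.2 hrY)

/-- The quotient of `G` under `κ`: distinct classes are adjacent if some edge joins them. -/
def quot (G : SimpleGraph V) (κ : V → K) : SimpleGraph K where
  Adj k l := k ≠ l ∧ ∃ x y, κ x = k ∧ κ y = l ∧ G.Adj x y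
  symm := ⟨fun _ _ ⟨h, x, y, hx, hy, hxy⟩ => ⟨h.symm, y, x, hy, hx, hxy.symm⟩⟩
  loopless := ⟨fun _ h => h.1 rfl⟩

theorem quot_adj_of_adj {G : SimpleGraph V} {κ : V → K} {x y : V} (h : G.Adj x y)
    (hne : κ x ≠ κ y) : (G.quot κ).Adj (κ x) (κ y) := ⟨hne, x, y, rfl, rfl, h⟩

/-- In a thin class, all vertices with some edge leaving the class have the same neighbours outside.
So adjacency of such vertices in different classes depends on the classes only. -/
theorem adj_of_quot_adj {G : SimpleGraph V} {κ : V → K} (hκ : ∀ k, G.ThinCut (κ ⁻¹' {k}))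
    {x x' y y' : V} (hx : G.Adj x x') (hx' : κ x' ≠ κ x) (hy : G.Adj y y') (hy' : κ y' ≠ κ y)
    (h : (G.quot κ).Adj (κ x) (κ y)) : G.Adj x y := by
  obtain ⟨hne, p, q, hp, hq, hpq⟩ := h
  have h1 : G.Adj x q := hκ (κ x) (a := x) (a' := p) (b := x') (b' := q) rfl hp hx'
    (fun e => hne (e.symm.trans hq)) hx hpq
  exact (hκ (κ y) (a := y) (a' := q) (b := y') (b' := x) rfl hq hy' hne hy h1.symm).symm

theorem ThinCut.preimage_quot {G : SimpleGraph V} {κ : V → K} (hκ : ∀ k, G.ThinCut (κ ⁻¹' {k}))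
    {S : Set K} (hS : (G.quot κ).ThinCut S) : G.ThinCut (κ ⁻¹' S) := by
  intro a a' b b' ha ha' hb hb' hab hab'
  have key : ∀ {p q : V}, κ p ∈ S → κ q ∉ S → κ p ≠ κ q := fun hp hq e => hq (e ▸ hp)
  exact adj_of_quot_adj hκ hab (key ha hb).symm hab'.symm (key ha' hb')
    (hS ha ha' hb hb' (quot_adj_of_adj hab (key ha hb)) (quot_adj_of_adj hab' (key ha' hb')))

-- A missing edge `ab'` beside `ab` and `a'b'` gives a 2×2 minor with determinant one. Conversely, a
-- complete bipartite cut has as matrix the outer product of two indicator vectors.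
open Classical in
theorem cutRank_le_one_iff [Finite V] {G : SimpleGraph V} {X : Set V} :
    G.cutRank X ≤ 1 ↔ G.ThinCut X := by
  have := Fintype.ofFinite V
  have heq : G.cutRank X = ((G.adjMatrix (ZMod 2)).submatrix (Subtype.val : ↥X → V)
      (Subtype.val : ↥Xᶜ → V)).rank := Matrix.eRank_toNat_eq_rank _
  rw [heq]
  constructor
  · intro h a a' b b' ha ha' hb hb' hab hab'
    by_contra hn
    have h2 := Matrix.rank_submatrix_le ((G.adjMatrix (ZMod 2)).submatrix
      (Subtype.val : ↥X → V) (Subtype.val : ↥Xᶜ → V)) ![⟨a, ha⟩, ⟨a', ha'⟩] ![⟨b, hb⟩, ⟨b', hb'⟩]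
    rw [Matrix.rank_of_det_ne_zero] at h2
    · simp at h2
      omega
    · rw [Matrix.det_fin_two]
      simp [hab, hab', hn]
  · intro h
    have : ((G.adjMatrix (ZMod 2)).submatrix (Subtype.val : ↥X → V) (Subtype.val : ↥Xᶜ → V)) =
        Matrix.vecMulVec (fun a : ↥X => if ∃ b ∉ X, G.Adj a b then 1 else 0)
          (fun b : ↥Xᶜ => if ∃ a ∈ X, G.Adj a b then 1 else 0) := by
      ext a b
      simp only [Matrix.submatrix_apply, adjMatrix_apply, Matrix.vecMulVec_apply]
      by_cases hab : G.Adj a b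
      · rw [if_pos hab, if_pos ⟨b, b.2, hab⟩, if_pos ⟨a, a.2, hab⟩, mul_one]
      · rw [if_neg hab]
        by_cases h1 : ∃ b ∉ X, G.Adj a b
        · by_cases h2 : ∃ a ∈ X, G.Adj a b
          · obtain ⟨c, hc, hac⟩ := h1
            obtain ⟨d, hd, hdb⟩ := h2
            exact absurd (h a.2 hd hc b.2 hac hdb) hab
          · rw [if_neg h2, mul_zero]
        · rw [if_neg h1, zero_mul]
    rw [this]
    exact Matrix.rank_vecMulVec_le _ _

open Classical in
theorem one_le_cutRank [Finite V] {G : SimpleGraph V} {X : Set V} {a b : V} (ha : a ∈ X)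
    (hb : b ∉ X) (hab : G.Adj a b) : 1 ≤ G.cutRank X := by
  have := Fintype.ofFinite V
  have heq : G.cutRank X = ((G.adjMatrix (ZMod 2)).submatrix (Subtype.val : ↥X → V)
      (Subtype.val : ↥Xᶜ → V)).rank := Matrix.eRank_toNat_eq_rank _
  rw [heq]
  have h2 := Matrix.rank_submatrix_le ((G.adjMatrix (ZMod 2)).submatrix
    (Subtype.val : ↥X → V) (Subtype.val : ↥Xᶜ → V)) ![⟨a, ha⟩] ![⟨b, hb⟩]
  rw [Matrix.rank_of_det_ne_zero] at h2
  · simpa using h2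
  · simp [hab]

/-- For a connected graph, a split is a thin cut with at least two vertices on both sides. -/
theorem Connected.isSplit_iff [Finite V] {G : SimpleGraph V} (hG : G.Connected) {X : Set V} :
    G.IsSplit X ↔ X.Nontrivial ∧ Xᶜ.Nontrivial ∧ G.ThinCut X := by
  rw [IsSplit, ← cutRank_le_one_iff, ← Set.one_lt_ncard_iff_nontrivial,
    ← Set.one_lt_ncard_iff_nontrivial]
  constructor
  · rintro ⟨h1, h2, h3⟩
    exact ⟨h1, h2, h3.le⟩
  · rintro ⟨h1, h2, h3⟩
    refine ⟨h1, h2, le_antisymm h3 ?_⟩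
    obtain ⟨a, ha⟩ := Set.nonempty_of_ncard_ne_zero (s := X) (by omega)
    obtain ⟨b, hb⟩ := Set.nonempty_of_ncard_ne_zero (s := Xᶜ) (by omega)
    obtain ⟨x, hx, y, hy, hxy⟩ := hG.exists_adj_mem_notMem ha hb
    exact one_le_cutRank hx hy hxy

/-- Some linear arrangement of the vertices has only thin initial cuts. -/
def HasThinOrder (G : SimpleGraph V) : Prop :=
  ∃ f : V → ℕ, Function.Injective f ∧ ∀ t, G.ThinCut {x | f x ≤ t}

theorem HasThinOrder.of_embedding {G : SimpleGraph V} {H : SimpleGraph W} (e : H ↪g G)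
    (h : G.HasThinOrder) : H.HasThinOrder := by
  obtain ⟨f, hf, h⟩ := h
  exact ⟨f ∘ e, hf.comp e.injective, fun t => (h t).preimage e⟩

theorem HasThinOrder.of_locallyEquivalent {G H : SimpleGraph V} (h : G.HasThinOrder)
    (hGH : G.LocallyEquivalent H) : H.HasThinOrder := by
  obtain ⟨f, hf, h⟩ := h
  exact ⟨f, hf, fun t => (h t).of_locallyEquivalent hGH⟩

theorem HasThinOrder.of_isVertexMinor {G : SimpleGraph V} {H : SimpleGraph W}
    (hHG : H.IsVertexMinor G) (h : G.HasThinOrder) : H.HasThinOrder := by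
  obtain ⟨G', hG', ⟨e⟩⟩ := hHG
  exact (h.of_locallyEquivalent hG').of_embedding e

/-- Connectedness forces rank at least one already at the first vertex of any order, so the minimum
is one as soon as some order reaches at most one. -/
theorem linearRankWidth_eq_one_iff [Fintype V] [Nontrivial V] {G : SimpleGraph V}
    (hG : G.Connected) : G.linearRankWidth = 1 ↔ G.HasThinOrder := by
  have hne : Nonempty (Fin (Fintype.card V) ≃ V) := ⟨(Fintype.equivFin V).symm⟩
  have hlow : ∀ e : Fin (Fintype.card V) ≃ V, 1 ≤ G.orderCutRank e := by
    intro e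
    have hc := Fintype.one_lt_card (α := V)
    have hi : 1 ≤ G.cutRank {x | e.symm x ≤ ⟨0, by omega⟩} := by
      obtain ⟨x, hx, y, hy, hxy⟩ := hG.exists_adj_mem_notMem
        (X := {x | e.symm x ≤ ⟨0, by omega⟩}) (a := e ⟨0, by omega⟩) (b := e ⟨1, by omega⟩)
        (by simp) (by simp)
      exact one_le_cutRank hx hy hxy
    exact hi.trans (Finset.le_sup (f := fun i => G.cutRank {x | e.symm x ≤ i})
      (Finset.mem_univ _))
  constructor
  · intro h
    obtain ⟨e, he⟩ : ∃ e, G.orderCutRank e = G.linearRankWidth :=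
      Nat.sInf_mem (Set.range_nonempty _)
    refine ⟨fun x => e.symm x, fun x y hxy => e.symm.injective (Fin.ext hxy), fun t => ?_⟩
    by_cases ht : t < Fintype.card V
    · have := Finset.sup_le_iff.1 (he.trans h).le ⟨t, ht⟩ (Finset.mem_univ _)
      exact cutRank_le_one_iff.1 this
    -- A threshold beyond the last position leaves no vertex outside the cut.
    · intro a a' b b' _ _ hb
      exact absurd (show (e.symm b : ℕ) ≤ t by omega) hb
  · rintro ⟨f, hf, h⟩
    let _ := LinearOrder.lift' f hf
    let e : Fin (Fintype.card V) ≃o V := Fintype.orderIsoFinOfCardEq V rfl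
    refine le_antisymm ((ciInf_le (OrderBot.bddBelow _) e.toEquiv).trans ?_)
      (le_ciInf fun e => hlow e)
    refine Finset.sup_le fun i _ => ?_
    rw [cutRank_le_one_iff]
    convert h (f (e i)) using 1
    ext x
    change e.symm x ≤ i ↔ f x ≤ f (e i)
    rw [← e.le_iff_le, OrderIso.apply_symm_apply]
    rfl

theorem LocallyEquivalent.localComplement {G H : SimpleGraph V} (h : G.LocallyEquivalent H)
    (x : V) : G.LocallyEquivalent (H.localComplement x) :=
  Relation.ReflTransGen.tail h ⟨x, rfl⟩

theorem localComplement_localComplement (G : SimpleGraph V) (x : V) :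
    (G.localComplement x).localComplement x = G := by
  ext a b
  have s := G.adj_comm
  have := G.irrefl (v := x)
  have := @Adj.ne V G
  simp only [localComplement_adj, Xor]
  grind

theorem LocallyEquivalent.symm {G H : SimpleGraph V} (h : G.LocallyEquivalent H) :
    H.LocallyEquivalent G := by
  induction h with
  | refl => exact .refl
  | tail _ hs ih =>
    obtain ⟨x, rfl⟩ := hs
    exact Relation.ReflTransGen.head ⟨x, (localComplement_localComplement _ x).symm⟩ ih

/-- Local complementation at a vertex of an induced subgraph commutes with inducing, so the sequence
can be carried out in the larger graph. This gives transitivity of the vertex-minor relation. -/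
theorem LocallyEquivalent.lift_embedding {G G' : SimpleGraph V} {H : SimpleGraph W}
    (h : G.LocallyEquivalent G') (e : G ↪g H) :
    ∃ H', H.LocallyEquivalent H' ∧ ∃ e' : G' ↪g H', ⇑e' = e := by
  induction h with
  | refl => exact ⟨H, .refl, e, rfl⟩
  | tail _ hs ih =>
    obtain ⟨x, rfl⟩ := hs
    obtain ⟨H', hH', e', he'⟩ := ih
    refine ⟨H'.localComplement (e' x), hH'.localComplement _, ⟨e'.toEmbedding, ?_⟩, he'⟩
    intro a b
    simp [localComplement_adj]

theorem IsVertexMinor.trans {U : Type w} {F : SimpleGraph U} {G : SimpleGraph V}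
    {H : SimpleGraph W} (h₁ : F.IsVertexMinor G) (h₂ : G.IsVertexMinor H) :
    F.IsVertexMinor H := by
  obtain ⟨G', hG', ⟨e⟩⟩ := h₁
  obtain ⟨H', hH', ⟨e₂⟩⟩ := h₂
  obtain ⟨H'', hH'', e₃, -⟩ := hG'.lift_embedding e₂
  exact ⟨H'', Relation.ReflTransGen.trans hH' hH'', ⟨e.trans e₃⟩⟩

theorem IsVertexMinor.of_embedding {G : SimpleGraph V} {H : SimpleGraph W} (e : G ↪g H) :
    G.IsVertexMinor H := ⟨H, .refl, ⟨e⟩⟩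

theorem IsVertexMinor.of_locallyEquivalent {U : Type w} {F : SimpleGraph U} {G H : SimpleGraph V}
    (h₁ : F.IsVertexMinor G) (h : G.LocallyEquivalent H) : F.IsVertexMinor H :=
  h₁.trans ⟨G, h.symm, ⟨Embedding.refl⟩⟩

end Cut

end SimpleGraph

namespace SimpleGraph

/-! ### From a thin order to a caterpillar. -/

section Thread

variable {V : Type u} {W : Type v}

/-- Pivoting on the pair `u`, `v`. -/
def pivot (G : SimpleGraph V) (u v : V) : SimpleGraph V :=
  ((G.localComplement u).localComplement v).localComplement u

/-- A pivot on an edge `uv` exchanges the neighbourhoods of `u` and `v` outside the edge, and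
toggles the pairs between different classes among the common neighbours, the private neighbours of
`u` and those of `v`. -/
theorem pivot_adj_of_ne {G : SimpleGraph V} {u v a b : V} (h : G.Adj u v) (hau : a ≠ u)
    (hav : a ≠ v) (hbu : b ≠ u) (hbv : b ≠ v) (hab : a ≠ b) : (G.pivot u v).Adj a b ↔
      Xor (G.Adj a b) (Xor (G.Adj u a ∧ G.Adj v b) (G.Adj v a ∧ G.Adj u b)) := by
  have h6 := h.ne
  have h7 := h.symm
  by_cases p1 : G.Adj a b <;> by_cases p2 : G.Adj u a <;> by_cases p3 : G.Adj u b <;>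
    by_cases p4 : G.Adj v a <;> by_cases p5 : G.Adj v b <;>
    simp [pivot, localComplement_adj, Xor, h, h6.symm, h7, p1, p2, p3, p4, p5, hau.symm,
      hav.symm, hbu.symm, hbv.symm, hab]

theorem pivot_adj_left {G : SimpleGraph V} {u v a : V} (h : G.Adj u v) (hau : a ≠ u)
    (hav : a ≠ v) : (G.pivot u v).Adj u a ↔ G.Adj v a := by
  have s := G.adj_comm
  have h1 := s u v
  have h2 := s u a
  have h4 := s v a
  have h6 := h.ne
  have h7 := G.irrefl (v := u)
  simp only [pivot, localComplement_adj, Xor]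
  grind

theorem pivot_adj_right {G : SimpleGraph V} {u v a : V} (h : G.Adj u v) (hau : a ≠ u)
    (hav : a ≠ v) : (G.pivot u v).Adj v a ↔ G.Adj u a := by
  have s := G.adj_comm
  have h1 := s u v
  have h2 := s u a
  have h4 := s v a
  have h6 := h.ne
  have h7 := G.irrefl (v := u)
  have h8 := G.irrefl (v := v)
  simp only [pivot, localComplement_adj, Xor]
  grind

theorem pivot_adj_self {G : SimpleGraph V} {u v : V} (h : G.Adj u v) :
    (G.pivot u v).Adj u v := by
  have h1 := G.adj_comm u v
  have h6 := h.ne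
  have h7 := G.irrefl (v := u)
  have h8 := G.irrefl (v := v)
  simp only [pivot, localComplement_adj, Xor]
  grind

/-- `H` arises from `G` by local complementations at vertices of `S`. -/
def LocallyEquivalentOn (S : Set V) (G H : SimpleGraph V) : Prop :=
  Relation.ReflTransGen (fun A B : SimpleGraph V => ∃ x ∈ S, B = A.localComplement x) G H

theorem LocallyEquivalentOn.locallyEquivalent {S : Set V} {G H : SimpleGraph V}
    (h : LocallyEquivalentOn S G H) : G.LocallyEquivalent H :=
  Relation.ReflTransGen.mono (fun _ _ ⟨x, _, hx⟩ => ⟨x, hx⟩) _ _ h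

theorem LocallyEquivalentOn.mono {S S' : Set V} (hS : S ⊆ S') {G H : SimpleGraph V}
    (h : LocallyEquivalentOn S G H) : LocallyEquivalentOn S' G H :=
  Relation.ReflTransGen.mono (fun _ _ ⟨x, h, hx⟩ => ⟨x, hS h, hx⟩) _ _ h

theorem LocallyEquivalentOn.localComplement {S : Set V} {G H : SimpleGraph V}
    (h : LocallyEquivalentOn S G H) {x : V} (hx : x ∈ S) :
    LocallyEquivalentOn S G (H.localComplement x) :=
  Relation.ReflTransGen.tail h ⟨x, hx, rfl⟩

theorem LocallyEquivalentOn.pivot {S : Set V} {G H : SimpleGraph V}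
    (h : LocallyEquivalentOn S G H) {x y : V} (hx : x ∈ S) (hy : y ∈ S) :
    LocallyEquivalentOn S G (H.pivot x y) :=
  ((h.localComplement hx).localComplement hy).localComplement hx

/-- `G` induces on the listed vertices a caterpillar in which the first vertex is at an end of the
spine: the first vertex hangs on the second one, or the second one on the first one. -/
inductive ListsCaterpillar (G : SimpleGraph V) : List V → Prop
  | single (x : V) : ListsCaterpillar G [x]
  | spine {x y : V} {l : List V} : ListsCaterpillar G (y :: l) → G.Adj x y →
      (∀ z ∈ l, ¬ G.Adj x z) → ListsCaterpillar G (x :: y :: l)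
  | leaf {x y : V} {l : List V} : ListsCaterpillar G (x :: l) → G.Adj x y →
      (∀ z ∈ l, ¬ G.Adj y z) → ListsCaterpillar G (x :: y :: l)

/-- The head may be replaced by any vertex with the same neighbours in the tail. This is what a
pivot on the first two listed vertices requires, as it exchanges their roles. -/
theorem ListsCaterpillar.congr_head {G H : SimpleGraph V} {y z : V} {l : List V}
    (h : ListsCaterpillar G (y :: l)) (h₁ : ∀ w ∈ l, (H.Adj z w ↔ G.Adj y w))
    (h₂ : ∀ w ∈ l, ∀ w' ∈ l, (H.Adj w w' ↔ G.Adj w w')) : ListsCaterpillar H (z :: l) := by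
  generalize hm : y :: l = m at h
  induction h generalizing y z l with
  | single x =>
    obtain ⟨rfl, rfl⟩ := List.cons_eq_cons.1 hm
    exact .single z
  | @spine x x' l' hc hxx' hx ih =>
    obtain ⟨rfl, rfl⟩ := List.cons_eq_cons.1 hm
    refine .spine (ih ?_ ?_ rfl) ((h₁ _ (by simp)).2 hxx') ?_
    · exact fun w hw => h₂ _ (by simp) _ (by simp [hw])
    · exact fun w hw w' hw' => h₂ _ (by simp [hw]) _ (by simp [hw'])
    · exact fun w hw hzw => hx w hw ((h₁ _ (by simp [hw])).1 hzw)
  | @leaf x x' l' hc hxx' hx ih =>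
    obtain ⟨rfl, rfl⟩ := List.cons_eq_cons.1 hm
    refine .leaf (ih ?_ ?_ rfl) ((h₁ _ (by simp)).2 hxx') ?_
    · exact fun w hw => h₁ _ (by simp [hw])
    · exact fun w hw w' hw' => h₂ _ (by simp [hw]) _ (by simp [hw'])
    · exact fun w hw hzw => hx w hw ((h₂ _ (by simp) _ (by simp [hw])).1 hzw)

theorem ListsCaterpillar.congr {G H : SimpleGraph V} {l : List V} (h : ListsCaterpillar G l)
    (h' : ∀ w ∈ l, ∀ w' ∈ l, (H.Adj w w' ↔ G.Adj w w')) : ListsCaterpillar H l := by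
  cases l with
  | nil => cases h
  | cons y l =>
    exact h.congr_head (fun w hw => h' _ (by simp) _ (by simp [hw]))
      (fun w hw w' hw' => h' _ (by simp [hw]) _ (by simp [hw']))

theorem ListsCaterpillar.adj_head {G : SimpleGraph V} {x y : V} {l : List V}
    (h : ListsCaterpillar G (x :: y :: l)) : G.Adj x y := by
  cases h <;> assumption

/-- If `x` is a twin of the first vertex of a listed caterpillar, then `x` can be turned into a
vertex that hangs on this first vertex. -/
theorem exists_pendant_of_twin {G : SimpleGraph V} {x y z : V} {l : List V}
    (hn : (x :: y :: z :: l).Nodup) (h : ListsCaterpillar G (y :: z :: l))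
    (ht : ∀ w ∈ z :: l, (G.Adj x w ↔ G.Adj y w)) :
    ∃ H, LocallyEquivalentOn {w | w ∈ x :: y :: z :: l} G H ∧ ListsCaterpillar H (y :: z :: l) ∧
      H.Adj x y ∧ ∀ w ∈ z :: l, ¬ H.Adj x w := by
  have hyz := h.adj_head
  have hxz : G.Adj x z := (ht z (by simp)).2 hyz
  have hyS : y ∈ {w | w ∈ x :: y :: z :: l} := by simp
  have hzS : z ∈ {w | w ∈ x :: y :: z :: l} := by simp
  simp only [List.nodup_cons, List.mem_cons, not_or] at hn
  obtain ⟨⟨hxy', hxz', hxl⟩, ⟨hyz', hyl⟩, hzl, hl⟩ := hn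
  have hxne : ∀ w ∈ l, w ≠ x := fun w hw e => hxl (e ▸ hw)
  have hyne : ∀ w ∈ l, w ≠ y := fun w hw e => hyl (e ▸ hw)
  have hzne : ∀ w ∈ l, w ≠ z := fun w hw e => hzl (e ▸ hw)
  have ht' : ∀ w ∈ l, (G.Adj x w ↔ G.Adj y w) := fun w hw => ht w (by simp [hw])
  cases h with
  | spine hc _ hy =>
    -- Among the vertices from `z` on, both `x` and `y` see only `z`. If `xyz` is a triangle,
    -- complementing at `y` deletes just the edge `xz`.
    by_cases hxy : G.Adj x y
    · refine ⟨G.localComplement y, .tail .refl ⟨y, hyS, rfl⟩, .spine (hc.congr ?_) ?_ ?_, ?_, ?_⟩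
      · intro w hw w' hw'
        simp only [List.mem_cons] at hw hw'
        have := @Adj.ne V G
        have := hy w
        have := hy w'
        simp only [localComplement_adj, Xor]
        grind
      · simp [localComplement_adj, hyz, hyz', Xor]
      · intro w hw
        simp [localComplement_adj, hy w hw, Xor]
      · simp [localComplement_adj, hxy, hxy', Xor]
      · intro w hw
        rcases List.mem_cons.1 hw with rfl | hw
        · simp [localComplement_adj, hxz, hyz, hxy.symm, Xor]
        · simp [localComplement_adj, ht' w hw, hy w hw, Xor]
    -- Here `x` and `y` both hang on `z`. After the pivot, `y` takes over the neighbours of `z`,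
    -- among them `x`, and `z` becomes a leaf on `y`.
    · refine ⟨G.pivot y z, LocallyEquivalentOn.pivot .refl hyS hzS, .leaf (hc.congr_head ?_ ?_) ?_ ?_, ?_, ?_⟩
      · intro w hw
        exact pivot_adj_left hyz (hyne w hw) (hzne w hw)
      · intro w hw w' hw'
        by_cases hww : w = w'
        · subst hww
          simp
        · rw [pivot_adj_of_ne hyz (hyne w hw) (hzne w hw) (hyne w' hw') (hzne w' hw') hww]
          simp [hy w hw, hy w' hw', Xor]
      · exact pivot_adj_self hyz
      · intro w hw
        rw [pivot_adj_right hyz (hyne w hw) (hzne w hw)]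
        exact hy w hw
      · rw [adj_comm, pivot_adj_left hyz hxy' hxz']
        exact hxz.symm
      · intro w hw
        rcases List.mem_cons.1 hw with rfl | hw
        · rw [adj_comm, pivot_adj_right hyz hxy' hxz', adj_comm]
          exact hxy
        · rw [pivot_adj_of_ne hyz hxy' hxz' (hyne w hw) (hzne w hw) (hxne w hw).symm]
          simp [hy w hw, ht' w hw, G.adj_comm y x, hxy, Xor]
  | leaf hc _ hz =>
    -- Here `z` hangs on `y` and sees only `x` and `y`, so complementing at `z` can delete the edge
    -- `xy`. Once it is absent, pivoting on `yz` gives `z` the neighbours of `y` in `l` and toggles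
    -- away those of `x`, which leaves `x` pendant on `y`.
    obtain ⟨G₁, hG₁, hxy, hsame⟩ : ∃ G₁, LocallyEquivalentOn {w | w ∈ x :: y :: z :: l} G G₁ ∧
        ¬ G₁.Adj x y ∧ ∀ w ∈ z :: l, ∀ w', (G₁.Adj w w' ↔ G.Adj w w') := by
      by_cases hxy : G.Adj x y
      · refine ⟨G.localComplement z, .tail .refl ⟨z, hzS, rfl⟩, ?_, ?_⟩
        · simp [localComplement_adj, hxy, hxz.symm, hyz.symm, Xor]
        · intro w hw w'
          have h1 : ¬ G.Adj z w := by
            rcases List.mem_cons.1 hw with rfl | hw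
            · simp
            · exact hz w hw
          simp only [localComplement_adj, h1, Xor, false_and, not_false_eq_true, and_true, or_false]
          exact ⟨fun h => h.2, fun h => ⟨h.ne, h⟩⟩
      · exact ⟨G, .refl, hxy, fun _ _ _ => Iff.rfl⟩
    have hsame' : ∀ w ∈ z :: l, ∀ w', (G₁.Adj w' w ↔ G.Adj w' w) := fun w hw w' => by
      rw [adj_comm, hsame w hw, adj_comm]
    have hyz₁ := (hsame' z (by simp) y).2 hyz
    have hz₁ : ∀ w ∈ l, ¬ G₁.Adj z w := fun w hw => by
      rw [hsame' w (by simp [hw])]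
      exact hz w hw
    have ht₁ : ∀ w ∈ l, (G₁.Adj x w ↔ G₁.Adj y w) := fun w hw => by
      rw [hsame' w (by simp [hw]), hsame' w (by simp [hw])]
      exact ht' w hw
    refine ⟨G₁.pivot y z, hG₁.pivot hyS hzS, .spine (hc.congr_head ?_ ?_) ?_ ?_, ?_, ?_⟩
    · intro w hw
      rw [pivot_adj_right hyz₁ (hyne w hw) (hzne w hw), hsame' w (by simp [hw])]
    · intro w hw w' hw'
      by_cases hww : w = w'
      · subst hww
        simp
      · rw [pivot_adj_of_ne hyz₁ (hyne w hw) (hzne w hw) (hyne w' hw') (hzne w' hw') hww,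
          hsame' w' (by simp [hw'])]
        simp [hz₁ w hw, hz₁ w' hw', Xor]
    · exact pivot_adj_self hyz₁
    · intro w hw
      rw [pivot_adj_left hyz₁ (hyne w hw) (hzne w hw)]
      exact hz₁ w hw
    · rw [adj_comm, pivot_adj_left hyz₁ hxy' hxz', hsame z (by simp)]
      exact hxz.symm
    · intro w hw
      rcases List.mem_cons.1 hw with rfl | hw
      · rw [adj_comm, pivot_adj_right hyz₁ hxy' hxz', adj_comm]
        exact hxy
      · rw [pivot_adj_of_ne hyz₁ hxy' hxz' (hyne w hw) (hzne w hw) (hxne w hw).symm]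
        simp [hz₁ w hw, ht₁ w hw, G₁.adj_comm y x, hxy, (hsame z (by simp) x).2 hxz.symm, Xor]

/-- The initial cuts of the listed vertices are thin, and the listed vertices induce a connected
graph. -/
def ThinList (G : SimpleGraph V) (l : List V) : Prop :=
  (∀ p q, p ++ q = l →
    ∀ a ∈ p, ∀ a' ∈ p, ∀ b ∈ q, ∀ b' ∈ q, G.Adj a b → G.Adj a' b' → G.Adj a b') ∧
  ∀ X : Set V, (∃ a ∈ l, a ∈ X) → (∃ b ∈ l, b ∉ X) →
    ∃ a ∈ l, ∃ b ∈ l, a ∈ X ∧ b ∉ X ∧ G.Adj a b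

theorem ThinList.localComplement {G : SimpleGraph V} {l : List V} (hn : l.Nodup)
    (h : G.ThinList l) {x : V} (hx : x ∈ l) : (G.localComplement x).ThinList l := by
  constructor
  · rintro p q rfl
    have h1 := h.1 p q rfl
    have hd := List.disjoint_of_nodup_append hn
    intro a ha a' ha' b hb b' hb' hab hab'
    have key : (G.induce {w | w ∈ p ++ q}).ThinCut {w | w.1 ∈ p} := by
      rintro ⟨a, haS⟩ ⟨a', haS'⟩ ⟨b, hbS⟩ ⟨b', hbS'⟩ ha ha' hb hb' hab hab'
      have hb2 : b ∈ q := (List.mem_append.1 hbS).resolve_left hb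
      have hb2' : b' ∈ q := (List.mem_append.1 hbS').resolve_left hb'
      exact h1 a ha a' ha' b hb2 b' hb2' hab hab'
    have := key.localComplement ⟨x, hx⟩ (a := ⟨a, List.mem_append_left _ ha⟩)
      (a' := ⟨a', List.mem_append_left _ ha'⟩) (b := ⟨b, List.mem_append_right _ hb⟩)
      (b' := ⟨b', List.mem_append_right _ hb'⟩) ha ha' (fun h => hd h hb) (fun h => hd h hb')
    simp only [localComplement_adj, induce_adj, ne_eq, Subtype.mk.injEq] at this
    exact this hab hab'
  · intro X hX hX'
    by_contra! hno
    obtain ⟨a, ha, b, hb, haX, hbX, hab⟩ := h.2 X hX hX'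
    have h3 := hno a ha b hb haX hbX
    -- If no edge of the new graph crosses `X`, then `x` has no neighbour on the other side, and
    -- complementing back at `x` creates no crossing edge.
    rw [← localComplement_localComplement G x, localComplement_adj] at hab
    by_cases hxX : x ∈ X
    · have := hno x hx b hb hxX hbX
      simp [h3, this, Xor] at hab
    · have := hno a ha x hx haX hxX
      rw [adj_comm] at this
      simp [h3, this, Xor] at hab

theorem ThinList.of_locallyEquivalentOn {G H : SimpleGraph V} {l : List V} (hn : l.Nodup)
    (h : G.ThinList l) (hGH : LocallyEquivalentOn {w | w ∈ l} G H) : H.ThinList l := by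
  induction hGH with
  | refl => exact h
  | tail _ hs ih =>
    obtain ⟨x, hx, rfl⟩ := hs
    exact ih.localComplement hn hx

theorem ThinList.pair {G : SimpleGraph V} {x y : V} {l : List V} (h : G.ThinList (x :: y :: l))
    {b : V} (hb : b ∈ l) (hxb : G.Adj x b) {c : V} (hc : c ∈ l) (hyc : G.Adj y c) :
    G.Adj y b :=
  h.1 [x, y] l rfl y (by simp) x (by simp) c hc b hb hyc hxb

/-- Exchanging the first two vertices affects only the prefix of length one, whose cut is always
thin. -/
theorem ThinList.swap {G : SimpleGraph V} {x y : V} {l : List V} (h : G.ThinList (x :: y :: l)) :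
    G.ThinList (y :: x :: l) := by
  refine ⟨?_, ?_⟩
  · intro p q hpq
    match p, hpq with
    | [], hpq => simp
    | [z], hpq =>
      intro a ha a' ha' b _ b' _ _ hab'
      rw [List.mem_singleton] at ha ha'
      rwa [ha, ← ha']
    | z :: z' :: p, hpq =>
      simp only [List.cons_append, List.cons.injEq] at hpq
      obtain ⟨rfl, rfl, rfl⟩ := hpq
      have hmem : ∀ a, a ∈ z :: z' :: p ↔ a ∈ z' :: z :: p := by
        intro a
        simp only [List.mem_cons]
        tauto
      simp only [hmem]
      exact h.1 (z' :: z :: p) q rfl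
  · have hmem : ∀ a, a ∈ y :: x :: l ↔ a ∈ x :: y :: l := by
      intro a
      simp only [List.mem_cons]
      tauto
    simp only [hmem]
    exact h.2

/-- If `y` has a later neighbour, thinness of the cut after `x, y` makes it adjacent to all later
neighbours of `x`. So `y` takes over every connection through `x`, and the tail stays connected. -/
theorem ThinList.tail {G : SimpleGraph V} {x y : V} {l : List V} (hn : (x :: y :: l).Nodup)
    (h : G.ThinList (x :: y :: l))
    (hy : l ≠ [] → ∃ b ∈ l, G.Adj y b) : G.ThinList (y :: l) := by
  have hx : ∀ w ∈ y :: l, w ≠ x := fun w hw e => (List.nodup_cons.1 hn).1 (e ▸ hw)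
  have hyb : ∀ b ∈ l, G.Adj x b → G.Adj y b := by
    intro b hb hxb
    obtain ⟨c, hc, hyc⟩ := hy (List.ne_nil_of_mem hb)
    exact h.pair hb hxb hc hyc
  refine ⟨?_, ?_⟩
  · rintro p q hpq a ha a' ha'
    exact h.1 (x :: p) q (by simp [hpq]) a (by simp [ha]) a' (by simp [ha'])
  · have key : ∀ X : Set V, y ∈ X → (∃ b ∈ y :: l, b ∉ X) →
        ∃ a ∈ y :: l, ∃ b ∈ y :: l, a ∈ X ∧ b ∉ X ∧ G.Adj a b := by
      rintro X hyX ⟨b, hb, hbX⟩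
      obtain ⟨a, ha, b, hb, haX, hbX, hab⟩ := h.2 (insert x X) ⟨x, by simp, by simp⟩
        ⟨b, by simp [List.mem_cons.1 hb], by simp [hbX, hx b hb]⟩
      simp only [Set.mem_insert_iff, not_or] at hbX
      have hb' : b ∈ y :: l := (List.mem_cons.1 hb).resolve_left hbX.1
      rcases List.mem_cons.1 ha with rfl | ha
      · have hbl : b ∈ l := (List.mem_cons.1 hb').resolve_left fun e => hbX.2 (e ▸ hyX)
        exact ⟨y, by simp, b, hb', hyX, hbX.2, hyb b hbl hab⟩
      · exact ⟨a, ha, b, hb', haX.resolve_left (hx a ha), hbX.2, hab⟩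
    intro X hX hX'
    by_cases hyX : y ∈ X
    · exact key X hyX hX'
    · obtain ⟨b, hb, a, ha, hbX, haX, hab⟩ := key Xᶜ hyX (by simpa using hX)
      exact ⟨a, ha, b, hb, not_not.1 haX, hbX, hab.symm⟩

/-- Induction on the length, with complementations inside the tail so that the whole list stays
thin. When the tail is a caterpillar with head `y`, the first vertex `x` either has no neighbour
beyond `y`, and then hangs on `y` by connectedness, or is by thinness a twin of `y` over the rest,
which `exists_pendant_of_twin` repairs. -/
theorem ThinList.exists_listsCaterpillar {l : List V} (hne : l ≠ []) {G : SimpleGraph V}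
    (hn : l.Nodup) (h : G.ThinList l) :
    ∃ H, LocallyEquivalentOn {w | w ∈ l} G H ∧ ListsCaterpillar H l := by
  induction hk : l.length generalizing l with
  | zero => exact absurd (List.length_eq_zero_iff.1 hk) hne
  | succ k ih =>
    have step : ∀ {x y : V} {l : List V}, (x :: y :: l).Nodup → G.ThinList (x :: y :: l) →
        (y :: l).length = k → (l ≠ [] → ∃ b ∈ l, G.Adj y b) →
        ∃ H, LocallyEquivalentOn {w | w ∈ x :: y :: l} G H ∧ ListsCaterpillar H (y :: l) ∧
          H.Adj x y ∧ ∀ w ∈ l, ¬ H.Adj x w := by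
      intro x y l hn h hk hy
      obtain ⟨H, hGH, hH⟩ := ih (by simp) (List.nodup_cons.1 hn).2 (h.tail hn hy) hk
      have hGH' : LocallyEquivalentOn {w | w ∈ x :: y :: l} G H :=
        hGH.mono fun w hw => List.mem_cons_of_mem _ hw
      have hthin := h.of_locallyEquivalentOn hn hGH'
      by_cases hx : ∃ b ∈ l, H.Adj x b
      · obtain ⟨b, hb, hxb⟩ := hx
        match l, hb with
        | z :: l, hb =>
          have hyz := hH.adj_head
          obtain ⟨H', h1, h2, h3, h4⟩ := exists_pendant_of_twin hn hH (fun w hw =>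
            ⟨fun hxw => hthin.pair hw hxw (by simp) hyz,
              fun hyw => hthin.1 [x, y] (z :: l) rfl x (by simp) y (by simp) b hb w hw hxb hyw⟩)
          exact ⟨H', Relation.ReflTransGen.trans hGH' h1, h2, h3, h4⟩
      · push Not at hx
        refine ⟨H, hGH', hH, ?_, hx⟩
        obtain ⟨a, ha, b, hb, haX, hbX, hab⟩ := hthin.2 {x} ⟨x, by simp⟩
          ⟨y, by simp, fun e : y = x => (List.nodup_cons.1 hn).1 (by simp [e])⟩
        obtain rfl : a = x := haX
        rcases List.mem_cons.1 hb with rfl | hb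
        · exact absurd rfl hbX
        · rcases List.mem_cons.1 hb with rfl | hb
          · exact hab
          · exact absurd hab (hx b hb)
    match l, hn, h, hk with
    | [x], _, _, _ => exact ⟨G, .refl, .single x⟩
    | x :: y :: l, hn, h, hk =>
      by_cases hy : l ≠ [] → ∃ b ∈ l, G.Adj y b
      · obtain ⟨H, h1, h2, h3, h4⟩ := step hn h (by simpa using hk) hy
        exact ⟨H, h1, .spine h2 h3 h4⟩
      -- If `y` has no later neighbour, the tail would be disconnected. Then `x` has one, and the
      -- two are exchanged, so that `y` ends up as a leaf on `x`.
      · push Not at hy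
        obtain ⟨hl, hy⟩ := hy
        obtain ⟨c, hc⟩ := List.exists_mem_of_ne_nil l hl
        obtain ⟨⟨hxy, hxl⟩, hyl, -⟩ : (x ≠ y ∧ x ∉ l) ∧ y ∉ l ∧ l.Nodup := by
          simpa only [List.nodup_cons, List.mem_cons, not_or] using hn
        obtain ⟨a, ha, b, hb, haX, hbX, hab⟩ := h.2 {x, y} ⟨x, by simp⟩
          ⟨c, by simp [hc], by
            rintro (rfl | rfl)
            exacts [hxl hc, hyl hc]⟩
        have hb' : b ∈ l := by
          simp only [Set.mem_insert_iff, Set.mem_singleton_iff, not_or] at hbX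
          simpa [hbX] using hb
        have hxb : ∃ b ∈ l, G.Adj x b := by
          rcases haX with rfl | rfl
          · exact ⟨b, hb', hab⟩
          · exact absurd hab (hy b hb')
        obtain ⟨H, h1, h2, h3, h4⟩ := step (List.Perm.nodup (List.Perm.swap y x l) hn) h.swap
          (by simpa using hk) fun _ => hxb
        refine ⟨H, h1.mono ?_, .leaf h2 h3.symm h4⟩
        intro w hw
        simp only [Set.mem_ofPred_eq, List.mem_cons] at hw ⊢
        tauto

end Thread

end SimpleGraph

namespace SimpleGraph

/-! ### Caterpillars, paths and thin orders. -/

section Caterpillar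

variable {V : Type u} {W : Type v}

theorem HasThinOrder.exists_thinList [Finite V] {G : SimpleGraph V} (hG : G.Connected)
    (h : G.HasThinOrder) : ∃ l : List V, l.Nodup ∧ (∀ w, w ∈ l) ∧ G.ThinList l := by
  have := Fintype.ofFinite V
  obtain ⟨f, hf, h⟩ := h
  let _ := LinearOrder.lift' f hf
  refine ⟨(Finset.univ : Finset V).sort, Finset.sort_nodup _ _, fun w => by simp, ?_, ?_⟩
  · intro p q hpq a ha a' ha' b hb b' hb' hab hab'
    have hs := Finset.pairwise_sort (Finset.univ : Finset V) (· ≤ ·)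
    have hn := Finset.sort_nodup (Finset.univ : Finset V) (· ≤ ·)
    rw [← hpq] at hs hn
    have hd := List.disjoint_of_nodup_append hn
    have key : ∀ a ∈ p, ∀ b ∈ q, f a < f b := by
      intro a ha b hb
      have h1 : f a ≤ f b := (List.pairwise_append.1 hs).2.2 a ha b hb
      have h2 : f a ≠ f b := fun e => hd ha (hf e ▸ hb)
      omega
    have h1 := key a ha b hb
    have h2 := key a ha b' hb'
    have h3 := key a' ha' b hb
    have h4 := key a' ha' b' hb'
    -- The threshold only has to separate the four vertices at hand.
    exact h (max (f a) (f a')) (a := a) (a' := a') (b := b) (b' := b') (by simp) (by simp)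
      (by simp; omega) (by simp; omega) hab hab'
  · rintro X ⟨a, -, ha⟩ ⟨b, -, hb⟩
    obtain ⟨x, hx, y, hy, hxy⟩ := hG.exists_adj_mem_notMem ha hb
    exact ⟨x, by simp, y, by simp, hx, hy, hxy⟩

/-- A graph whose vertices are indexed by an interval so that adjacent means consecutive. -/
theorem isPathGraph_of_index [Finite W] {H : SimpleGraph W} (g : W → ℕ)
    (hg : Function.Injective g) (hadj : ∀ a b, H.Adj a b ↔ g a + 1 = g b ∨ g b + 1 = g a)
    (hconv : ∀ a b t, g a ≤ t → t ≤ g b → ∃ c, g c = t) : H.IsPathGraph := by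
  rcases isEmpty_or_nonempty W with hW | hW
  · exact ⟨0, ⟨⟨Equiv.equivOfIsEmpty _ _, fun {a} => isEmptyElim a⟩⟩⟩
  · obtain ⟨a, ha⟩ := Finite.exists_min g
    obtain ⟨b, hb⟩ := Finite.exists_max g
    let φ : W → Fin (g b - g a + 1) := fun w => ⟨g w - g a, by have := hb w; omega⟩
    have hφ : Function.Bijective φ := by
      constructor
      · intro x y hxy
        have h1 := ha x
        have h2 := ha y
        have h3 := Fin.mk.inj_iff.1 hxy
        exact hg (by omega)
      · intro i
        have := ha b
        obtain ⟨c, hc⟩ := hconv a b (g a + i) (by omega) (by omega)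
        exact ⟨c, Fin.ext (by simp [φ, hc])⟩
    refine ⟨_, ⟨⟨Equiv.ofBijective φ hφ, ?_⟩⟩⟩
    intro x y
    have h1 := ha x
    have h2 := ha y
    rw [pathGraph_adj, hadj]
    simp only [Equiv.ofBijective_apply, φ]
    omega

theorem ListsCaterpillar.reachable {G : SimpleGraph V} {x : V} {l : List V}
    (h : ListsCaterpillar G (x :: l)) : ∀ w ∈ x :: l, G.Reachable x w := by
  generalize hm : x :: l = m at h
  induction h generalizing x l with
  | single y =>
    obtain ⟨rfl, rfl⟩ := List.cons_eq_cons.1 hm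
    intro w hw
    rw [List.mem_singleton.1 hw]
  | @spine y z l' hc hyz hy ih =>
    obtain ⟨rfl, rfl⟩ := List.cons_eq_cons.1 hm
    intro w hw
    rcases List.mem_cons.1 hw with rfl | hw
    · rfl
    · exact hyz.reachable.trans (ih rfl w hw)
  | @leaf y z l' hc hyz hy ih =>
    obtain ⟨rfl, rfl⟩ := List.cons_eq_cons.1 hm
    intro w hw
    rcases List.mem_cons.1 hw with rfl | hw
    · rfl
    · rcases List.mem_cons.1 hw with rfl | hw
      · exact hyz.reachable
      · exact ih rfl w (by simp [hw])

theorem not_isCycle_of_unique_neighbor {G : SimpleGraph V} {v x y : V} {p : G.Walk v v}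
    (hp : p.IsCycle) (hx : x ∈ p.support) (h : ∀ w ∈ p.support, G.Adj x w → w = y) : False := by
  have h2 := hp.ncard_neighborSet_toSubgraph_eq_two hx
  have h3 : p.toSubgraph.neighborSet x ⊆ {y} := by
    intro w hw
    refine h w ?_ (p.toSubgraph.adj_sub hw)
    rw [← Walk.mem_verts_toSubgraph]
    exact p.toSubgraph.edge_vert hw.symm
  have := Set.ncard_le_ncard h3
  rw [h2, Set.ncard_singleton] at this
  omega

theorem ListsCaterpillar.not_isCycle {G : SimpleGraph V} {l : List V}
    (h : ListsCaterpillar G l) {v : V} {p : G.Walk v v} (hp : p.IsCycle)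
    (hl : ∀ w ∈ p.support, w ∈ l) : False := by
  induction h with
  | single x =>
    refine not_isCycle_of_unique_neighbor hp (x := x) (y := x) ?_ ?_
    · rw [← List.mem_singleton.1 (hl v p.start_mem_support)]
      exact p.start_mem_support
    · exact fun w hw _ => List.mem_singleton.1 (hl w hw)
  | @spine x y l hc hxy hx ih =>
    by_cases hxp : x ∈ p.support
    · refine not_isCycle_of_unique_neighbor hp hxp (y := y) fun w hw hxw => ?_
      have := hl w hw
      simp only [List.mem_cons] at this
      rcases this with rfl | rfl | hwl
      · exact absurd hxw (G.irrefl)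
      · rfl
      · exact absurd hxw (hx w hwl)
    · exact ih fun w hw => (List.mem_cons.1 (hl w hw)).resolve_left fun e => hxp (e ▸ hw)
  | @leaf x y l hc hxy hy ih =>
    by_cases hyp : y ∈ p.support
    · refine not_isCycle_of_unique_neighbor hp hyp (y := x) fun w hw hyw => ?_
      have := hl w hw
      simp only [List.mem_cons] at this
      rcases this with rfl | rfl | hwl
      · rfl
      · exact absurd hyw (G.irrefl)
      · exact absurd hyw (hy w hwl)
    · refine ih fun w hw => ?_
      have := hl w hw
      simp only [List.mem_cons] at this ⊢
      rcases this with h | rfl | h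
      · exact Or.inl h
      · exact absurd hw hyp
      · exact Or.inr h

open Classical in
/-- The spine of a listed caterpillar, indexed by an initial segment of `ℕ`. -/
theorem ListsCaterpillar.exists_spine {G : SimpleGraph V} {x : V} {l : List V}
    (hn : (x :: l).Nodup) (h : ListsCaterpillar G (x :: l)) :
    ∃ (g : V → ℕ) (S : Set V) (k : ℕ), x ∈ S ∧ (∀ a ∈ S, a ∈ x :: l) ∧ g x = 0 ∧
      (∀ a ∈ S, g a ≤ k) ∧ (∀ i ≤ k, ∃ a ∈ S, g a = i) ∧ Set.InjOn g S ∧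
      (∀ a ∈ S, ∀ b ∈ S, (G.Adj a b ↔ g a + 1 = g b ∨ g b + 1 = g a)) ∧
      ∀ w ∈ x :: l, w ∉ S → ∃ s ∈ S, G.Adj w s ∧ ∀ w' ∈ x :: l, G.Adj w w' → w' = s := by
  generalize hm : x :: l = m at h
  induction h generalizing x l with
  | single y =>
    obtain ⟨rfl, rfl⟩ := List.cons_eq_cons.1 hm
    refine ⟨fun _ => 0, {x}, 0, by simp, by simp, rfl, by simp, ?_, by simp, by simp, by simp⟩
    intro i hi
    exact ⟨x, rfl, (Nat.le_zero.1 hi).symm⟩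
  | @spine y z l' hc hyz hy ih =>
    obtain ⟨rfl, rfl⟩ := List.cons_eq_cons.1 hm
    obtain ⟨g, S, k, hzS, hSl, hgz, hk, hk', hinj, hadj, hleaf⟩ :=
      ih (List.nodup_cons.1 hn).2 rfl
    have hxS : x ∉ S := fun h => (List.nodup_cons.1 hn).1 (hSl x h)
    have hne : ∀ a ∈ S, a ≠ x := fun a ha e => hxS (e ▸ ha)
    have hxa : ∀ a ∈ S, (G.Adj x a ↔ g a = 0) := by
      intro a ha
      constructor
      · intro h
        rcases List.mem_cons.1 (hSl a ha) with rfl | hal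
        · exact hgz
        · exact absurd h (hy a hal)
      · intro h
        rwa [hinj ha hzS (h.trans hgz.symm)]
    refine ⟨fun w => if w = x then 0 else g w + 1, insert x S, k + 1, by simp, ?_, by simp, ?_, ?_,
      ?_, ?_, ?_⟩
    · rintro a (rfl | ha)
      · simp
      · exact List.mem_cons_of_mem _ (hSl a ha)
    · rintro a (rfl | ha)
      · simp
      · simp [hne a ha, hk a ha]
    · intro i hi
      rcases i with _ | i
      · exact ⟨x, by simp, by simp⟩
      · obtain ⟨a, ha, hga⟩ := hk' i (by omega)
        exact ⟨a, by simp [ha], by simp [hne a ha, hga]⟩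
    · rintro a (rfl | ha) b (rfl | hb) hab
      · rfl
      · simp [hne b hb] at hab
      · simp [hne a ha] at hab
      · simp only [hne a ha, hne b hb, if_false, add_left_inj] at hab
        exact hinj ha hb hab
    · rintro a (rfl | ha) b (rfl | hb)
      · simp
      · simp only [hne b hb, if_true, if_false, hxa b hb]
        omega
      · simp only [hne a ha, if_true, if_false, G.adj_comm a, hxa a ha]
        omega
      · simp only [hne a ha, hne b hb, if_false, hadj a ha b hb]
        omega
    · intro w hw hwS
      simp only [Set.mem_insert_iff, not_or] at hwS
      have hw' := (List.mem_cons.1 hw).resolve_left hwS.1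
      obtain ⟨s, hs, hws, huniq⟩ := hleaf w hw' hwS.2
      refine ⟨s, by simp [hs], hws, fun w' hwl' hww' => ?_⟩
      rcases List.mem_cons.1 hwl' with rfl | hwl'
      · rcases List.mem_cons.1 hw' with rfl | hwl
        · exact absurd hzS hwS.2
        · exact absurd hww'.symm (hy w hwl)
      · exact huniq w' hwl' hww'
  | @leaf y z l' hc hyz hz ih =>
    obtain ⟨rfl, rfl⟩ := List.cons_eq_cons.1 hm
    have hn' : (x :: l').Nodup := hn.sublist (by simp)
    obtain ⟨g, S, k, hxS, hSl, hgx, hk, hk', hinj, hadj, hleaf⟩ := ih hn' rfl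
    have hsub : ∀ a ∈ x :: l', a ∈ x :: z :: l' := by
      intro a ha
      simp only [List.mem_cons] at ha ⊢
      tauto
    refine ⟨g, S, k, hxS, fun a ha => hsub a (hSl a ha), hgx, hk, hk', hinj, hadj, ?_⟩
    intro w hw hwS
    have hwx : w ≠ x := fun e => hwS (e ▸ hxS)
    rcases List.mem_cons.1 ((List.mem_cons.1 hw).resolve_left hwx) with rfl | hwl
    · refine ⟨x, hxS, hyz.symm, fun w' hw' hww' => ?_⟩
      simp only [List.mem_cons] at hw'
      rcases hw' with rfl | rfl | hw'
      · rfl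
      · exact absurd hww' (G.irrefl)
      · exact absurd hww' (hz w' hw')
    · obtain ⟨s, hs, hws, huniq⟩ := hleaf w (by simp [hwl]) hwS
      refine ⟨s, hs, hws, fun w' hw' hww' => ?_⟩
      simp only [List.mem_cons] at hw'
      rcases hw' with rfl | rfl | hw'
      · exact huniq _ (by simp) hww'
      · exact absurd hww'.symm (hz w hwl)
      · exact huniq _ (by simp [hw']) hww'

theorem ListsCaterpillar.isCaterpillar [Finite V] {G : SimpleGraph V} {l : List V}
    (hn : l.Nodup) (hl : ∀ w, w ∈ l) (h : ListsCaterpillar G l) : G.IsCaterpillar := by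
  match l, h with
  | x :: l, h =>
    have : Nonempty V := ⟨x⟩
    refine ⟨⟨⟨?_⟩, ?_⟩, ?_⟩
    · exact fun a b => (h.reachable a (hl a)).symm.trans (h.reachable b (hl b))
    · exact fun v p hp => h.not_isCycle hp fun w _ => hl w
    · obtain ⟨g, S, k, -, -, -, hk, hk', hinj, hadj, hleaf⟩ := h.exists_spine hn
      have hNS : ∀ w, (G.neighborSet w).ncard ≠ 1 → w ∈ S := by
        intro w hw
        by_contra hwS
        obtain ⟨s, -, hws, huniq⟩ := hleaf w (hl w) hwS
        refine hw (Set.ncard_eq_one.2 ⟨s, ?_⟩)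
        ext w'
        exact ⟨fun h => huniq w' (hl w') h, fun h => by rw [h]; exact hws⟩
      refine isPathGraph_of_index (fun w => g w.1) ?_ ?_ ?_
      · intro a b hab
        exact Subtype.ext (hinj (hNS _ a.2) (hNS _ b.2) hab)
      · exact fun a b => hadj _ (hNS _ a.2) _ (hNS _ b.2)
      · intro a b t hat htb
        rcases hat.eq_or_lt with rfl | hat
        · exact ⟨a, rfl⟩
        rcases htb.eq_or_lt with rfl | htb
        · exact ⟨b, rfl⟩
        -- The ends of `S` may themselves be leaves of the tree, so only convexity is claimed: a
        -- position strictly between two others has spine neighbours on both sides and is not a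
        -- leaf.
        have hbk := hk b (hNS _ b.2)
        obtain ⟨c, hc, hgc⟩ := hk' t (by omega)
        obtain ⟨c₁, hc₁, hgc₁⟩ := hk' (t - 1) (by omega)
        obtain ⟨c₂, hc₂, hgc₂⟩ := hk' (t + 1) (by omega)
        refine ⟨⟨c, fun h1 => ?_⟩, hgc⟩
        obtain ⟨s, hs⟩ := Set.ncard_eq_one.1 h1
        have e1 : c₁ ∈ G.neighborSet c := (hadj c hc c₁ hc₁).2 (by omega)
        have e2 : c₂ ∈ G.neighborSet c := (hadj c hc c₂ hc₂).2 (by omega)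
        rw [hs] at e1 e2
        rw [Set.mem_singleton_iff] at e1 e2
        subst e1
        subst e2
        omega

/-- Local complementations of a path away from its end `0` extend to the path with one more
vertex. -/
theorem exists_extend_path {n : ℕ} {H : SimpleGraph (Fin (n + 1))}
    (h : LocallyEquivalentOn {i | i ≠ 0} (pathGraph (n + 1)) H) :
    ∃ H' : SimpleGraph (Fin (n + 2)),
      LocallyEquivalentOn {i | i ≠ 0} (pathGraph (n + 2)) H' ∧
      (∀ i j : Fin (n + 1), H'.Adj i.succ j.succ ↔ H.Adj i j) ∧
      ∀ j : Fin (n + 1), H'.Adj 0 j.succ ↔ j = 0 := by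
  induction h with
  | refl =>
    refine ⟨pathGraph (n + 2), .refl, ?_, ?_⟩
    · intro i j
      simp only [pathGraph_adj, Fin.val_succ]
      omega
    · intro j
      simp only [pathGraph_adj, Fin.val_succ, Fin.ext_iff, Fin.val_zero]
      omega
  | tail _ hs ih =>
    obtain ⟨x, hx, rfl⟩ := hs
    obtain ⟨H', h1, h2, h3⟩ := ih
    refine ⟨H'.localComplement x.succ, h1.localComplement (Fin.succ_ne_zero x), ?_, ?_⟩
    · intro i j
      simp [localComplement_adj, h2]
    · intro j
      have : ¬ H'.Adj x.succ 0 := fun h => hx ((h3 x).1 h.symm)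
      simp [localComplement_adj, h3, this, Xor, (Fin.succ_ne_zero j).symm]

-- Induction along the list, with the head kept at the end `0` of the path and all complementations
-- away from `0`, so that the path can be prolonged there. A new spine vertex prolongs the path by
-- one vertex. A new leaf prolongs it by two and uses a pivot.
open Classical in
theorem ListsCaterpillar.exists_path {G : SimpleGraph V} {x : V} {l : List V}
    (hn : (x :: l).Nodup) (h : ListsCaterpillar G (x :: l)) :
    ∃ (n : ℕ) (H : SimpleGraph (Fin (n + 1))) (φ : V → Fin (n + 1)),
      LocallyEquivalentOn {i | i ≠ 0} (pathGraph (n + 1)) H ∧ φ x = 0 ∧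
      Set.InjOn φ {w | w ∈ x :: l} ∧
      ∀ a ∈ x :: l, ∀ b ∈ x :: l, (H.Adj (φ a) (φ b) ↔ G.Adj a b) := by
  generalize hm : x :: l = m at h
  induction h generalizing x l with
  | single y =>
    obtain ⟨rfl, rfl⟩ := List.cons_eq_cons.1 hm
    refine ⟨0, pathGraph 1, fun _ => 0, .refl, rfl, ?_, ?_⟩
    · intro a ha b hb _
      exact (List.mem_singleton.1 ha).trans (List.mem_singleton.1 hb).symm
    · intro a ha b hb
      rw [List.mem_singleton.1 ha, List.mem_singleton.1 hb]
      simp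
  | @spine y z l' hc hyz hy ih =>
    obtain ⟨rfl, rfl⟩ := List.cons_eq_cons.1 hm
    obtain ⟨n, H, φ, hH, hφz, hinj, hadj⟩ := ih (List.nodup_cons.1 hn).2 rfl
    obtain ⟨H', hH', h2, h3⟩ := exists_extend_path hH
    have hne : ∀ a ∈ z :: l', a ≠ x := fun a ha e => (List.nodup_cons.1 hn).1 (e ▸ ha)
    have hxa : ∀ a ∈ z :: l', (φ a = 0 ↔ G.Adj x a) := by
      intro a ha
      rw [← hφz, hinj.eq_iff ha (show z ∈ {w | w ∈ z :: l'} by simp)]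
      constructor
      · rintro rfl
        exact hyz
      · intro h
        exact (List.mem_cons.1 ha).resolve_right fun hl => hy a hl h
    refine ⟨n + 1, H', fun w => if w = x then 0 else (φ w).succ, hH', by simp, ?_, ?_⟩
    · intro a ha b hb hab
      replace ha := List.mem_cons.1 ha
      replace hb := List.mem_cons.1 hb
      rcases ha with rfl | ha <;> rcases hb with rfl | hb
      · rfl
      · simp only [hne b hb, if_true, if_false] at hab
        exact absurd hab.symm (Fin.succ_ne_zero _)
      · simp only [hne a ha, if_true, if_false] at hab
        exact absurd hab (Fin.succ_ne_zero _)
      · simp only [hne a ha, hne b hb, if_false, Fin.succ_inj] at hab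
        exact hinj ha hb hab
    · intro a ha b hb
      replace ha := List.mem_cons.1 ha
      replace hb := List.mem_cons.1 hb
      rcases ha with rfl | ha <;> rcases hb with rfl | hb
      · simp
      · simp only [hne b hb, if_true, if_false, h3, hxa b hb]
      · simp only [hne a ha, if_true, if_false, H'.adj_comm _ 0, h3, hxa a ha, G.adj_comm a]
      · simp only [hne a ha, hne b hb, if_false, h2, hadj a ha b hb]
  | @leaf y z l' hc hyz hz ih =>
    obtain ⟨rfl, rfl⟩ := List.cons_eq_cons.1 hm
    have hn' : (x :: l').Nodup := hn.sublist (by simp)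
    obtain ⟨n, H, φ, hH, hφx, hinj, hadj⟩ := ih hn' rfl
    obtain ⟨H₁, hH₁, h2, h3⟩ := exists_extend_path hH
    obtain ⟨H₂, hH₂, h4, h5⟩ := exists_extend_path hH₁
    simp only [List.nodup_cons, List.mem_cons, not_or] at hn
    obtain ⟨⟨hxz, hxl⟩, hzl, hl⟩ := hn
    replace hxz : x ≠ z := hxz
    have hnx : ∀ a ∈ l', a ≠ x := fun a ha e => hxl (e ▸ ha)
    have hnz : ∀ a ∈ l', a ≠ z := fun a ha e => hzl (e ▸ ha)
    have hφ : ∀ a ∈ l', φ a ≠ 0 := fun a ha e => hnx a ha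
      (hinj (show a ∈ x :: l' by simp [ha]) (show x ∈ x :: l' by simp) (e.trans hφx.symm))
    have e01 : H₂.Adj 0 (Fin.succ 0) := (h5 0).2 rfl
    have e12 : H₂.Adj (Fin.succ 0) (Fin.succ (Fin.succ 0)) := (h4 _ _).2 ((h3 0).2 rfl)
    have n1 : ∀ i : Fin (n + 1), i ≠ 0 → ¬ H₂.Adj (Fin.succ 0) i.succ.succ := fun i hi h =>
      hi ((h3 i).1 ((h4 _ _).1 h))
    have n0 : ∀ i : Fin (n + 1), ¬ H₂.Adj 0 i.succ.succ := fun i h =>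
      Fin.succ_ne_zero _ ((h5 _).1 h)
    have d0 : ∀ i : Fin (n + 2), i.succ ≠ 0 := fun i => Fin.succ_ne_zero i
    have d1 : ∀ i : Fin (n + 1), i.succ.succ ≠ Fin.succ 0 := fun i h =>
      Fin.succ_ne_zero i (Fin.succ_injective _ h)
    have d2 : ∀ i : Fin (n + 1), i ≠ 0 → i.succ.succ ≠ (Fin.succ 0).succ := fun i hi h =>
      hi (Fin.succ_injective _ (Fin.succ_injective _ h))
    -- Before the pivot, the old head sits at position 2. Pivoting on positions 1 and 2 joins
    -- position 0 to the former neighbours of the head in `l'` and leaves position 2 adjacent to 0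
    -- and 1 only. With position 1 dropped, 0 is the head `x` and 2 is the leaf `z`.
    refine ⟨n + 2, H₂.pivot (Fin.succ 0) (Fin.succ (Fin.succ 0)),
      fun w => if w = x then 0 else if w = z then Fin.succ (Fin.succ 0) else (φ w).succ.succ,
      hH₂.pivot (d0 _) (d0 _), by simp, ?_, ?_⟩
    · intro a ha b hb hab
      simp only [Set.mem_ofPred_eq, List.mem_cons] at ha hb
      rcases ha with rfl | rfl | ha <;> rcases hb with rfl | rfl | hb
      · rfl
      · simp only [hxz.symm, if_true, if_false] at hab
        exact absurd hab.symm (d0 _)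
      · simp only [hnx b hb, hnz b hb, if_true, if_false] at hab
        exact absurd hab.symm (d0 _)
      · simp only [hxz.symm, if_true, if_false] at hab
        exact absurd hab (d0 _)
      · rfl
      · simp only [hxz.symm, hnx b hb, hnz b hb, if_true, if_false] at hab
        exact absurd hab.symm (d2 _ (hφ b hb))
      · simp only [hnx a ha, hnz a ha, if_true, if_false] at hab
        exact absurd hab (d0 _)
      · simp only [hxz.symm, hnx a ha, hnz a ha, if_true, if_false] at hab
        exact absurd hab (d2 _ (hφ a ha))
      · simp only [hnx a ha, hnz a ha, hnx b hb, hnz b hb, if_false, Fin.succ_inj] at hab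
        exact hinj (by simp [ha]) (by simp [hb]) hab
    · have pxz : (H₂.pivot (Fin.succ 0) (Fin.succ (Fin.succ 0))).Adj (Fin.succ (Fin.succ 0)) 0 :=
        (pivot_adj_right e12 (d0 _).symm (d0 _).symm).2 e01.symm
      have pxa : ∀ a ∈ l', (H₂.pivot (Fin.succ 0) (Fin.succ (Fin.succ 0))).Adj 0 (φ a).succ.succ ↔
          G.Adj x a := by
        intro a ha
        rw [pivot_adj_of_ne e12 (d0 _).symm (d0 _).symm (d1 _) (d2 _ (hφ a ha)) (d0 _).symm,
          h4, h2]
        have hxa : H.Adj 0 (φ a) ↔ G.Adj x a := by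
          rw [← hφx, hadj x (by simp) a (by simp [ha])]
        simp only [n0, e01.symm, n1 _ (hφ a ha), hxa, Xor, and_false, true_and, not_false_eq_true,
          and_true, or_false, false_or, false_and]
      have pza : ∀ a ∈ l', ¬ (H₂.pivot (Fin.succ 0) (Fin.succ (Fin.succ 0))).Adj
          (Fin.succ (Fin.succ 0)) (φ a).succ.succ := by
        intro a ha
        rw [pivot_adj_right e12 (d1 _) (d2 _ (hφ a ha))]
        exact n1 _ (hφ a ha)
      intro a ha b hb
      simp only [List.mem_cons] at ha hb
      rcases ha with rfl | rfl | ha <;> rcases hb with rfl | rfl | hb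
      · simp
      · simp only [hxz.symm, if_true, if_false, pxz.symm, hyz]
      · simp only [hnx b hb, hnz b hb, if_true, if_false, pxa b hb]
      · simp only [hxz.symm, if_true, if_false, pxz, hyz.symm]
      · simp
      · simp only [hxz.symm, hnx b hb, hnz b hb, if_true, if_false, pza b hb, hz b hb]
      · simp only [hnx a ha, hnz a ha, if_true, if_false]
        rw [adj_comm, pxa a ha, adj_comm]
      · simp only [hxz.symm, hnx a ha, hnz a ha, if_true, if_false]
        rw [adj_comm, G.adj_comm]
        exact iff_of_false (pza a ha) (hz a ha)
      · simp only [hnx a ha, hnz a ha, hnx b hb, hnz b hb, if_false]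
        by_cases hab : a = b
        · subst hab
          simp
        · rw [pivot_adj_of_ne e12 (d1 _) (d2 _ (hφ a ha)) (d1 _) (d2 _ (hφ b hb)), h4, h2,
            hadj a (by simp [ha]) b (by simp [hb])]
          · simp only [n1 _ (hφ a ha), n1 _ (hφ b hb), Xor, and_false, false_and, or_false,
              not_false_eq_true, and_true]
          · intro e
            exact hab (hinj (by simp [ha]) (by simp [hb]) (by simpa using e))

theorem ListsCaterpillar.isVertexMinor_pathGraph {G : SimpleGraph V} {l : List V}
    (hn : l.Nodup) (hl : ∀ w, w ∈ l) (h : ListsCaterpillar G l) :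
    ∃ n, G.IsVertexMinor (pathGraph n) := by
  match l, h with
  | x :: l, h =>
    obtain ⟨n, H, φ, hH, -, hinj, hadj⟩ := h.exists_path hn
    exact ⟨n + 1, H, hH.locallyEquivalent, ⟨⟨⟨φ, fun a b hab => hinj (hl a) (hl b) hab⟩,
      fun {a b} => hadj a (hl a) b (hl b)⟩⟩⟩

theorem HasThinOrder.exists_isCaterpillar [Finite V] {G : SimpleGraph V} (hG : G.Connected)
    (h : G.HasThinOrder) : ∃ T : SimpleGraph V, T.IsCaterpillar ∧ G.LocallyEquivalent T := by
  obtain ⟨l, hn, hl, ht⟩ := h.exists_thinList hG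
  obtain ⟨v⟩ := hG.nonempty
  obtain ⟨T, hGT, hT⟩ := ht.exists_listsCaterpillar (List.ne_nil_of_mem (hl v)) hn
  exact ⟨T, hT.isCaterpillar hn hl, hGT.locallyEquivalent⟩

theorem HasThinOrder.exists_isVertexMinor_pathGraph [Finite V] {G : SimpleGraph V}
    (hG : G.Connected) (h : G.HasThinOrder) : ∃ n, G.IsVertexMinor (pathGraph n) := by
  obtain ⟨l, hn, hl, ht⟩ := h.exists_thinList hG
  obtain ⟨v⟩ := hG.nonempty
  obtain ⟨T, hGT, hT⟩ := ht.exists_listsCaterpillar (List.ne_nil_of_mem (hl v)) hn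
  obtain ⟨n, hn⟩ := hT.isVertexMinor_pathGraph hn hl
  exact ⟨n, (IsVertexMinor.of_locallyEquivalent (IsVertexMinor.of_embedding Embedding.refl)
    hGT.locallyEquivalent).trans hn⟩

theorem hasThinOrder_pathGraph (n : ℕ) : (pathGraph n).HasThinOrder := by
  refine ⟨Fin.val, Fin.val_injective, fun t a a' b b' ha ha' hb hb' hab hab' => ?_⟩
  rw [pathGraph_adj] at *
  simp only [Set.mem_ofPred_eq] at *
  omega

/-- Order the spine along the path and put every leaf right after its neighbour: spine vertices get
even values of `g`, leaves the next odd value. All edges across an initial cut then have the same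
left end. -/
theorem IsCaterpillar.hasThinOrder [Finite V] {T : SimpleGraph V} (h : T.IsCaterpillar) :
    T.HasThinOrder := by
  classical
  have := Fintype.ofFinite V
  obtain ⟨hT, n, ⟨φ⟩⟩ := h
  set N : Set V := {x | (T.neighborSet x).ncard ≠ 1} with hN
  have hleaf : ∀ x ∉ N, ∃ s, T.neighborSet x = {s} := fun x hx =>
    Set.ncard_eq_one.1 (not_not.1 hx)
  choose! nb hnb using hleaf
  have hnb' : ∀ x ∉ N, ∀ y, T.Adj x y → y = nb x := fun x hx y hxy => by
    have : y ∈ T.neighborSet x := hxy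
    rwa [hnb x hx] at this
  let idx := Fintype.equivFin V
  -- Two adjacent leaves make up the whole tree. This case is separate because a leaf then has no
  -- neighbour on the spine.
  by_cases hK : ∃ a ∉ N, ∃ b ∉ N, T.Adj a b
  · obtain ⟨a, ha, b, hb, hab⟩ := hK
    have hall : ∀ w, w = a ∨ w = b := by
      intro w
      by_contra hw
      obtain ⟨x, hx, y, hy, hxy⟩ := hT.connected.exists_adj_mem_notMem (X := {a, b}) (a := a)
        (b := w) (by simp) hw
      rcases hx with rfl | rfl
      · exact hy (by simp [(hnb' _ ha y hxy).trans (hnb' _ ha b hab).symm])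
      · exact hy (by simp [(hnb' _ hb y hxy).trans (hnb' _ hb a hab.symm).symm])
    refine ⟨fun x => idx x, fun x y h => idx.injective (Fin.ext h), fun t => ?_⟩
    intro x x' y y' hx hx' hy hy' _ hxy'
    have h1 : x ≠ y := fun e => hy (e ▸ hx)
    have h2 : x' ≠ y := fun e => hy (e ▸ hx')
    have : x = x' := by
      rcases hall x with rfl | rfl <;> rcases hall x' with rfl | rfl <;>
        rcases hall y with rfl | rfl <;> tauto
    rwa [this]
  · push Not at hK
    let pos : V → ℕ := fun x => if hx : x ∈ N then φ ⟨x, hx⟩ else 0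
    have hpos : ∀ x ∈ N, ∀ y ∈ N, pos x = pos y → x = y := by
      intro x hx y hy h
      simp only [pos, hx, hy, dif_pos] at h
      exact Subtype.ext_iff.1 (φ.injective (Fin.ext h))
    have hposadj : ∀ x ∈ N, ∀ y ∈ N, T.Adj x y → pos x + 1 = pos y ∨ pos y + 1 = pos x := by
      intro x hx y hy h
      have h1 : (T.induce N).Adj ⟨x, hx⟩ ⟨y, hy⟩ := h
      rw [← φ.map_adj_iff, pathGraph_adj] at h1
      simpa only [pos, hx, hy, dif_pos] using h1
    let g : V → ℕ := fun x => if x ∈ N then 2 * pos x else 2 * pos (nb x) + 1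
    have hgN : ∀ x ∈ N, g x = 2 * pos x := fun x hx => by simp [g, hx]
    have hgL : ∀ x ∉ N, g x = 2 * pos (nb x) + 1 := fun x hx => by simp [g, hx]
    have hedge : ∀ a b, T.Adj a b → g a ≤ g b →
        a ∈ N ∧ (g b = g a + 1 ∨ b ∈ N ∧ g b = g a + 2) := by
      intro a b hab hle
      by_cases ha : a ∈ N
      · refine ⟨ha, ?_⟩
        by_cases hb : b ∈ N
        · have := hposadj a ha b hb hab
          rw [hgN a ha, hgN b hb] at *
          right
          refine ⟨hb, ?_⟩
          omega
        · left
          rw [hgN a ha, hgL b hb, ← hnb' b hb a hab.symm]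
      · have hb : b ∈ N := by
          by_contra hb
          exact hK a ha b hb hab
        rw [hgL a ha, ← hnb' a ha b hab, hgN b hb] at hle
        omega
    -- Leaves at the same spine vertex share the value of `g`; the enumeration `idx` breaks ties
    -- lexicographically.
    refine ⟨fun x => Fintype.card V * g x + idx x, ?_, fun t => ?_⟩
    · intro x y h
      have h1 := congrArg (· % Fintype.card V) h
      simp only [Nat.mul_add_mod, Nat.mod_eq_of_lt (idx x).2, Nat.mod_eq_of_lt (idx y).2] at h1
      exact idx.injective (Fin.ext h1)
    · have hlt : ∀ x y, g x < g y →
          Fintype.card V * g x + idx x < Fintype.card V * g y + idx y := by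
        intro x y h
        have := Nat.mul_le_mul_left (Fintype.card V) (show g x + 1 ≤ g y from h)
        have := (idx x).2
        rw [mul_add, mul_one] at *
        omega
      have hle : ∀ x y, Fintype.card V * g x + idx x < Fintype.card V * g y + idx y →
          g x ≤ g y := by
        intro x y h
        by_contra h'
        have := hlt y x (by omega)
        omega
      have key : ∀ a a' b b', Fintype.card V * g a + idx a ≤ t → Fintype.card V * g a' + idx a' ≤ t
          → t < Fintype.card V * g b + idx b → t < Fintype.card V * g b' + idx b' →
          T.Adj a b → T.Adj a' b' → g a ≤ g a' → a = a' := by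
        intro a a' b b' ha ha' hb hb' hab hab' haa'
        obtain ⟨haN, hgb⟩ := hedge a b hab (hle _ _ (by omega))
        obtain ⟨haN', -⟩ := hedge a' b' hab' (hle _ _ (by omega))
        rcases haa'.eq_or_lt with h | h
        · rw [hgN _ haN, hgN _ haN'] at h
          exact hpos a haN a' haN' (by omega)
        · exfalso
          have h1 : g a' ≤ g b := by
            by_contra h2
            have := hlt b a' (by omega)
            omega
          rw [hgN _ haN, hgN _ haN'] at *
          rcases hgb with hgb | ⟨hbN, hgb⟩
          · omega
          · rw [hgN _ hbN] at *
            obtain rfl := hpos b hbN a' haN' (by omega)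
            omega
      intro a a' b b' ha ha' hb hb' hab hab'
      simp only [Set.mem_ofPred_eq, not_le] at ha ha' hb hb'
      have : a = a' := by
        rcases le_total (g a) (g a') with h | h
        · exact key a a' b b' ha ha' hb hb' hab hab' h
        · exact (key a' a b' b ha' ha hb' hb hab' hab h).symm
      rwa [this]

end Caterpillar

end SimpleGraph

namespace SimpleGraph

/-! ### The three obstructions have no thin order. -/

section Obstructions

variable {V : Type u} {W : Type v}

theorem HasThinOrder.exists_thinCut_card [Fintype V] {G : SimpleGraph V}
    (h : G.HasThinOrder) {k : ℕ} (hk : k ≤ Fintype.card V) :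
    ∃ S : Finset V, S.card = k ∧ G.ThinCut (S : Set V) := by
  classical
  obtain ⟨f, hf, h⟩ := h
  suffices ∃ S : Finset V, S.card = k ∧ ∀ a ∈ S, ∀ b ∉ S, f a < f b by
    obtain ⟨S, hS, hS'⟩ := this
    refine ⟨S, hS, fun a a' b b' ha ha' hb hb' => ?_⟩
    have h1 := hS' a ha b hb
    have h2 := hS' a ha b' hb'
    have h3 := hS' a' ha' b hb
    have h4 := hS' a' ha' b' hb'
    exact h (max (f a) (f a')) (by simp) (by simp) (by simp; omega) (by simp; omega)
  induction k with
  | zero => exact ⟨∅, by simp⟩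
  | succ k ih =>
    obtain ⟨S, hS, hS'⟩ := ih (by omega)
    have hne : Sᶜ.Nonempty := by
      rw [← Finset.card_pos, Finset.card_compl]
      omega
    obtain ⟨x, hx, hmin⟩ := Finset.exists_min_image Sᶜ f hne
    rw [Finset.mem_compl] at hx
    refine ⟨insert x S, by rw [Finset.card_insert_of_notMem hx, hS], ?_⟩
    intro a ha b hb
    rw [Finset.mem_insert, not_or] at hb
    rcases Finset.mem_insert.1 ha with rfl | ha
    · have h1 := hmin b (by simpa using hb.2)
      have h2 : f b ≠ f a := fun e => hb.1 (hf e)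
      omega
    · exact hS' a ha b hb.2

/-- A thin order has a thin initial segment of each size, so it suffices to refute all vertex sets
of one size `k`, a finite check. -/
theorem not_hasThinOrder_of_forall_card {n : ℕ} {G : SimpleGraph (Fin n)} [DecidableRel G.Adj]
    {k : ℕ} (hk : k ≤ n)
    (h : ∀ S ∈ (Finset.univ : Finset (Fin n)).powersetCard k, ∃ a ∈ S, ∃ a' ∈ S, ∃ b ∉ S, ∃ b' ∉ S,
      G.Adj a b ∧ G.Adj a' b' ∧ ¬ G.Adj a b') : ¬ G.HasThinOrder := by
  intro hG
  obtain ⟨S, hS, hthin⟩ := hG.exists_thinCut_card (k := k) (by simpa using hk)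
  obtain ⟨a, ha, a', ha', b, hb, b', hb', h1, h2, h3⟩ := h S (by simp [hS])
  exact h3 (hthin ha ha' hb hb' h1 h2)

instance : DecidableRel netGraph.Adj := fun i j => decidable_of_iff
  ((s(i, j) = s(0, 1) ∨ s(i, j) = s(1, 2) ∨ s(i, j) = s(0, 2) ∨ s(i, j) = s(0, 3) ∨
    s(i, j) = s(1, 4) ∨ s(i, j) = s(2, 5)) ∧ i ≠ j) (by
  rw [netGraph, fromEdgeSet_adj]
  rfl)

instance : DecidableRel co3K2.Adj := fun i j => decidable_of_iff
  (i ≠ j ∧ ¬ ((s(i, j) = s(0, 1) ∨ s(i, j) = s(2, 3) ∨ s(i, j) = s(4, 5)) ∧ i ≠ j)) (by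
  rw [co3K2, compl_adj, fromEdgeSet_adj]
  rfl)

theorem not_hasThinOrder_cycleGraph : ¬ (cycleGraph 5).HasThinOrder :=
  not_hasThinOrder_of_forall_card (k := 2) (by omega) (by decide)

theorem not_hasThinOrder_netGraph : ¬ netGraph.HasThinOrder :=
  not_hasThinOrder_of_forall_card (k := 3) (by omega) (by decide +kernel)

theorem not_hasThinOrder_co3K2 : ¬ co3K2.HasThinOrder :=
  not_hasThinOrder_of_forall_card (k := 3) (by omega) (by decide +kernel)

end Obstructions

/-! ### Bad paths, the 5-cycle and distance heredity. -/

section BadPath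

variable {V : Type u} {W : Type v}

/-- An induced path `c 0, …, c m` with at least one edge that avoids the closed neighbourhood of
`v`, together with neighbours `u` and `u'` of `v`, such that `c 0` is the only neighbour of `u` on
the path, and `c m` and possibly `c 0` are the only neighbours of `u'` on the path. -/
structure IsBadPath (G : SimpleGraph V) (v u u' : V) (m : ℕ) (c : ℕ → V) : Prop where
  pos : 1 ≤ m
  adj_u : G.Adj v u
  adj_u' : G.Adj v u'
  ne : ∀ i ≤ m, c i ≠ v
  not_adj : ∀ i ≤ m, ¬ G.Adj v (c i)
  inj : ∀ i ≤ m, ∀ j ≤ m, c i = c j → i = j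
  adj : ∀ i ≤ m, ∀ j ≤ m, (G.Adj (c i) (c j) ↔ i + 1 = j ∨ j + 1 = i)
  u_adj : ∀ i ≤ m, (G.Adj u (c i) ↔ i = 0)
  u'_adj : G.Adj u' (c m)
  u'_not_adj : ∀ i, 0 < i → i < m → ¬ G.Adj u' (c i)

/-- No bad path occurs in `G`. -/
def NoBadPath (G : SimpleGraph V) : Prop := ∀ v u u' m c, ¬ G.IsBadPath v u u' m c

theorem NoBadPath.of_embedding {G : SimpleGraph V} {H : SimpleGraph W} (e : H ↪g G)
    (h : G.NoBadPath) : H.NoBadPath := by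
  intro v u u' m c hc
  refine h (e v) (e u) (e u') m (fun i => e (c i)) ⟨hc.pos, ?_, ?_, ?_, ?_, ?_, ?_, ?_, ?_, ?_⟩
  · simpa using hc.adj_u
  · simpa using hc.adj_u'
  · simpa using hc.ne
  · simpa using hc.not_adj
  · simpa using hc.inj
  · simpa using hc.adj
  · simpa using hc.u_adj
  · simpa using hc.u'_adj
  · simpa using hc.u'_not_adj

theorem isVertexMinor_cycleGraph_of_adj {G : SimpleGraph V} {v u a b u' : V} (h1 : G.Adj v u)
    (h2 : G.Adj u a) (h3 : G.Adj a b) (h4 : G.Adj b u') (h5 : G.Adj u' v) (n1 : ¬ G.Adj v a)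
    (n2 : ¬ G.Adj v b) (n3 : ¬ G.Adj u b) (n4 : ¬ G.Adj u u') (n5 : ¬ G.Adj a u') :
    (cycleGraph 5).IsVertexMinor G := by
  have hadj : ∀ i j : Fin 5, G.Adj (![v, u, a, b, u'] i) (![v, u, a, b, u'] j) ↔
      (cycleGraph 5).Adj i j := by
    have e : ∀ i j : Fin 5, (cycleGraph 5).Adj i j ↔ decide ((cycleGraph 5).Adj i j) = true := by
      simp
    intro i j
    rw [e]
    fin_cases i <;> fin_cases j <;>
      first
      | exact iff_of_true h1 (by decide)
      | exact iff_of_true h2 (by decide)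
      | exact iff_of_true h3 (by decide)
      | exact iff_of_true h4 (by decide)
      | exact iff_of_true h5 (by decide)
      | exact iff_of_true h1.symm (by decide)
      | exact iff_of_true h2.symm (by decide)
      | exact iff_of_true h3.symm (by decide)
      | exact iff_of_true h4.symm (by decide)
      | exact iff_of_true h5.symm (by decide)
      | exact iff_of_false (G.irrefl) (by decide)
      | exact iff_of_false n1 (by decide)
      | exact iff_of_false n2 (by decide)
      | exact iff_of_false n3 (by decide)
      | exact iff_of_false n4 (by decide)
      | exact iff_of_false n5 (by decide)
      | exact iff_of_false (fun h => n1 h.symm) (by decide)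
      | exact iff_of_false (fun h => n2 h.symm) (by decide)
      | exact iff_of_false (fun h => n3 h.symm) (by decide)
      | exact iff_of_false (fun h => n4 h.symm) (by decide)
      | exact iff_of_false (fun h => n5 h.symm) (by decide)
  refine IsVertexMinor.of_embedding ⟨⟨![v, u, a, b, u'], ?_⟩, fun {i j} => hadj i j⟩
  intro i j hij
  -- Injectivity is automatic: no two vertices of the 5-cycle have the same neighbours.
  have key : ∀ i j : Fin 5, (∀ k, (cycleGraph 5).Adj i k ↔ (cycleGraph 5).Adj j k) → i = j := by
    decide
  refine key i j fun k => ?_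
  rw [← hadj, ← hadj, hij]

/-- For `m ≥ 2`, complementing at `c 1` joins `c 0` to `c 2`, and dropping `c 1` gives a shorter bad
path. For `m = 1`, the five vertices form a 5-cycle up to the possible chords `uu'` and `c 0 u'`;
complementing at `v` deletes the first and at `c 1` the second. -/
theorem IsBadPath.isVertexMinor_cycleGraph {G : SimpleGraph V} {v u u' : V} {m : ℕ} {c : ℕ → V}
    (h : G.IsBadPath v u u' m c) : (cycleGraph 5).IsVertexMinor G := by
  induction hk : m generalizing G m c with
  | zero =>
    have := h.pos
    omega
  | succ k ih =>
    have hlc : ∀ x, (cycleGraph 5).IsVertexMinor (G.localComplement x) →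
        (cycleGraph 5).IsVertexMinor G := fun x hx => hx.of_locallyEquivalent
      (LocallyEquivalent.symm (LocallyEquivalent.localComplement .refl x))
    have hvu := h.adj_u
    have hvu' := h.adj_u'
    rcases k with _ | k
    · subst hk
      have hva := h.not_adj 0 (by omega)
      have hvb := h.not_adj 1 (by omega)
      have hab := (h.adj 0 (by omega) 1 (by omega)).2 (by omega)
      have hua := (h.u_adj 0 (by omega)).2 rfl
      have hub : ¬ G.Adj u (c 1) := fun e => by simpa using (h.u_adj 1 (by omega)).1 e
      have hub' := h.u'_adj
      have hva' := h.ne 0 (by omega)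
      have hvb' := h.ne 1 (by omega)
      simp only [zero_add] at *
      generalize c 0 = a at *
      generalize c 1 = b at *
      clear h ih
      have hlcG : ∀ {G' : SimpleGraph V} (x), (cycleGraph 5).IsVertexMinor (G'.localComplement x) →
        (cycleGraph 5).IsVertexMinor G' := fun x hx => hx.of_locallyEquivalent
          (LocallyEquivalent.symm (LocallyEquivalent.localComplement .refl x))
      by_cases e1 : G.Adj u u' <;> by_cases e2 : G.Adj a u'
      · have hne := e2.ne
        refine hlcG v (hlcG b (isVertexMinor_cycleGraph_of_adj (v := v) (u := u) (a := a) (b := b)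
          (u' := u') ?_ ?_ ?_ ?_ ?_ ?_ ?_ ?_ ?_ ?_)) <;>
        simp [localComplement_adj, Xor, hvu, hvu', hva, hvb, hab, hua, hub, e1, e2, hvu.ne,
          hvu'.ne', hua.ne, hab.ne, hab.ne', hub'.ne', hub'.symm, hab.symm, hvu'.symm,
          G.adj_comm b, e1.ne, hne, hva'.symm, hvb', hvb'.symm]
      · refine hlcG v (isVertexMinor_cycleGraph_of_adj (v := v) (u := u) (a := a) (b := b)
          (u' := u') ?_ ?_ ?_ ?_ ?_ ?_ ?_ ?_ ?_ ?_) <;>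
        simp [localComplement_adj, Xor, hvu, hvu', hva, hvb, hab, hua, hub, e1, e2, hvu.ne,
          hvu'.ne', hua.ne, hab.ne, hub'.ne', hub'.symm, hvu'.symm]
      · refine hlcG b (isVertexMinor_cycleGraph_of_adj (v := v) (u := u) (a := a) (b := b)
          (u' := u') ?_ ?_ ?_ ?_ ?_ ?_ ?_ ?_ ?_ ?_) <;>
        simp [localComplement_adj, Xor, hvu, hva, hab, hua, hub, e1, e2, hvu.ne,
          hvu'.ne', hua.ne, hab.ne, hub'.ne', hub'.symm, hab.symm, hvu'.symm,
          G.adj_comm b, hvb]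
      · exact isVertexMinor_cycleGraph_of_adj hvu hua hab hub'.symm hvu'.symm hva hvb hub e1 e2
    · subst hk
      refine hlc (c 1) (ih (m := k + 1) (c := fun i => if i = 0 then c 0 else c (i + 1)) ?_ rfl)
      have hc1v : ¬ G.Adj (c 1) v := fun e => h.not_adj 1 (by omega) e.symm
      have hc1u : ¬ G.Adj (c 1) u := fun e => by simpa using (h.u_adj 1 (by omega)).1 e.symm
      have hc1u' : ¬ G.Adj (c 1) u' := fun e => h.u'_not_adj 1 (by omega) (by omega) e.symm
      have key : ∀ {x y : V}, ¬ G.Adj (c 1) x → ((G.localComplement (c 1)).Adj x y ↔ G.Adj x y) := by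
        intro x y hx
        simp only [localComplement_adj, hx, Xor, false_and, not_false_eq_true, and_true, or_false]
        exact ⟨fun h => h.2, fun h => ⟨h.ne, h⟩⟩
      constructor
      · omega
      · exact (key hc1v).2 h.adj_u
      · exact (key hc1v).2 h.adj_u'
      · intro i hi
        split_ifs
        · exact h.ne 0 (by omega)
        · exact h.ne _ (by omega)
      · intro i hi
        rw [key hc1v]
        split_ifs
        · exact h.not_adj 0 (by omega)
        · exact h.not_adj _ (by omega)
      · intro i hi j hj hij
        have hinj := h.inj
        split_ifs at hij with h1 h2 h2
        · omega
        · have := hinj _ (by omega) _ (by omega) hij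
          omega
        · have := hinj _ (by omega) _ (by omega) hij
          omega
        · have := hinj _ (by omega) _ (by omega) hij
          omega
      · have hadj := h.adj
        have hinj := h.inj
        intro i hi j hj
        split_ifs with h1 h2 h2
        · simp [h1, h2]
        · have h3 : c 0 ≠ c (j + 1) := fun e => by
            have := hinj _ (by omega) _ (by omega) e
            omega
          rw [localComplement_adj, hadj 0 (by omega) (j + 1) (by omega),
            hadj 1 (by omega) 0 (by omega), hadj 1 (by omega) (j + 1) (by omega)]
          unfold Xor
          simp only [ne_eq, h3, not_false_eq_true, or_true, true_and]
          omega
        · have h3 : c (i + 1) ≠ c 0 := fun e => by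
            have := hinj _ (by omega) _ (by omega) e
            omega
          rw [localComplement_adj, hadj (i + 1) (by omega) 0 (by omega),
            hadj 1 (by omega) 0 (by omega), hadj 1 (by omega) (i + 1) (by omega)]
          unfold Xor
          simp only [ne_eq, h3, not_false_eq_true, or_true, true_and, and_true]
          omega
        · by_cases hij : i = j
          · subst hij
            simp
          · have h3 : c (i + 1) ≠ c (j + 1) := fun e => by
              have := hinj _ (by omega) _ (by omega) e
              omega
            rw [localComplement_adj, hadj (i + 1) (by omega) (j + 1) (by omega),
              hadj 1 (by omega) (j + 1) (by omega), hadj 1 (by omega) (i + 1) (by omega)]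
            unfold Xor
            simp only [ne_eq, h3, not_false_eq_true, true_and]
            omega
      · intro i hi
        rw [key hc1u]
        split_ifs with h1
        · rw [h.u_adj 0 (by omega)]
          simp [h1]
        · rw [h.u_adj _ (by omega)]
          omega
      · rw [key hc1u', if_neg (by omega)]
        exact h.u'_adj
      · intro i hi hi'
        rw [key hc1u', if_neg (by omega)]
        exact h.u'_not_adj _ (by omega) (by omega)

theorem noBadPath_of_not_isVertexMinor {G : SimpleGraph V}
    (h : ¬ (cycleGraph 5).IsVertexMinor G) : G.NoBadPath :=
  fun _ _ _ _ _ hc => h hc.isVertexMinor_cycleGraph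

theorem length_walk_pathGraph {n : ℕ} {i j : Fin n} (p : (pathGraph n).Walk i j) :
    (j : ℕ) ≤ i + p.length := by
  induction p with
  | nil => simp
  | cons h p ih =>
    rw [pathGraph_adj] at h
    rw [Walk.length_cons]
    omega

theorem dist_pathGraph {n : ℕ} {i j : Fin n} (hij : i ≤ j) :
    (pathGraph n).dist i j = j - i := by
  apply le_antisymm
  · obtain ⟨j, hj⟩ := j
    induction j with
    | zero =>
      have : i = ⟨0, hj⟩ := Fin.ext (by have := Fin.le_def.1 hij; simpa using this)
      simp [this]
    | succ j ih =>
      have hij' := Fin.le_def.1 hij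
      dsimp only at hij'
      rcases hij'.eq_or_lt with h | h
      · have : i = ⟨j + 1, hj⟩ := Fin.ext h
        simp [this]
      · have h1 := ih (by omega) (by rw [Fin.le_def]; dsimp only; omega)
        have hadj : (pathGraph n).Adj ⟨j, by omega⟩ ⟨j + 1, hj⟩ := by simp [pathGraph_adj]
        obtain ⟨p, hp⟩ := (pathGraph_preconnected n i ⟨j, by omega⟩).exists_walk_length_eq_dist
        have := dist_le (p.concat hadj)
        rw [Walk.length_concat, hp] at this
        dsimp only at *
        omega
  · obtain ⟨p, hp⟩ := (pathGraph_preconnected n i j).exists_walk_length_eq_dist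
    have := length_walk_pathGraph p
    omega

/-- The vertices `v, u, c 0, …, c m` form an induced path of length `m + 2 ≥ 3`, while `u'` shows
that its ends have distance at most two. -/
theorem IsDistanceHereditary.noBadPath {G : SimpleGraph V} (h : G.IsDistanceHereditary) :
    G.NoBadPath := by
  intro v u u' m c hc
  have hpos := hc.pos
  have hinj := hc.inj
  have hadj := hc.adj
  have huadj := hc.u_adj
  have hne := hc.ne
  have hvc := hc.not_adj
  let f : Fin (m + 3) → V := fun i => if i.1 = 0 then v else if i.1 = 1 then u else c (i.1 - 2)
  have f0 : ∀ i : Fin (m + 3), i.1 = 0 → f i = v := fun i hi => if_pos hi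
  have f1 : ∀ i : Fin (m + 3), i.1 = 1 → f i = u := fun i hi =>
    (if_neg (by omega)).trans (if_pos hi)
  have f2 : ∀ i : Fin (m + 3), 2 ≤ i.1 → f i = c (i.1 - 2) := fun i hi => by
    simp only [f]
    rw [if_neg (by omega), if_neg (by omega)]
  have huc : ∀ i ≤ m, c i ≠ u := fun i hi e => hvc i hi (e ▸ hc.adj_u)
  have h3 : ∀ i : Fin (m + 3), i.1 = 0 ∨ i.1 = 1 ∨ 2 ≤ i.1 := fun i => by omega
  have fadj : ∀ i j, G.Adj (f i) (f j) ↔ (pathGraph (m + 3)).Adj i j := by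
    intro i j
    rw [pathGraph_adj]
    rcases h3 i with hi | hi | hi <;> rcases h3 j with hj | hj | hj
    · rw [f0 i hi, f0 j hj]
      simp [hi, hj]
    · rw [f0 i hi, f1 j hj]
      simp [hi, hj, hc.adj_u]
    · rw [f0 i hi, f2 j hj]
      refine iff_of_false (hvc _ (by omega)) (by omega)
    · rw [f1 i hi, f0 j hj]
      simp [hi, hj, hc.adj_u.symm]
    · rw [f1 i hi, f1 j hj]
      simp [hi, hj]
    · rw [f1 i hi, f2 j hj, huadj _ (by omega)]
      omega
    · rw [f2 i hi, f0 j hj]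
      refine iff_of_false (fun e => hvc _ (by omega) e.symm) (by omega)
    · rw [f2 i hi, f1 j hj, G.adj_comm, huadj _ (by omega)]
      omega
    · rw [f2 i hi, f2 j hj, hadj _ (by omega) _ (by omega)]
      omega
  have finj : Function.Injective f := by
    intro i j hij
    rw [Fin.ext_iff]
    rcases h3 i with hi | hi | hi <;> rcases h3 j with hj | hj | hj
    · omega
    · rw [f0 i hi, f1 j hj] at hij
      exact absurd hij hc.adj_u.ne
    · rw [f0 i hi, f2 j hj] at hij
      exact absurd hij.symm (hne _ (by omega))
    · rw [f1 i hi, f0 j hj] at hij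
      exact absurd hij.symm hc.adj_u.ne
    · omega
    · rw [f1 i hi, f2 j hj] at hij
      exact absurd hij.symm (huc _ (by omega))
    · rw [f2 i hi, f0 j hj] at hij
      exact absurd hij (hne _ (by omega))
    · rw [f2 i hi, f1 j hj] at hij
      exact absurd hij (huc _ (by omega))
    · rw [f2 i hi, f2 j hj] at hij
      have := hinj _ (by omega) _ (by omega) hij
      omega
  have hd := h (m + 3) ⟨⟨f, finj⟩, fun {i j} => fadj i j⟩ 0 (Fin.last _)
  rw [dist_pathGraph (Fin.zero_le _)] at hd
  change G.dist (f 0) (f (Fin.last _)) = _ at hd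
  rw [f0 0 rfl, f2 (Fin.last _) (by simp)] at hd
  have := dist_le (Walk.cons hc.adj_u' (Walk.cons hc.u'_adj Walk.nil))
  simp at this hd
  omega

/-- In a graph without bad paths, two vertices in the same component of the graph without the
closed neighbourhood of `v` have the same neighbours among the neighbours of `v`, or one of them
has none. -/
theorem NoBadPath.adj_of_walk {G : SimpleGraph V} (h : G.NoBadPath) {v u u' : V}
    {a b : ↥{x | x ≠ v ∧ ¬ G.Adj v x}} (p : (G.induce {x | x ≠ v ∧ ¬ G.Adj v x}).Walk a b)
    (hu : G.Adj v u) (hu' : G.Adj v u') (hua : G.Adj u a) (hub' : G.Adj u' b) : G.Adj u b := by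
  induction hm : p.length using Nat.strong_induction_on generalizing a b u u' with
  | _ m ih =>
  by_contra hub
  have hshort : ∀ q : (G.induce {x | x ≠ v ∧ ¬ G.Adj v x}).Walk a b, m ≤ q.length := by
    intro q
    by_contra hq
    exact hub (ih q.length (by omega) q hu hu' hua hub' rfl)
  -- A counterexample of least length is a shortest walk from `a` to `b`, hence an induced path. It
  -- is shown to be bad.
  have hlen : ∀ i j, i ≤ j → j ≤ m → ∀ q : (G.induce {x | x ≠ v ∧ ¬ G.Adj v x}).Walk
      (p.getVert i) (p.getVert j), j ≤ i + q.length := by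
    intro i j hij hj q
    have := hshort (((p.take i).append q).append (p.drop j))
    rw [Walk.length_append, Walk.length_append, Walk.take_length, Walk.drop_length] at this
    omega
  refine h v u u' m (fun i => (p.getVert i).1) ⟨?_, hu, hu', fun i _ => (p.getVert i).2.1,
    fun i _ => (p.getVert i).2.2, ?_, ?_, ?_, ?_, ?_⟩
  · by_contra hm0
    have : a = b := Walk.eq_of_length_eq_zero (p := p) (by omega)
    exact hub (this ▸ hua)
  · have key : ∀ i j, i ≤ j → j ≤ m → (p.getVert i).1 = (p.getVert j).1 → i = j := by
      intro i j hij hj e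
      have := hlen i j hij hj (Walk.nil.copy rfl (Subtype.ext e))
      rw [Walk.length_copy, Walk.length_nil] at this
      omega
    intro i hi j hj e
    rcases le_total i j with hij | hij
    · exact key i j hij hj e
    · exact (key j i hij hi e.symm).symm
  · have key : ∀ i j, i ≤ j → j ≤ m → (G.Adj (p.getVert i) (p.getVert j) ↔ i + 1 = j) := by
      intro i j hij hj
      constructor
      · intro e
        have hne : i ≠ j := by
          rintro rfl
          exact G.irrefl e
        have e' : (G.induce {x | x ≠ v ∧ ¬ G.Adj v x}).Adj (p.getVert i) (p.getVert j) := e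
        have := hlen i j hij hj e'.toWalk
        simp at this
        omega
      · rintro rfl
        exact p.adj_getVert_succ (by omega)
    intro i hi j hj
    rcases le_total i j with hij | hij
    · rw [key i j hij hj]
      omega
    · rw [G.adj_comm, key j i hij hi]
      omega
  · intro i hi
    constructor
    · intro hui
      by_contra hi0
      rcases hi.eq_or_lt with rfl | hi
      · rw [← hm, Walk.getVert_length] at hui
        exact hub hui
      · refine hub (ih _ ?_ (p.drop i) hu hu' hui hub' rfl)
        rw [Walk.drop_length]
        omega
    · rintro rfl
      rwa [Walk.getVert_zero]
  · rw [← hm, Walk.getVert_length]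
    exact hub'
  · intro i hi hi' hui
    -- If `u'` saw an inner vertex, the part of the walk up to it would make it a neighbour of `u`,
    -- and the part after it would then carry adjacency to `u` on to `b`.
    have h1 : G.Adj u (p.getVert i) := by
      refine ih _ ?_ (p.take i) hu hu' hua hui rfl
      rw [Walk.take_length]
      omega
    refine hub (ih _ ?_ (p.drop i) hu hu' h1 hub' rfl)
    rw [Walk.drop_length]
    omega

/-- An induced path is a shortest path, by induction with `c 0` removed. Beyond its first two
vertices, a shorter path `p` avoids the closed neighbourhood of `c 0`, as does the rest of `c`, and
the two meet at their end. So `adj_of_walk` makes `c 1` adjacent to the third vertex of `p`, a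
shortcut for the path from `c 1`. -/
theorem NoBadPath.le_dist {G : SimpleGraph V} (h : G.NoBadPath) {k : ℕ} {c : ℕ → V}
    (hinj : ∀ i ≤ k, ∀ j ≤ k, c i = c j → i = j)
    (hadj : ∀ i ≤ k, ∀ j ≤ k, (G.Adj (c i) (c j) ↔ i + 1 = j ∨ j + 1 = i)) :
    G.Reachable (c 0) (c k) ∧ k ≤ G.dist (c 0) (c k) := by
  induction k generalizing c with
  | zero => simp
  | succ k ih =>
    obtain ⟨hr, hk⟩ := ih (c := fun i => c (i + 1))
      (fun i hi j hj e => by have := hinj _ (by omega) _ (by omega) e; omega)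
      (fun i hi j hj => by rw [hadj _ (by omega) _ (by omega)]; omega)
    simp only [zero_add] at hr hk
    have h01 : G.Adj (c 0) (c 1) := (hadj 0 (by omega) 1 (by omega)).2 (by omega)
    have hr0 : G.Reachable (c 0) (c (k + 1)) := h01.reachable.trans hr
    refine ⟨hr0, ?_⟩
    by_contra hlt
    obtain ⟨p, hp⟩ := hr0.exists_walk_length_eq_dist
    have hmin : ∀ q : G.Walk (c 0) (c (k + 1)), p.length ≤ q.length := fun q => hp ▸ dist_le q
    have hp2 : 2 ≤ p.length := by
      by_contra hp2
      have h1 : p.length = 0 ∨ p.length = 1 := by omega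
      rcases h1 with h1 | h1
      · have := hinj _ (by omega) _ (by omega) (Walk.eq_of_length_eq_zero h1)
        omega
      · have := (hadj 0 (by omega) (k + 1) (by omega)).1 (Walk.adj_of_length_eq_one h1)
        omega
    have hS : ∀ i, 2 ≤ i → i ≤ p.length →
        p.getVert i ∈ {x | x ≠ c 0 ∧ ¬ G.Adj (c 0) x} := by
      intro i hi hil
      refine ⟨fun e => ?_, fun e => ?_⟩
      · have := hmin ((p.drop i).copy e rfl)
        rw [Walk.length_copy, Walk.drop_length] at this
        omega
      · have := hmin (Walk.cons e (p.drop i))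
        rw [Walk.length_cons, Walk.drop_length] at this
        omega
    have hqS : ∀ x ∈ (p.drop 2).support, x ∈ {x | x ≠ c 0 ∧ ¬ G.Adj (c 0) x} := by
      intro x hx
      obtain ⟨i, rfl, hi⟩ := Walk.mem_support_iff_exists_getVert.1 hx
      rw [Walk.drop_length] at hi
      rw [Walk.drop_getVert]
      exact hS _ (by omega) (by omega)
    have hcS : ∀ i, i + 2 ≤ k + 1 → c (i + 2) ∈ {x | x ≠ c 0 ∧ ¬ G.Adj (c 0) x} := by
      intro i hi
      refine ⟨fun e => ?_, fun e => ?_⟩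
      · have := hinj _ (by omega) _ (by omega) e
        omega
      · have := (hadj _ (by omega) _ (by omega)).1 e
        omega
    have hreach : ∀ i (hi : i + 2 ≤ k + 1), (G.induce {x | x ≠ c 0 ∧ ¬ G.Adj (c 0) x}).Reachable
        ⟨c 2, hcS 0 (by omega)⟩ ⟨c (i + 2), hcS i hi⟩ := by
      intro i
      induction i with
      | zero => exact fun _ => Reachable.refl _
      | succ i ih =>
        intro hi
        refine (ih (by omega)).trans (Adj.reachable ?_)
        exact (hadj _ (by omega) _ (by omega)).2 (by omega)
    obtain ⟨k, rfl⟩ : ∃ k', k = k' + 1 := ⟨k - 1, by omega⟩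
    obtain ⟨w⟩ := (hreach k (by omega)).trans ⟨((p.drop 2).induce _ hqS).reverse⟩
    have hv1 : G.Adj (c 0) (p.getVert 1) := by
      simpa using p.adj_getVert_succ (i := 0) (by omega)
    have h12 : G.Adj (p.getVert 1) (p.getVert 2) := p.adj_getVert_succ (i := 1) (by omega)
    have := h.adj_of_walk w h01 hv1 ((hadj 1 (by omega) 2 (by omega)).2 (by omega)) h12
    have := dist_le (Walk.cons this (p.drop 2))
    rw [Walk.length_cons, Walk.drop_length] at this
    omega

theorem NoBadPath.isDistanceHereditary {G : SimpleGraph V} (h : G.NoBadPath) :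
    G.IsDistanceHereditary := by
  intro n f i j
  have key : ∀ i j : Fin n, i ≤ j → G.dist (f i) (f j) = (pathGraph n).dist i j := by
    intro i j hij
    rw [dist_pathGraph hij]
    apply le_antisymm
    · rw [← dist_pathGraph hij]
      obtain ⟨p, hp⟩ := (pathGraph_preconnected n i j).exists_walk_length_eq_dist
      rw [← hp, ← Walk.length_map f.toHom p]
      exact dist_le _
    · have hn : ∀ t, t ≤ j.1 - i.1 → i.1 + t < n := fun t ht => by
        have := j.2
        have := Fin.le_def.1 hij
        omega
      let c : ℕ → V := fun t => if ht : t ≤ j.1 - i.1 then f ⟨i.1 + t, hn t ht⟩ else f i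
      have hc : ∀ t (ht : t ≤ j.1 - i.1), c t = f ⟨i.1 + t, hn t ht⟩ := fun t ht => dif_pos ht
      have := (h.le_dist (k := j.1 - i.1) (c := c) ?_ ?_).2
      · rw [hc 0 (by omega), hc _ le_rfl] at this
        have e : (⟨i.1 + (j.1 - i.1), hn _ le_rfl⟩ : Fin n) = j :=
          Fin.ext (by have := Fin.le_def.1 hij; dsimp only; omega)
        rwa [e] at this
      · intro s hs t ht e
        rw [hc s hs, hc t ht] at e
        have := Fin.mk.inj_iff.1 (f.injective e)
        omega
      · intro s hs t ht
        rw [hc s hs, hc t ht, f.map_adj_iff, pathGraph_adj]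
        dsimp only
        omega
  rcases le_total i j with hij | hij
  · exact key i j hij
  · rw [dist_comm, key j i hij, dist_comm]

/-- With four vertices a split is found. If the non-neighbours of some `v` span an edge, the
component containing it is one side, thin by `adj_of_walk`. Otherwise two non-adjacent vertices are
twins and form a side. In a clique any two vertices do. -/
theorem NoBadPath.card_le_of_isPrime [Finite V] {G : SimpleGraph V} (h : G.NoBadPath)
    (hG : G.Connected) (hp : G.IsPrime) : Nat.card V ≤ 3 := by
  by_contra hcard
  have hcompl : ∀ x y : V, x ≠ y → ({x, y} : Set V)ᶜ.Nontrivial := by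
    intro x y hxy
    rw [← Set.one_lt_ncard_iff_nontrivial, Set.ncard_compl, Set.ncard_pair hxy]
    omega
  have hpair : ∀ x y : V, x ≠ y → ({x, y} : Set V).Nontrivial := fun x y hxy =>
    ⟨x, by simp, y, by simp, hxy⟩
  have hp' : ∀ X : Set V, X.Nontrivial → Xᶜ.Nontrivial → ¬ G.ThinCut X := fun X h1 h2 h3 =>
    hp X (hG.isSplit_iff.2 ⟨h1, h2, h3⟩)
  by_cases hA : ∃ v x y, x ≠ v ∧ ¬ G.Adj v x ∧ y ≠ v ∧ ¬ G.Adj v y ∧ G.Adj x y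
  · obtain ⟨v, x, y, hxv, hvx, hyv, hvy, hxy⟩ := hA
    set H := G.induce {x | x ≠ v ∧ ¬ G.Adj v x} with hH
    let C : Set V := {w | ∃ hw : w ≠ v ∧ ¬ G.Adj v w, H.Reachable ⟨x, hxv, hvx⟩ ⟨w, hw⟩}
    have hxyH : H.Adj ⟨x, hxv, hvx⟩ ⟨y, hyv, hvy⟩ := hxy
    obtain ⟨_, hv, u, -, hvu⟩ := hG.exists_adj_mem_notMem (X := {v}) (a := v) (b := x) rfl hxv
    rw [Set.mem_singleton_iff.1 hv] at hvu
    refine hp' C ⟨x, ⟨⟨hxv, hvx⟩, .refl _⟩, y, ⟨⟨hyv, hvy⟩, hxyH.reachable⟩, hxy.ne⟩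
      ⟨v, fun h => h.1.1 rfl, u, fun h => h.1.2 hvu, hvu.ne⟩ ?_
    have hout : ∀ a ∈ C, ∀ b ∉ C, G.Adj a b → G.Adj v b := by
      rintro a ⟨ha, har⟩ b hb hab
      by_contra hvb
      have hbv : b ≠ v := by
        rintro rfl
        exact ha.2 hab.symm
      have : H.Adj ⟨a, ha⟩ ⟨b, hbv, hvb⟩ := hab
      exact hb ⟨⟨hbv, hvb⟩, har.trans this.reachable⟩
    intro a a' b b' haC haC' hb hb' hab hab'
    obtain ⟨ha, har⟩ := id haC
    obtain ⟨ha', har'⟩ := id haC'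
    obtain ⟨p⟩ := har'.symm.trans har
    exact (h.adj_of_walk p (hout _ haC' _ hb' hab') (hout _ haC _ hb hab) hab'.symm
      hab.symm).symm
  · push Not at hA
    by_cases hB : ∃ v w, v ≠ w ∧ ¬ G.Adj v w
    · obtain ⟨v, w, hvw, hnvw⟩ := hB
      have hsub : ∀ v w, v ≠ w → ¬ G.Adj v w → ∀ y, G.Adj w y → G.Adj v y := by
        intro v w hvw hn y hwy
        by_contra hvy
        refine hA v w y hvw.symm hn ?_ hvy hwy
        rintro rfl
        exact hn hwy.symm
      refine hp' {v, w} (hpair v w hvw) (hcompl v w hvw) ?_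
      intro a a' b b' ha ha' _ _ _ hab'
      have hs1 := hsub v w hvw hnvw b'
      have hs2 := hsub w v hvw.symm (fun e => hnvw e.symm) b'
      rcases ha with rfl | rfl <;> rcases ha' with rfl | rfl
      · exact hab'
      · exact hs1 hab'
      · exact hs2 hab'
      · exact hab'
    · push Not at hB
      have : Nontrivial V := by
        rw [← Finite.one_lt_card_iff_nontrivial]
        omega
      obtain ⟨x, y, hxy⟩ := exists_pair_ne V
      refine hp' {x, y} (hpair x y hxy) (hcompl x y hxy) ?_
      intro a a' b b' ha _ _ hb' _ _
      exact hB a b' fun e => hb' (e ▸ ha)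

end BadPath

end SimpleGraph

namespace SimpleGraph

/-! ### Parts of a split as quotients. -/

section Quotient

variable {V : Type u} {W : Type v} {K : Type w}

theorem quot_quot {G : SimpleGraph V} {κ : V → K} {μ : K → W} :
    (G.quot κ).quot μ = G.quot (μ ∘ κ) := by
  ext k l
  constructor
  · rintro ⟨hkl, p, q, rfl, rfl, -, x, y, rfl, rfl, hxy⟩
    exact ⟨hkl, x, y, rfl, rfl, hxy⟩
  · rintro ⟨hkl, x, y, rfl, rfl, hxy⟩
    exact ⟨hkl, κ x, κ y, rfl, rfl, fun e => hkl (congrArg μ e), x, y, rfl, rfl, hxy⟩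

theorem quot_comp_adj {G : SimpleGraph V} {κ : V → K} {f : K → W} (hf : Function.Injective f)
    {k l : K} : (G.quot (f ∘ κ)).Adj (f k) (f l) ↔ (G.quot κ).Adj k l := by
  simp only [quot, Function.comp_apply, hf.eq_iff, hf.ne_iff]

theorem Connected.quot {G : SimpleGraph V} (hG : G.Connected) {κ : V → K}
    (hκ : Function.Surjective κ) : (G.quot κ).Connected := by
  have := hG.nonempty
  have : Nonempty K := ⟨κ this.some⟩
  refine ⟨fun k l => ?_⟩
  obtain ⟨x, rfl⟩ := hκ k
  obtain ⟨y, rfl⟩ := hκ l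
  obtain ⟨p⟩ := hG.preconnected x y
  induction p with
  | nil => rfl
  | @cons x z y h p ih =>
    by_cases e : κ x = κ z
    · rw [e]
      exact ih
    · exact (quot_adj_of_adj h e).reachable.trans ih

/-- A quotient with thin classes of a connected graph is isomorphic to an induced subgraph. -/
theorem Connected.exists_quot_embedding {G : SimpleGraph V} (hG : G.Connected) {κ : V → K}
    (hκ : Function.Surjective κ) (hthin : ∀ k, G.ThinCut (κ ⁻¹' {k})) :
    Nonempty (G.quot κ ↪g G) := by
  -- A representative must have a neighbour outside its class. The condition on `l` is vacuous when
  -- there is only one class.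
  have hrep : ∀ k, ∃ x, κ x = k ∧ ∀ l, l ≠ k → ∃ y, κ y ≠ k ∧ G.Adj x y := by
    intro k
    obtain ⟨x, hx⟩ := hκ k
    by_cases h : ∃ l, l ≠ k
    · obtain ⟨l, hl⟩ := h
      obtain ⟨y, rfl⟩ := hκ l
      obtain ⟨a, ha, b, hb, hab⟩ := hG.exists_adj_mem_notMem (X := κ ⁻¹' {k}) hx hl
      exact ⟨a, ha, fun _ _ => ⟨b, hb, hab⟩⟩
    · push Not at h
      exact ⟨x, hx, fun l hl => absurd (h l) hl⟩
  choose r hr hr' using hrep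
  refine ⟨⟨⟨r, fun k l e => by rw [← hr k, e, hr l]⟩, ?_⟩⟩
  intro k l
  change G.Adj (r k) (r l) ↔ _
  constructor
  · intro h
    have := quot_adj_of_adj (κ := κ) h
    rw [hr, hr] at this
    refine this ?_
    rintro rfl
    exact G.irrefl h
  · intro h
    obtain ⟨x, hx, hkx⟩ := hr' k l h.ne'
    obtain ⟨y, hy, hly⟩ := hr' l k h.ne
    refine adj_of_quot_adj hthin hkx ?_ hly ?_ ?_
    · rwa [hr]
    · rwa [hr]
    · rwa [hr, hr]

open Classical in
/-- The map from the vertices of `G` to the vertices of `G.splitPart X` that contracts the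
complement of `X` to the marker. -/
noncomputable def sideMap (X : Set V) (x : V) : Option ↥X :=
  if h : x ∈ X then some ⟨x, h⟩ else none

theorem sideMap_of_mem {X : Set V} {x : V} (h : x ∈ X) : sideMap X x = some ⟨x, h⟩ := dif_pos h

theorem sideMap_of_notMem {X : Set V} {x : V} (h : x ∉ X) : sideMap X x = none := dif_neg h

theorem sideMap_eq_none {X : Set V} {x : V} : sideMap X x = none ↔ x ∉ X := by
  by_cases h : x ∈ X <;> simp [sideMap, h]

theorem sideMap_eq_some {X : Set V} {x : V} {y : ↥X} : sideMap X x = some y ↔ x = y := by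
  by_cases h : x ∈ X
  · rw [sideMap_of_mem h, Option.some_inj, Subtype.ext_iff]
  · rw [sideMap_of_notMem h]
    simp only [reduceCtorEq, false_iff]
    rintro rfl
    exact h y.2

theorem sideMap_surjective {X : Set V} (h : Xᶜ.Nonempty) :
    Function.Surjective (sideMap X) := by
  rintro (_ | y)
  · obtain ⟨x, hx⟩ := h
    exact ⟨x, sideMap_of_notMem hx⟩
  · exact ⟨y, sideMap_of_mem y.2⟩

/-- The marker is the contracted other side. Repeated splitting thus becomes composition of maps,
and every block is a quotient of `G` itself. -/
theorem splitPart_eq_quot (G : SimpleGraph V) (X : Set V) :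
    G.splitPart X = G.quot (sideMap X) := by
  ext a b
  rcases a with _ | a <;> rcases b with _ | b
  · simp
  · simp only [splitPart, quot, sideMap_eq_none, sideMap_eq_some]
    constructor
    · rintro ⟨z, hz, hbz⟩
      exact ⟨by simp, z, b, hz, rfl, hbz.symm⟩
    · rintro ⟨-, z, y, hz, rfl, hzy⟩
      exact ⟨z, hz, hzy.symm⟩
  · simp only [splitPart, quot, sideMap_eq_none, sideMap_eq_some]
    constructor
    · rintro ⟨z, hz, hbz⟩
      exact ⟨by simp, a, z, rfl, hz, hbz⟩
    · rintro ⟨-, y, z, rfl, hz, hzy⟩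
      exact ⟨z, hz, hzy⟩
  · simp only [splitPart, quot, sideMap_eq_some]
    constructor
    · intro h
      exact ⟨by simpa [Subtype.ext_iff] using h.ne, a, b, rfl, rfl, h⟩
    · rintro ⟨-, x, y, rfl, rfl, h⟩
      exact h

theorem quot_splitPart (G : SimpleGraph V) (X : Set V) (μ : Option ↥X → K) :
    (G.splitPart X).quot μ = G.quot (μ ∘ sideMap X) := by
  rw [splitPart_eq_quot, quot_quot]

theorem ThinCut.sideMap_fibre {G : SimpleGraph V} {X : Set V} (h : G.ThinCut X) (k : Option ↥X) :
    G.ThinCut (sideMap X ⁻¹' {k}) := by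
  rcases k with _ | y
  · convert h.compl
    ext x
    simp [sideMap_eq_none]
  · apply thinCut_of_subsingleton
    intro a ha b hb
    rw [sideMap_eq_some.1 ha, sideMap_eq_some.1 hb]

/-- Thin cuts of a part of a split lift to `G`. -/
theorem ThinCut.of_splitPart {G : SimpleGraph V} {X : Set V} (h : G.ThinCut X)
    {S : Set (Option ↥X)} (hS : (G.splitPart X).ThinCut S) : G.ThinCut (sideMap X ⁻¹' S) := by
  rw [splitPart_eq_quot] at hS
  exact ThinCut.preimage_quot h.sideMap_fibre hS

theorem IsSplit.thinCut [Finite V] {G : SimpleGraph V} {X : Set V} (h : G.IsSplit X) :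
    G.ThinCut X := cutRank_le_one_iff.1 h.2.2.le

theorem IsSplit.nonempty_compl {G : SimpleGraph V} {X : Set V} (h : G.IsSplit X) :
    Xᶜ.Nonempty := Set.nonempty_of_ncard_ne_zero (by have := h.2.1; omega)

theorem IsSplit.nonempty {G : SimpleGraph V} {X : Set V} (h : G.IsSplit X) :
    X.Nonempty := Set.nonempty_of_ncard_ne_zero (by have := h.1; omega)

theorem Connected.splitPart {G : SimpleGraph V} (hG : G.Connected) {X : Set V}
    (h : Xᶜ.Nonempty) : (G.splitPart X).Connected := by
  rw [splitPart_eq_quot]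
  exact hG.quot (sideMap_surjective h)

end Quotient

/-! ### Blocks of a decomposition as quotients of the graph. -/

namespace SplitDecomposition

variable {V : Type u} {G : SimpleGraph V}

/-- The vertex of the block `b` that represents the vertex `x` of `G`: the copy of `x`, or the
marker that leads from `b` towards `x`. -/
noncomputable def toward : {V : Type u} → {G : SimpleGraph V} → (D : SplitDecomposition G) →
    D.Block → V → D.Vert
  | _, _, single _, _, x => x
  | _, _, split _ X _ D₁ D₂, b, x =>
      Sum.elim (fun b => Sum.inl (D₁.toward b (sideMap X x)))
        (fun b => Sum.inr (D₂.toward b (sideMap Xᶜ x))) b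

theorem blockOf_toward (D : SplitDecomposition G) (b : D.Block) (x : V) :
    D.blockOf (D.toward b x) = b := by
  induction D with
  | single G => rfl
  | split G X hX D₁ D₂ ih₁ ih₂ =>
    rcases b with b | b
    · exact congrArg Sum.inl (ih₁ b (sideMap X x))
    · exact congrArg Sum.inr (ih₂ b (sideMap Xᶜ x))

theorem emb_split_of_mem {X : Set V} {hX : G.IsSplit X} {D₁ : SplitDecomposition (G.splitPart X)}
    {D₂ : SplitDecomposition (G.splitPart Xᶜ)} {x : V} (hx : x ∈ X) :
    (split G X hX D₁ D₂).emb x = Sum.inl (D₁.emb (sideMap X x)) := by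
  rw [sideMap_of_mem hx]
  exact dif_pos hx

theorem emb_split_of_notMem {X : Set V} {hX : G.IsSplit X}
    {D₁ : SplitDecomposition (G.splitPart X)}
    {D₂ : SplitDecomposition (G.splitPart Xᶜ)} {x : V} (hx : x ∉ X) :
    (split G X hX D₁ D₂).emb x = Sum.inr (D₂.emb (sideMap Xᶜ x)) := by
  rw [sideMap_of_mem hx]
  exact dif_neg hx

theorem toward_blockOf_emb_eq (D : SplitDecomposition G) {x y : V} :
    D.toward (D.blockOf (D.emb y)) x = D.emb y ↔ x = y := by
  induction D with
  | single G => rfl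
  | split G X hX D₁ D₂ ih₁ ih₂ =>
    by_cases hy : y ∈ X
    · rw [emb_split_of_mem hy]
      refine Sum.inl_injective.eq_iff.trans (ih₁.trans ?_)
      rw [sideMap_of_mem hy, sideMap_eq_some]
    · rw [emb_split_of_notMem hy]
      refine Sum.inr_injective.eq_iff.trans (ih₂.trans ?_)
      rw [sideMap_of_mem (X := Xᶜ) hy, sideMap_eq_some]

theorem exists_toward_eq (D : SplitDecomposition G) (z : D.Vert) :
    ∃ x, D.toward (D.blockOf z) x = z := by
  induction D with
  | single G => exact ⟨z, rfl⟩
  | split G X hX D₁ D₂ ih₁ ih₂ =>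
    rcases z with z | z
    · obtain ⟨p, hp⟩ := ih₁ z
      obtain ⟨x, rfl⟩ := sideMap_surjective hX.nonempty_compl p
      exact ⟨x, congrArg Sum.inl hp⟩
    · obtain ⟨p, hp⟩ := ih₂ z
      obtain ⟨x, rfl⟩ := sideMap_surjective (X := Xᶜ) (by simpa using hX.nonempty) p
      exact ⟨x, congrArg Sum.inr hp⟩

/-- The map `toward` into a block is the composite of the contractions made along the way, and
quotients compose. -/
theorem solid_adj_iff (D : SplitDecomposition G) {z z' : D.Vert} : D.solid.Adj z z' ↔
    D.blockOf z = D.blockOf z' ∧ (G.quot (D.toward (D.blockOf z))).Adj z z' := by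
  induction D with
  | single G =>
    refine ⟨fun h => ⟨rfl, h.ne, z, z', rfl, rfl, h⟩, ?_⟩
    rintro ⟨-, -, x, y, hx, hy, h⟩
    have hx : x = z := hx
    have hy : y = z' := hy
    rw [← hx, ← hy]
    exact h
  | split G X hX D₁ D₂ ih₁ ih₂ =>
    rcases z with z | z <;> rcases z' with z' | z'
    · refine (ih₁ (z := z) (z' := z')).trans (and_congr Sum.inl_injective.eq_iff.symm ?_)
      exact (iff_of_eq (congrArg (fun H => H.Adj z z') (quot_splitPart G X _))).trans
        (quot_comp_adj Sum.inl_injective).symm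
    · refine iff_of_false (fun h => ?_) fun h => ?_
      · exact (by simp : ¬ (SimpleGraph.sum D₁.solid D₂.solid).Adj (Sum.inl z) (Sum.inr z')) h
      · exact Sum.inl_ne_inr h.1
    · refine iff_of_false (fun h => ?_) fun h => ?_
      · exact (by simp : ¬ (SimpleGraph.sum D₁.solid D₂.solid).Adj (Sum.inr z) (Sum.inl z')) h
      · exact Sum.inr_ne_inl h.1
    · refine (ih₂ (z := z) (z' := z')).trans (and_congr Sum.inr_injective.eq_iff.symm ?_)
      exact (iff_of_eq (congrArg (fun H => H.Adj z z') (quot_splitPart G Xᶜ _))).trans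
        (quot_comp_adj Sum.inr_injective).symm

/-- Thin cuts of a part of a split lift to the whole graph, so by induction the vertices behind any
vertex of a block form a thin class. -/
theorem thinCut_toward [hfin : Finite V] (D : SplitDecomposition G) (b : D.Block) (z : D.Vert) :
    G.ThinCut (D.toward b ⁻¹' {z}) := by
  revert hfin
  induction D with
  | single G =>
    intro _
    exact thinCut_of_subsingleton fun x hx y hy => hx.trans hy.symm
  | split G X hX D₁ D₂ ih₁ ih₂ =>
    intro hfin
    rcases b with b | b <;> rcases z with z | z
    · convert hX.thinCut.of_splitPart (ih₁ b z) using 1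
      ext x
      exact Sum.inl_injective.eq_iff
    · intro x _ _ _ hx
      exact absurd hx Sum.inl_ne_inr
    · intro x _ _ _ hx
      exact absurd hx Sum.inr_ne_inl
    · convert hX.thinCut.compl.of_splitPart (ih₂ b z) using 1
      ext x
      exact Sum.inr_injective.eq_iff

theorem marked_split_inl {X : Set V} {hX : G.IsSplit X} {D₁ : SplitDecomposition (G.splitPart X)}
    {D₂ : SplitDecomposition (G.splitPart Xᶜ)} {z z' : D₁.Vert} :
    (split G X hX D₁ D₂).marked.Adj (Sum.inl z) (Sum.inl z') ↔ D₁.marked.Adj z z' := by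
  change D₁.marked.Adj z z' ∨ (edge _ _).Adj (Sum.inl z) (Sum.inl z') ↔ _
  simp [edge_adj]

theorem marked_split_inr {X : Set V} {hX : G.IsSplit X} {D₁ : SplitDecomposition (G.splitPart X)}
    {D₂ : SplitDecomposition (G.splitPart Xᶜ)} {z z' : D₂.Vert} :
    (split G X hX D₁ D₂).marked.Adj (Sum.inr z) (Sum.inr z') ↔ D₂.marked.Adj z z' := by
  change D₂.marked.Adj z z' ∨ (edge _ _).Adj (Sum.inr z) (Sum.inr z') ↔ _
  simp [edge_adj]

theorem marked_split_inl_inr {X : Set V} {hX : G.IsSplit X}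
    {D₁ : SplitDecomposition (G.splitPart X)}
    {D₂ : SplitDecomposition (G.splitPart Xᶜ)} {z : D₁.Vert} {z' : D₂.Vert} :
    (split G X hX D₁ D₂).marked.Adj (Sum.inl z) (Sum.inr z') ↔
      z = D₁.emb none ∧ z' = D₂.emb none := by
  change (SimpleGraph.sum D₁.marked D₂.marked ⊔ edge _ _).Adj (Sum.inl z) (Sum.inr z') ↔ _
  simp [edge_adj]

/-- The two ends of a marked edge stand for complementary vertex sets of `G`: the set behind `z` is
the set not behind `z'`. The way the blocks are joined is later used only through this bipartition.
-/
theorem toward_eq_iff_of_marked (D : SplitDecomposition G) {z z' : D.Vert}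
    (h : D.marked.Adj z z') (x : V) :
    D.toward (D.blockOf z) x = z ↔ D.toward (D.blockOf z') x ≠ z' := by
  induction D with
  | single G => exact absurd h (fun h => h)
  | split G X hX D₁ D₂ ih₁ ih₂ =>
    have key : ∀ {z z'}, (split G X hX D₁ D₂).marked.Adj (Sum.inl z) (Sum.inr z') →
        ((split G X hX D₁ D₂).toward ((split G X hX D₁ D₂).blockOf (Sum.inl z)) x = Sum.inl z ↔
        (split G X hX D₁ D₂).toward ((split G X hX D₁ D₂).blockOf (Sum.inr z')) x ≠
          Sum.inr z') := by
      intro z z' h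
      obtain ⟨rfl, rfl⟩ := marked_split_inl_inr.1 h
      have h1 := D₁.toward_blockOf_emb_eq (x := sideMap X x) (y := none)
      have h2 := D₂.toward_blockOf_emb_eq (x := sideMap Xᶜ x) (y := none)
      refine (Sum.inl_injective.eq_iff.trans h1).trans
        (Iff.trans ?_ (not_congr (Sum.inr_injective.eq_iff.trans h2)).symm)
      rw [sideMap_eq_none, sideMap_eq_none, Set.mem_compl_iff]
      simp
    rcases z with z | z <;> rcases z' with z' | z'
    · have := ih₁ (marked_split_inl.1 h) (sideMap X x)
      exact Sum.inl_injective.eq_iff.trans (this.trans Sum.inl_injective.ne_iff.symm)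
    · exact key h
    · have := key h.symm
      tauto
    · have := ih₂ (marked_split_inr.1 h) (sideMap Xᶜ x)
      exact Sum.inr_injective.eq_iff.trans (this.trans Sum.inr_injective.ne_iff.symm)

theorem blockGraph_eq_quot (D : SplitDecomposition G) (b : D.Block) :
    D.blockGraph b = G.quot (fun x => ⟨D.toward b x, D.blockOf_toward b x⟩) := by
  ext ⟨z, hz⟩ ⟨z', hz'⟩
  change D.solid.Adj z z' ↔ _
  rw [solid_adj_iff]
  subst hz
  refine ⟨fun h => ?_, fun h => ⟨hz'.symm, ?_⟩⟩
  · exact (quot_comp_adj Subtype.val_injective (κ := fun x =>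
      (⟨D.toward _ x, D.blockOf_toward _ x⟩ : ↥{x : D.Vert | D.blockOf x = _}))).1 h.2
  · exact (quot_comp_adj Subtype.val_injective (κ := fun x =>
      (⟨D.toward _ x, D.blockOf_toward _ x⟩ : ↥{x : D.Vert | D.blockOf x = _}))).2 h

theorem surjective_toward (D : SplitDecomposition G) (b : D.Block) : Function.Surjective
    (fun x => (⟨D.toward b x, D.blockOf_toward b x⟩ : ↥{x : D.Vert | D.blockOf x = b})) := by
  rintro ⟨z, rfl⟩
  obtain ⟨x, hx⟩ := D.exists_toward_eq z
  exact ⟨x, Subtype.ext hx⟩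

theorem connected_blockGraph (D : SplitDecomposition G) (hG : G.Connected) (b : D.Block) :
    (D.blockGraph b).Connected := by
  rw [blockGraph_eq_quot]
  exact hG.quot (D.surjective_toward b)

theorem exists_blockGraph_embedding [Finite V] (D : SplitDecomposition G) (hG : G.Connected)
    (b : D.Block) : Nonempty (D.blockGraph b ↪g G) := by
  rw [blockGraph_eq_quot]
  refine hG.exists_quot_embedding (D.surjective_toward b) fun z => ?_
  convert D.thinCut_toward b z.1 using 1
  ext x
  exact Subtype.ext_iff

instance finite_block (D : SplitDecomposition G) : Finite D.Block := by
  induction D with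
  | single G => exact inferInstanceAs (Finite Unit)
  | split G X hX D₁ D₂ ih₁ ih₂ => exact inferInstanceAs (Finite (D₁.Block ⊕ D₂.Block))

instance finite_vert [hfin : Finite V] (D : SplitDecomposition G) : Finite D.Vert := by
  revert hfin
  induction D with
  | single G =>
    intro hfin
    exact hfin
  | split G X hX D₁ D₂ ih₁ ih₂ =>
    intro hfin
    have := ih₁
    have := ih₂
    exact inferInstanceAs (Finite (D₁.Vert ⊕ D₂.Vert))

/-- The block `b` of the first part of a split, as a block of the whole decomposition. -/
def blockGraphIsoInl {X : Set V} {hX : G.IsSplit X} (D₁ : SplitDecomposition (G.splitPart X))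
    (D₂ : SplitDecomposition (G.splitPart Xᶜ)) (b : D₁.Block) :
    D₁.blockGraph b ≃g (split G X hX D₁ D₂).blockGraph (Sum.inl b) where
  toFun z := ⟨Sum.inl z.1, congrArg Sum.inl z.2⟩
  invFun := fun
    | ⟨Sum.inl z, hz⟩ => ⟨z, Sum.inl_injective hz⟩
    | ⟨Sum.inr _, hz⟩ => absurd hz Sum.inr_ne_inl
  left_inv _ := rfl
  right_inv := by
    rintro ⟨z | z, hz⟩
    · rfl
    · exact absurd hz Sum.inr_ne_inl
  map_rel_iff' := Iff.rfl

/-- The block `b` of the second part of a split, as a block of the whole decomposition. -/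
def blockGraphIsoInr {X : Set V} {hX : G.IsSplit X} (D₁ : SplitDecomposition (G.splitPart X))
    (D₂ : SplitDecomposition (G.splitPart Xᶜ)) (b : D₂.Block) :
    D₂.blockGraph b ≃g (split G X hX D₁ D₂).blockGraph (Sum.inr b) where
  toFun z := ⟨Sum.inr z.1, congrArg Sum.inr z.2⟩
  invFun := fun
    | ⟨Sum.inr z, hz⟩ => ⟨z, Sum.inr_injective hz⟩
    | ⟨Sum.inl _, hz⟩ => absurd hz Sum.inl_ne_inr
  left_inv _ := rfl
  right_inv := by
    rintro ⟨z | z, hz⟩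
    · exact absurd hz Sum.inl_ne_inr
    · rfl
  map_rel_iff' := Iff.rfl

/-- The only block of the trivial decomposition. -/
def blockGraphIsoSingle (G : SimpleGraph V) (b : (single G).Block) :
    G ≃g (single G).blockGraph b where
  toFun z := ⟨z, rfl⟩
  invFun z := z.1
  left_inv _ := rfl
  right_inv _ := rfl
  map_rel_iff' := Iff.rfl

theorem card_option_of_isSplit [Finite V] {X : Set V} (hX : G.IsSplit X) :
    3 ≤ Nat.card (Option ↥X) ∧ 3 ≤ Nat.card (Option ↥Xᶜ) := by
  have h1 := hX.1
  have h2 := hX.2.1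
  rw [← Nat.card_coe_set_eq] at h1 h2
  rw [Finite.card_option, Finite.card_option]
  omega

theorem card_option_lt_of_isSplit [Finite V] {X : Set V} (hX : G.IsSplit X) :
    Nat.card (Option ↥X) < Nat.card V ∧ Nat.card (Option ↥Xᶜ) < Nat.card V := by
  have h1 := hX.1
  have h2 := hX.2.1
  have h3 := Set.ncard_add_ncard_compl X
  rw [Finite.card_option, Finite.card_option, Nat.card_coe_set_eq, Nat.card_coe_set_eq]
  omega

theorem three_le_card_block [hfin : Finite V] (D : SplitDecomposition G) (h : 3 ≤ Nat.card V)
    (b : D.Block) : 3 ≤ Nat.card ↥{z : D.Vert | D.blockOf z = b} := by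
  revert hfin
  induction D with
  | single G =>
    intro _
    rwa [← Nat.card_congr (blockGraphIsoSingle G b).toEquiv]
  | split G X hX D₁ D₂ ih₁ ih₂ =>
    intro hfin
    rcases b with b | b
    · rw [← Nat.card_congr (blockGraphIsoInl D₁ D₂ b).toEquiv]
      exact ih₁ (card_option_of_isSplit hX).1 b
    · rw [← Nat.card_congr (blockGraphIsoInr D₁ D₂ b).toEquiv]
      exact ih₂ (card_option_of_isSplit hX).2 b

theorem three_le_card_of_marked [Finite V] (D : SplitDecomposition G) {z z' : D.Vert}
    (h : D.marked.Adj z z') : 3 ≤ Nat.card V := by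
  cases D with
  | single G => exact absurd h (fun h => h)
  | split G X hX D₁ D₂ =>
    have := (card_option_of_isSplit hX).1
    have := (card_option_lt_of_isSplit hX).1
    omega

end SplitDecomposition

end SimpleGraph

/-! ### Decompositions with at most two markers per block. -/

namespace SimpleGraph

/-- A graph is brittle if any two disjoint edges `ab`, `a'b'` force the edge `ab'`: all cuts are
thin. -/
def IsBrittle {V : Type u} (G : SimpleGraph V) : Prop :=
  ∀ a b a' b', G.Adj a b → G.Adj a' b' → a ≠ b' → a' ≠ b → G.Adj a b'

theorem IsBrittle.thinCut {V : Type u} {G : SimpleGraph V} (h : G.IsBrittle) (X : Set V) :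
    G.ThinCut X := by
  intro a a' b b' ha ha' hb hb' hab hab'
  refine h a b a' b' hab hab' ?_ ?_
  · rintro rfl
    exact hb' ha
  · rintro rfl
    exact hb ha'

theorem IsBrittle.of_embedding {V : Type u} {W : Type v} {G : SimpleGraph V} {H : SimpleGraph W}
    (h : G.IsBrittle) (φ : H ↪g G) : H.IsBrittle := by
  intro a b a' b' hab hab' h1 h2
  exact φ.map_adj_iff.1 (h _ _ _ _ (φ.map_adj_iff.2 hab) (φ.map_adj_iff.2 hab')
    (φ.injective.ne h1) (φ.injective.ne h2))

namespace SplitDecomposition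

variable {V : Type u} {G : SimpleGraph V}

theorem tree_split_inl {X : Set V} {hX : G.IsSplit X} {D₁ : SplitDecomposition (G.splitPart X)}
    {D₂ : SplitDecomposition (G.splitPart Xᶜ)} {b b' : D₁.Block} :
    (split G X hX D₁ D₂).tree.Adj (Sum.inl b) (Sum.inl b') ↔ D₁.tree.Adj b b' := by
  refine and_congr Sum.inl_injective.ne_iff ⟨?_, ?_⟩
  · rintro ⟨x | x, y | y, h, hx, hy⟩
    · exact ⟨x, y, marked_split_inl.1 h, Sum.inl_injective hx, Sum.inl_injective hy⟩
    · exact absurd hy Sum.inr_ne_inl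
    · exact absurd hx Sum.inr_ne_inl
    · exact absurd hy Sum.inr_ne_inl
  · rintro ⟨x, y, h, rfl, rfl⟩
    exact ⟨Sum.inl x, Sum.inl y, marked_split_inl.2 h, rfl, rfl⟩

theorem tree_split_inr {X : Set V} {hX : G.IsSplit X} {D₁ : SplitDecomposition (G.splitPart X)}
    {D₂ : SplitDecomposition (G.splitPart Xᶜ)} {b b' : D₂.Block} :
    (split G X hX D₁ D₂).tree.Adj (Sum.inr b) (Sum.inr b') ↔ D₂.tree.Adj b b' := by
  refine and_congr Sum.inr_injective.ne_iff ⟨?_, ?_⟩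
  · rintro ⟨x | x, y | y, h, hx, hy⟩
    · exact absurd hy Sum.inl_ne_inr
    · exact absurd hx Sum.inl_ne_inr
    · exact absurd hy Sum.inl_ne_inr
    · exact ⟨x, y, marked_split_inr.1 h, Sum.inr_injective hx, Sum.inr_injective hy⟩
  · rintro ⟨x, y, h, rfl, rfl⟩
    exact ⟨Sum.inr x, Sum.inr y, marked_split_inr.2 h, rfl, rfl⟩

theorem tree_split_inl_inr {X : Set V} {hX : G.IsSplit X}
    {D₁ : SplitDecomposition (G.splitPart X)} {D₂ : SplitDecomposition (G.splitPart Xᶜ)}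
    {b : D₁.Block} {c : D₂.Block} :
    (split G X hX D₁ D₂).tree.Adj (Sum.inl b) (Sum.inr c) ↔
      b = D₁.blockOf (D₁.emb none) ∧ c = D₂.blockOf (D₂.emb none) := by
  constructor
  · rintro ⟨-, x | x, y | y, h, hx, hy⟩
    · exact absurd hy Sum.inl_ne_inr
    · obtain ⟨rfl, rfl⟩ := marked_split_inl_inr.1 h
      exact ⟨(Sum.inl_injective hx).symm, (Sum.inr_injective hy).symm⟩
    · exact absurd hx Sum.inr_ne_inl
    · exact absurd hx Sum.inr_ne_inl
  · rintro ⟨rfl, rfl⟩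
    exact ⟨Sum.inl_ne_inr, _, _, marked_split_inl_inr.2 ⟨rfl, rfl⟩, rfl, rfl⟩

/-- Each block contains at most two markers and vertices of `R`. -/
def Slim : {V : Type u} → {G : SimpleGraph V} → SplitDecomposition G → Set V → Prop
  | _, _, single _, R => ∀ a ∈ R, ∀ b ∈ R, ∀ c ∈ R, a = b ∨ a = c ∨ b = c
  | _, _, split _ X _ D₁ D₂, R =>
      D₁.Slim (insert none (sideMap X '' R)) ∧ D₂.Slim (insert none (sideMap Xᶜ '' R))

/-- After a split, the set for each side contains the new marker, which leaves room for one vertex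
of `R` per side. -/
theorem Slim.eq_of_mem {D : SplitDecomposition G} {R : Set V} (h : D.Slim R) :
    ∀ a ∈ R, ∀ b ∈ R, ∀ c ∈ R, a = b ∨ a = c ∨ b = c := by
  induction D with
  | single G => exact h
  | split G X hX D₁ D₂ ih₁ ih₂ =>
    have k₁ : ∀ a ∈ R, a ∈ X → ∀ b ∈ R, b ∈ X → a = b := by
      intro a ha haX b hb hbX
      have := ih₁ h.1 none (Or.inl rfl) (sideMap X a) (Or.inr ⟨a, ha, rfl⟩) (sideMap X b)
        (Or.inr ⟨b, hb, rfl⟩)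
      simpa [sideMap_of_mem haX, sideMap_of_mem hbX] using this
    have k₂ : ∀ a ∈ R, a ∉ X → ∀ b ∈ R, b ∉ X → a = b := by
      intro a ha haX b hb hbX
      have := ih₂ h.2 none (Or.inl rfl) (sideMap Xᶜ a) (Or.inr ⟨a, ha, rfl⟩) (sideMap Xᶜ b)
        (Or.inr ⟨b, hb, rfl⟩)
      simpa [sideMap_of_mem (X := Xᶜ) haX, sideMap_of_mem (X := Xᶜ) hbX] using this
    intro a ha b hb c hc
    by_cases haX : a ∈ X <;> by_cases hbX : b ∈ X
    · exact Or.inl (k₁ a ha haX b hb hbX)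
    · by_cases hcX : c ∈ X
      · exact Or.inr (Or.inl (k₁ a ha haX c hc hcX))
      · exact Or.inr (Or.inr (k₂ b hb hbX c hc hcX))
    · by_cases hcX : c ∈ X
      · exact Or.inr (Or.inr (k₁ b hb hbX c hc hcX))
      · exact Or.inr (Or.inl (k₂ a ha haX c hc hcX))
    · exact Or.inl (k₂ a ha haX b hb hbX)

theorem exists_three_of_not_slim {D : SplitDecomposition G} {R : Set V} (h : ¬ D.Slim R) :
    ∃ z : Fin 3 → D.Vert, Function.Injective z ∧ (∀ i j, D.blockOf (z i) = D.blockOf (z j)) ∧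
      ∀ i, (∃ z', D.marked.Adj (z i) z') ∨ ∃ x ∈ R, D.emb x = z i := by
  induction D with
  | single G =>
    simp only [Slim] at h
    push Not at h
    obtain ⟨a, ha, b, hb, c, hc, hab, hac, hbc⟩ := h
    refine ⟨(![a, b, c] : Fin 3 → _), ?_, fun _ _ => rfl, ?_⟩
    · intro i j hij
      fin_cases i <;> fin_cases j <;> simp_all
    · intro i
      refine Or.inr ?_
      fin_cases i
      · exact ⟨a, ha, rfl⟩
      · exact ⟨b, hb, rfl⟩
      · exact ⟨c, hc, rfl⟩
  | split G X hX D₁ D₂ ih₁ ih₂ =>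
    rcases not_and_or.1 h with h | h
    · obtain ⟨z, hz, hb, hm⟩ := ih₁ h
      refine ⟨fun i => Sum.inl (z i), Sum.inl_injective.comp hz,
        fun i j => congrArg Sum.inl (hb i j), fun i => ?_⟩
      have hnone : D₁.emb none = z i →
          ∃ z', (split G X hX D₁ D₂).marked.Adj (Sum.inl (z i)) z' := fun e =>
        ⟨Sum.inr (D₂.emb none), marked_split_inl_inr.2 ⟨e.symm, rfl⟩⟩
      rcases hm i with ⟨z', h'⟩ | ⟨p, rfl | ⟨x, hx, rfl⟩, hp⟩
      · exact Or.inl ⟨Sum.inl z', marked_split_inl.2 h'⟩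
      · exact Or.inl (hnone hp)
      · by_cases hxX : x ∈ X
        · exact Or.inr ⟨x, hx, (emb_split_of_mem hxX).trans (congrArg Sum.inl hp)⟩
        · rw [sideMap_of_notMem hxX] at hp
          exact Or.inl (hnone hp)
    · obtain ⟨z, hz, hb, hm⟩ := ih₂ h
      refine ⟨fun i => Sum.inr (z i), Sum.inr_injective.comp hz,
        fun i j => congrArg Sum.inr (hb i j), fun i => ?_⟩
      have hnone : D₂.emb none = z i →
          ∃ z', (split G X hX D₁ D₂).marked.Adj (Sum.inr (z i)) z' := fun e =>
        ⟨Sum.inl (D₁.emb none), (marked_split_inl_inr.2 ⟨rfl, e.symm⟩).symm⟩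
      rcases hm i with ⟨z', h'⟩ | ⟨p, rfl | ⟨x, hx, rfl⟩, hp⟩
      · exact Or.inl ⟨Sum.inr z', marked_split_inr.2 h'⟩
      · exact Or.inl (hnone hp)
      · by_cases hxX : x ∈ X
        · rw [sideMap_of_notMem (X := Xᶜ) (fun hn => hn hxX)] at hp
          exact Or.inl (hnone hp)
        · exact Or.inr ⟨x, hx, (emb_split_of_notMem hxX).trans (congrArg Sum.inr hp)⟩

theorem exists_three_markers {D : SplitDecomposition G} (h : ¬ D.Slim ∅) :
    ∃ z z' : Fin 3 → D.Vert, Function.Injective z ∧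
      (∀ i j, D.blockOf (z i) = D.blockOf (z j)) ∧ ∀ i, D.marked.Adj (z i) (z' i) := by
  obtain ⟨z, hz, hb, hm⟩ := exists_three_of_not_slim h
  have : ∀ i, ∃ z', D.marked.Adj (z i) z' := fun i => by simpa using hm i
  choose z' hz' using this
  exact ⟨z, z', hz, hb, hz'⟩

/-- Three markers in a block would give it three distinct neighbours in the tree. If two of them led
to the same block, or one led back to its own block, the vertices behind another marker would have
two different representatives in one block. -/
theorem slim_of_isPathGraph {D : SplitDecomposition G} (h : D.tree.IsPathGraph) : D.Slim ∅ := by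
  by_contra hs
  obtain ⟨z, z', hz, hb, hm⟩ := exists_three_markers hs
  have hpart : ∀ i x, D.toward (D.blockOf (z 0)) x = z i ↔
      D.toward (D.blockOf (z' i)) x ≠ z' i := by
    intro i x
    rw [hb 0 i]
    exact D.toward_eq_iff_of_marked (hm i) x
  have hne : ∀ i, ∃ x, D.toward (D.blockOf (z 0)) x = z i := by
    intro i
    rw [hb 0 i]
    exact D.exists_toward_eq (z i)
  have hthird : ∀ i j : Fin 3, ∃ k, k ≠ i ∧ k ≠ j := by decide
  have hadj : ∀ i, D.tree.Adj (D.blockOf (z 0)) (D.blockOf (z' i)) := by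
    intro i
    refine ⟨fun e => ?_, z i, z' i, hm i, hb i 0, rfl⟩
    have hz'i : ∀ k, k ≠ i → z k = z' i := by
      intro k hk
      obtain ⟨x, hx⟩ := hne k
      have h1 : ¬ D.toward (D.blockOf (z 0)) x = z i := fun h => hk (hz (hx.symm.trans h))
      rw [hpart, not_not, ← e, hx] at h1
      exact h1
    have h12 : ∀ i : Fin 3, ∃ k l, k ≠ i ∧ l ≠ i ∧ k ≠ l := by decide
    obtain ⟨k, l, hk, hl, hkl⟩ := h12 i
    exact hkl (hz ((hz'i k hk).trans (hz'i l hl).symm))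
  have hinj : ∀ i j, i ≠ j → D.blockOf (z' i) ≠ D.blockOf (z' j) := by
    intro i j hij e
    have hzz : z' i ≠ z' j := by
      intro e'
      obtain ⟨x, hx⟩ := hne i
      have h1 := (hpart i x).1 hx
      rw [e', ← hpart j] at h1
      exact hij (hz (hx.symm.trans h1))
    obtain ⟨k, hki, hkj⟩ := hthird i j
    obtain ⟨x, hx⟩ := hne k
    have h1 : ¬ D.toward (D.blockOf (z 0)) x = z i := fun h => hki (hz (hx.symm.trans h))
    have h2 : ¬ D.toward (D.blockOf (z 0)) x = z j := fun h => hkj (hz (hx.symm.trans h))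
    rw [hpart, not_not] at h1 h2
    rw [← e, h1] at h2
    exact hzz h2
  obtain ⟨n, ⟨φ⟩⟩ := h
  have h0 := fun i => φ.map_adj_iff.2 (hadj i)
  simp only [pathGraph_adj] at h0
  have h1 : ∀ i j, i ≠ j → (φ (D.blockOf (z' i))).val ≠ (φ (D.blockOf (z' j))).val :=
    fun i j hij e => hinj i j hij (φ.injective (Fin.ext e))
  have := h0 0
  have := h0 1
  have := h0 2
  have := h1 0 1 (by decide)
  have := h1 0 2 (by decide)
  have := h1 1 2 (by decide)
  omega

/-- An enumeration of the tree as a path with `n` nodes, in which the blocks with vertices of `R`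
are at the ends, and a block with several of them is the only one. -/
structure IsPathIndex (D : SplitDecomposition G) (R : Set V) (n : ℕ) (g : D.Block → ℕ) : Prop where
  inj : Function.Injective g
  lt : ∀ b, g b < n
  surj : ∀ i < n, ∃ b, g b = i
  adj : ∀ b c, D.tree.Adj b c ↔ g b + 1 = g c ∨ g c + 1 = g b
  extreme : ∀ x ∈ R, g (D.blockOf (D.emb x)) = 0 ∨ g (D.blockOf (D.emb x)) + 1 = n
  eq_one : ∀ x ∈ R, ∀ y ∈ R, x ≠ y → D.blockOf (D.emb x) = D.blockOf (D.emb y) → n = 1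

theorem IsPathIndex.reverse {D : SplitDecomposition G} {R : Set V} {n : ℕ} {g : D.Block → ℕ}
    (h : D.IsPathIndex R n g) : D.IsPathIndex R n (fun b => n - 1 - g b) where
  inj b c e := h.inj (by have := h.lt b; have := h.lt c; simp only at e; omega)
  lt b := by have := h.lt b; omega
  surj i hi := by
    obtain ⟨b, hb⟩ := h.surj (n - 1 - i) (by omega)
    exact ⟨b, by omega⟩
  adj b c := by
    have := h.lt b
    have := h.lt c
    rw [h.adj]
    omega
  extreme x hx := by
    have := h.lt (D.blockOf (D.emb x))
    have := h.extreme x hx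
    omega
  eq_one := h.eq_one

theorem IsPathIndex.exists_last {D : SplitDecomposition G} {R : Set V} {n : ℕ} {g : D.Block → ℕ}
    (h : D.IsPathIndex R n g) {r : V} (hr : r ∈ R) :
    ∃ g, D.IsPathIndex R n g ∧ g (D.blockOf (D.emb r)) + 1 = n ∧
      ∀ x ∈ R, x ≠ r → g (D.blockOf (D.emb x)) = 0 := by
  have key : ∀ g, D.IsPathIndex R n g → g (D.blockOf (D.emb r)) + 1 = n →
      ∀ x ∈ R, x ≠ r → g (D.blockOf (D.emb x)) = 0 := by
    intro g h hr' x hx hxr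
    rcases h.extreme x hx with h' | h'
    · exact h'
    · have := h.eq_one x hx r hr hxr (h.inj (by omega))
      omega
  rcases h.extreme r hr with h' | h'
  · have : n - 1 - g (D.blockOf (D.emb r)) + 1 = n := by
      have := h.lt (D.blockOf (D.emb r))
      omega
    exact ⟨_, h.reverse, this, key _ h.reverse this⟩
  · exact ⟨g, h, h', key g h h'⟩

theorem IsPathIndex.exists_first {D : SplitDecomposition G} {R : Set V} {n : ℕ}
    {g : D.Block → ℕ} (h : D.IsPathIndex R n g) {r : V} (hr : r ∈ R) :
    ∃ g, D.IsPathIndex R n g ∧ g (D.blockOf (D.emb r)) = 0 ∧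
      ∀ x ∈ R, x ≠ r → g (D.blockOf (D.emb x)) + 1 = n := by
  obtain ⟨g, h, h', h''⟩ := h.exists_last hr
  refine ⟨_, h.reverse, ?_, fun x hx hxr => ?_⟩
  · omega
  · have := h'' x hx hxr
    have := h.lt (D.blockOf (D.emb x))
    omega

theorem blockOf_emb_split_of_mem {X : Set V} {hX : G.IsSplit X}
    {D₁ : SplitDecomposition (G.splitPart X)}
    {D₂ : SplitDecomposition (G.splitPart Xᶜ)} {x : V} (hx : x ∈ X) :
    (split G X hX D₁ D₂).blockOf ((split G X hX D₁ D₂).emb x) =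
      Sum.inl (D₁.blockOf (D₁.emb (sideMap X x))) := by
  rw [emb_split_of_mem hx]
  rfl

theorem blockOf_emb_split_of_notMem {X : Set V} {hX : G.IsSplit X}
    {D₁ : SplitDecomposition (G.splitPart X)}
    {D₂ : SplitDecomposition (G.splitPart Xᶜ)} {x : V} (hx : x ∉ X) :
    (split G X hX D₁ D₂).blockOf ((split G X hX D₁ D₂).emb x) =
      Sum.inr (D₂.blockOf (D₂.emb (sideMap Xᶜ x))) := by
  rw [emb_split_of_notMem hx]
  rfl

/-- The set `R` is what makes the induction close. On either side of a split it contains the new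
marker, so one enumeration can be made to end, and the other to begin, at the block of the marker;
the other elements of `R` are then at the far ends of the concatenation. -/
theorem Slim.exists_isPathIndex {D : SplitDecomposition G} {R : Set V} (h : D.Slim R) :
    ∃ n g, D.IsPathIndex R n g := by
  induction D with
  | single G =>
    refine ⟨1, fun _ => 0, fun _ _ _ => rfl, fun _ => Nat.one_pos, fun i hi => ⟨(), by omega⟩,
      fun b c => ?_, fun _ _ => Or.inl rfl, fun _ _ _ _ _ _ => rfl⟩
    exact iff_of_false (fun h => h.1 rfl) (by omega)
  | split G X hX D₁ D₂ ih₁ ih₂ =>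
    obtain ⟨n₁, g₁, h₁⟩ := ih₁ h.1
    obtain ⟨n₂, g₂, h₂⟩ := ih₂ h.2
    obtain ⟨g₁, h₁, hl₁, hf₁⟩ := h₁.exists_last (r := none) (Or.inl rfl)
    obtain ⟨g₂, h₂, hf₂, hl₂⟩ := h₂.exists_first (r := none) (Or.inl rfl)
    have hpos := h₂.lt (D₂.blockOf (D₂.emb none))
    have hcross : ∀ b c, (split G X hX D₁ D₂).tree.Adj (Sum.inl b) (Sum.inr c) ↔
        g₁ b + 1 = n₁ + g₂ c := by
      intro b c
      rw [tree_split_inl_inr]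
      have := h₁.lt b
      refine ⟨?_, fun e => ⟨h₁.inj ?_, h₂.inj ?_⟩⟩
      · rintro ⟨rfl, rfl⟩
        omega
      · omega
      · omega
    refine ⟨n₁ + n₂, fun b => Sum.elim g₁ (fun c => n₁ + g₂ c) b, ?_, ?_, ?_, ?_, ?_, ?_⟩
    · rintro (b | b) (c | c) e
      · exact congrArg Sum.inl (h₁.inj e)
      · have := h₁.lt b
        simp only [Sum.elim_inl, Sum.elim_inr] at e
        omega
      · have := h₁.lt c
        simp only [Sum.elim_inl, Sum.elim_inr] at e
        omega
      · exact congrArg Sum.inr (h₂.inj (Nat.add_left_cancel e))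
    · rintro (b | b)
      · have := h₁.lt b
        simp only [Sum.elim_inl]
        omega
      · have := h₂.lt b
        simp only [Sum.elim_inr]
        omega
    · intro i hi
      by_cases hi' : i < n₁
      · obtain ⟨b, hb⟩ := h₁.surj i hi'
        exact ⟨Sum.inl b, hb⟩
      · obtain ⟨b, hb⟩ := h₂.surj (i - n₁) (by omega)
        exact ⟨Sum.inr b, by simp only [Sum.elim_inr]; omega⟩
    · rintro (b | b) (c | c)
      · exact tree_split_inl.trans (h₁.adj b c)
      · rw [hcross]
        have := h₁.lt b
        simp only [Sum.elim_inl, Sum.elim_inr]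
        omega
      · refine ((adj_comm _ _ _).trans (hcross c b)).trans ?_
        have := h₁.lt c
        simp only [Sum.elim_inl, Sum.elim_inr]
        omega
      · refine (tree_split_inr.trans (h₂.adj b c)).trans ?_
        simp only [Sum.elim_inr]
        omega
    · intro x hx
      by_cases hxX : x ∈ X
      · rw [blockOf_emb_split_of_mem hxX]
        exact Or.inl (hf₁ _ (Or.inr ⟨x, hx, rfl⟩) (by rw [Ne, sideMap_eq_none]; exact not_not.2 hxX))
      · rw [blockOf_emb_split_of_notMem hxX]
        have := hl₂ _ (Or.inr ⟨x, hx, rfl⟩) (by rw [Ne, sideMap_eq_none]; exact not_not.2 hxX)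
        refine Or.inr ?_
        simp only [Sum.elim_inr]
        omega
    · intro x hx y hy hxy e
      -- Two elements of `R` on the same side would, with the marker, make three; on different sides
      -- they lie in different blocks.
      exfalso
      by_cases hxX : x ∈ X <;> by_cases hyX : y ∈ X
      · have := h.1.eq_of_mem none (Or.inl rfl) _ (Or.inr ⟨x, hx, rfl⟩) _ (Or.inr ⟨y, hy, rfl⟩)
        simp [sideMap_of_mem hxX, sideMap_of_mem hyX] at this
        exact hxy this
      · rw [blockOf_emb_split_of_mem hxX, blockOf_emb_split_of_notMem hyX] at e
        exact Sum.inl_ne_inr e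
      · rw [blockOf_emb_split_of_notMem hxX, blockOf_emb_split_of_mem hyX] at e
        exact Sum.inr_ne_inl e
      · have := h.2.eq_of_mem none (Or.inl rfl) _ (Or.inr ⟨x, hx, rfl⟩) _ (Or.inr ⟨y, hy, rfl⟩)
        simp [sideMap_of_mem (X := Xᶜ) hxX, sideMap_of_mem (X := Xᶜ) hyX] at this
        exact hxy this

theorem Slim.isPathGraph_tree {D : SplitDecomposition G} (h : D.Slim ∅) :
    D.tree.IsPathGraph := by
  obtain ⟨n, g, hg⟩ := h.exists_isPathIndex
  exact isPathGraph_of_index g hg.inj hg.adj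
    fun a b t _ ht => hg.surj t (ht.trans_lt (hg.lt b))

/-- An ordering of the vertices all of whose cuts are thin, and in which the vertices of `R` are
first or last. -/
structure IsThinIndex (G : SimpleGraph V) (R : Set V) (f : V → ℕ) : Prop where
  inj : Function.Injective f
  thin : ∀ t, G.ThinCut {x | f x ≤ t}
  extreme : ∀ x ∈ R, (∀ y, f x ≤ f y) ∨ ∀ y, f y ≤ f x

theorem IsThinIndex.exists_reverse [Finite V] {R : Set V} {f : V → ℕ} (h : IsThinIndex G R f) :
    ∃ f', IsThinIndex G R f' ∧ ∀ x y, f' x ≤ f' y ↔ f y ≤ f x := by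
  obtain ⟨M, hM⟩ := (Set.finite_range f).bddAbove
  have hM : ∀ x, f x ≤ M := fun x => hM ⟨x, rfl⟩
  have hle : ∀ x y, M - f x ≤ M - f y ↔ f y ≤ f x := fun x y => by
    have := hM x
    have := hM y
    omega
  refine ⟨fun x => M - f x, ⟨fun x y e => h.inj ?_, fun t => ?_, fun x hx => ?_⟩, hle⟩
  · exact le_antisymm ((hle y x).1 e.ge) ((hle x y).1 e.le)
  · by_cases ht : t < M
    · convert (h.thin (M - t - 1)).compl using 1
      ext x
      have := hM x
      simp only [Set.mem_ofPred_eq, Set.mem_compl_iff]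
      omega
    · intro _ _ b _ _ _ hb
      exact absurd (show M - f b ≤ t by omega) hb
  · rcases h.extreme x hx with h' | h'
    · exact Or.inr fun y => (hle y x).2 (h' y)
    · exact Or.inl fun y => (hle x y).2 (h' y)

theorem IsThinIndex.exists_last [Finite V] {R : Set V} {f : V → ℕ} (h : IsThinIndex G R f) {r : V}
    (hr : r ∈ R) : ∃ f, IsThinIndex G R f ∧ (∀ y, f y ≤ f r) ∧ ∀ x ∈ R, x ≠ r → ∀ y, f x ≤ f y := by
  have key : ∀ f, IsThinIndex G R f → (∀ y, f y ≤ f r) → ∀ x ∈ R, x ≠ r → ∀ y, f x ≤ f y := by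
    intro f h hl x hx hxr
    rcases h.extreme x hx with h' | h'
    · exact h'
    · exact absurd (h.inj (le_antisymm (hl x) (h' r))) hxr
  rcases h.extreme r hr with h' | h'
  · obtain ⟨f', hf', hle⟩ := h.exists_reverse
    have hl : ∀ y, f' y ≤ f' r := fun y => (hle y r).2 (h' y)
    exact ⟨f', hf', hl, key f' hf' hl⟩
  · exact ⟨f, h, h', key f h h'⟩

theorem IsThinIndex.exists_first [Finite V] {R : Set V} {f : V → ℕ} (h : IsThinIndex G R f)
    {r : V} (hr : r ∈ R) :
    ∃ f, IsThinIndex G R f ∧ (∀ y, f r ≤ f y) ∧ ∀ x ∈ R, x ≠ r → ∀ y, f y ≤ f x := by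
  obtain ⟨f, h, hl, hf⟩ := h.exists_last hr
  obtain ⟨f', hf', hle⟩ := h.exists_reverse
  exact ⟨f', hf', fun y => (hle r y).2 (hl y), fun x hx hxr y => (hle y x).2 (hf x hx hxr y)⟩

theorem exists_isThinIndex_of_isBrittle [Finite V] (hG : G.IsBrittle) {R : Set V}
    (hR : ∀ a ∈ R, ∀ b ∈ R, ∀ c ∈ R, a = b ∨ a = c ∨ b = c) : ∃ f, IsThinIndex G R f := by
  classical
  obtain ⟨n, ⟨e⟩⟩ := Finite.exists_equiv_fin V
  have hinj : Function.Injective fun x => (e x).val := fun x y h => e.injective (Fin.ext h)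
  rcases R.eq_empty_or_nonempty with rfl | ⟨r, hr⟩
  · exact ⟨fun x => (e x).val, hinj, fun _ => hG.thinCut _, fun x hx => absurd hx id⟩
  have hs : ∃ s, ∀ x ∈ R, x = r ∨ x = s := by
    by_cases h : ∃ s ∈ R, s ≠ r
    · obtain ⟨s, hs, hsr⟩ := h
      refine ⟨s, fun x hx => ?_⟩
      have := hR x hx r hr s hs
      tauto
    · push Not at h
      exact ⟨r, fun x hx => Or.inl (h x hx)⟩
  obtain ⟨s, hs⟩ := hs
  -- All cuts are thin, so any order will do: `r` comes first, `s` last, and the values `1, …, n`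
  -- remain for the others.
  let f : V → ℕ := fun x => if x = r then 0 else if x = s then n + 1 else (e x).val + 1
  have hfr : f r = 0 := if_pos rfl
  have hlt : ∀ x, x ≠ s → f x < n + 1 := by
    intro x hx
    have := (e x).2
    simp only [f, if_neg hx]
    split_ifs <;> omega
  refine ⟨f, ?_, fun _ => hG.thinCut _, fun x hx => ?_⟩
  · intro x y h
    have hx := (e x).2
    have hy := (e y).2
    simp only [f] at h
    split_ifs at h with h1 h2 h3 h4 h5 h6 h7 h8
    all_goals first | omega | (exact hinj (by simp only; omega)) | simp_all
  · by_cases hxr : x = r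
    · subst hxr
      exact Or.inl fun y => by rw [hfr]; exact Nat.zero_le _
    · obtain rfl := (hs x hx).resolve_left hxr
      refine Or.inr fun y => ?_
      have hfx : f x = n + 1 := by simp [f, hxr]
      by_cases hy : y = x
      · rw [hy]
      · have := hlt y hy
        omega

/-- Same gluing as for the tree: an order of the first part with the marker last is followed by an
order of the second with the marker first, both markers being removed. -/
theorem Slim.exists_isThinIndex [hfin : Finite V] {D : SplitDecomposition G} {R : Set V}
    (h : D.Slim R) (hD : ∀ b, (D.blockGraph b).IsBrittle) : ∃ f, IsThinIndex G R f := by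
  classical
  revert hfin
  induction D with
  | single G =>
    intro hfin
    exact exists_isThinIndex_of_isBrittle
      ((hD ()).of_embedding (blockGraphIsoSingle G ()).toEmbedding) h
  | split G X hX D₁ D₂ ih₁ ih₂ =>
    intro hfin
    obtain ⟨f₁, h₁⟩ := ih₁ h.1 fun b =>
      (hD (Sum.inl b)).of_embedding (blockGraphIsoInl D₁ D₂ b).toEmbedding
    obtain ⟨f₂, h₂⟩ := ih₂ h.2 fun b =>
      (hD (Sum.inr b)).of_embedding (blockGraphIsoInr D₁ D₂ b).toEmbedding
    obtain ⟨f₁, h₁, hl₁, hf₁⟩ := h₁.exists_last (r := none) (Or.inl rfl)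
    obtain ⟨f₂, h₂, hf₂, hl₂⟩ := h₂.exists_first (r := none) (Or.inl rfl)
    let f : _ → ℕ := fun x => if x ∈ X then f₁ (sideMap X x) else f₁ none + f₂ (sideMap Xᶜ x)
    have hfX : ∀ x ∈ X, f x = f₁ (sideMap X x) := fun x hx => if_pos hx
    have hfX' : ∀ x, x ∉ X → f x = f₁ none + f₂ (sideMap Xᶜ x) := fun x hx => if_neg hx
    have hn : ∀ x ∈ X, sideMap X x ≠ none := fun x hx => by
      rw [Ne, sideMap_eq_none]
      exact not_not.2 hx
    have hn' : ∀ x, x ∉ X → sideMap Xᶜ x ≠ none := fun x hx => by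
      rw [Ne, sideMap_eq_none]
      exact not_not.2 hx
    have hlt : ∀ x ∈ X, f x < f₁ none := fun x hx => by
      rw [hfX x hx]
      exact lt_of_le_of_ne (hl₁ _) (h₁.inj.ne (hn x hx))
    have hgt : ∀ x, x ∉ X → f₁ none + f₂ none < f x := fun x hx => by
      rw [hfX' x hx]
      have := lt_of_le_of_ne (hf₂ _) (h₂.inj.ne (hn' x hx)).symm
      omega
    refine ⟨f, ?_, fun t => ?_, fun x hx => ?_⟩
    · intro x y e
      by_cases hx : x ∈ X <;> by_cases hy : y ∈ X
      · rw [hfX x hx, hfX y hy] at e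
        have := h₁.inj e
        rw [sideMap_of_mem hy, sideMap_eq_some] at this
        exact this
      · have := hlt x hx
        have := hgt y hy
        omega
      · have := hlt y hy
        have := hgt x hx
        omega
      · rw [hfX' x hx, hfX' y hy] at e
        have := h₂.inj (Nat.add_left_cancel e)
        rw [sideMap_of_mem (X := Xᶜ) hy, sideMap_eq_some] at this
        exact this
    -- Small thresholds give cuts lifted from the first part, those in the gap between the sides
    -- give `X` itself, and large ones give cuts lifted from the second part.
    · by_cases ht : t < f₁ none
      · convert hX.thinCut.of_splitPart (h₁.thin t) using 1
        ext x
        by_cases hx : x ∈ X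
        · simp only [Set.mem_ofPred_eq, Set.mem_preimage, hfX x hx]
        · have := hgt x hx
          simp only [Set.mem_ofPred_eq, Set.mem_preimage, sideMap_of_notMem hx]
          omega
      · by_cases ht' : t < f₁ none + f₂ none
        · convert hX.thinCut using 1
          ext x
          by_cases hx : x ∈ X
          · have := hlt x hx
            exact iff_of_true (show f x ≤ t by omega) hx
          · have := hgt x hx
            exact iff_of_false (show ¬ f x ≤ t by omega) hx
        · convert hX.thinCut.compl.of_splitPart (h₂.thin (t - f₁ none)) using 1
          ext x
          by_cases hx : x ∈ X
          · have := hlt x hx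
            simp only [Set.mem_ofPred_eq, Set.mem_preimage,
              sideMap_of_notMem (X := Xᶜ) (fun h => h hx)]
            omega
          · simp only [Set.mem_ofPred_eq, Set.mem_preimage, hfX' x hx]
            omega
    · by_cases hxX : x ∈ X
      · refine Or.inl fun y => ?_
        have h0 := hf₁ _ (Or.inr ⟨x, hx, rfl⟩) (hn x hxX)
        rw [hfX x hxX]
        by_cases hy : y ∈ X
        · rw [hfX y hy]
          exact h0 _
        · have := hgt y hy
          have := h0 none
          omega
      · refine Or.inr fun y => ?_
        have h0 := hl₂ _ (Or.inr ⟨x, hx, rfl⟩) (hn' x hxX)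
        rw [hfX' x hxX]
        by_cases hy : y ∈ X
        · have := hlt y hy
          omega
        · rw [hfX' y hy]
          exact Nat.add_le_add_left (h0 _) _

theorem Slim.hasThinOrder [Finite V] {D : SplitDecomposition G} (h : D.Slim ∅)
    (hD : ∀ b, (D.blockGraph b).IsBrittle) : G.HasThinOrder := by
  obtain ⟨f, hf⟩ := h.exists_isThinIndex hD
  exact ⟨f, hf.inj, hf.thin⟩

end SplitDecomposition

end SimpleGraph

/-! ### Crossing thin cuts. -/

namespace SimpleGraph

variable {V : Type u} {K : Type w} {G : SimpleGraph V}

/-- The sets `X` and `Y` cross: all four quadrants are nonempty. -/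
def Crosses (X Y : Set V) : Prop :=
  (X ∩ Y).Nonempty ∧ (X \ Y).Nonempty ∧ (Y \ X).Nonempty ∧ (X ∪ Y)ᶜ.Nonempty

theorem Crosses.symm {X Y : Set V} (h : Crosses X Y) : Crosses Y X := by
  obtain ⟨h1, h2, h3, h4⟩ := h
  exact ⟨by rwa [Set.inter_comm], h3, h2, by rwa [Set.union_comm]⟩

theorem Crosses.compl_left {X Y : Set V} (h : Crosses X Y) : Crosses Xᶜ Y := by
  obtain ⟨⟨a, ha⟩, ⟨b, hb⟩, ⟨c, hc⟩, ⟨d, hd⟩⟩ := h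
  simp only [Set.mem_compl_iff, Set.mem_union, not_or] at hd
  refine ⟨⟨c, hc.2, hc.1⟩, ⟨d, hd⟩, ⟨a, ha.2, fun h => h ha.1⟩, ⟨b, ?_⟩⟩
  simpa using hb

theorem ThinCut.of_preimage_quot {κ : V → K} {S : Set K} (h : G.ThinCut (κ ⁻¹' S)) :
    (G.quot κ).ThinCut S := by
  rintro a a' b b' ha ha' hb hb' ⟨-, x, y, rfl, rfl, hxy⟩ ⟨-, x', y', rfl, rfl, hxy'⟩
  exact quot_adj_of_adj (h ha ha' hb hb' hxy hxy') fun e => hb' (e ▸ ha)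

/-- With two vertices on each side, only two disjoint crossing edges matter. Such a matching crosses
one of the given cuts, whose thinness yields two edges across the other given cut, whose thinness in
turn yields the two edges wanted. -/
theorem thinCut_symmDiff_bool {Q : SimpleGraph (Bool × Bool)}
    (h1 : Q.ThinCut {k | k.1 = true}) (h2 : Q.ThinCut {k | k.2 = true}) :
    Q.ThinCut {k | k.1 ≠ k.2} := by
  have e1 : Q.Adj (true, false) (true, true) → Q.Adj (false, true) (false, false) →
      Q.Adj (true, false) (false, false) ∧ Q.Adj (false, true) (true, true) := by
    intro hqp hrs
    have hps := h2 (a := (true, true)) (b := (true, false)) rfl rfl (by simp) (by simp)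
      hqp.symm hrs
    have hrq := h2 (a := (false, true)) (b' := (true, false)) rfl rfl (by simp) (by simp)
      hrs hqp.symm
    exact ⟨h1 rfl rfl (by simp) (by simp) hrq.symm hps,
      (h1 rfl rfl (by simp) (by simp) hps hrq.symm).symm⟩
  have e2 : Q.Adj (true, false) (false, false) → Q.Adj (false, true) (true, true) →
      Q.Adj (true, false) (true, true) ∧ Q.Adj (false, true) (false, false) := by
    intro hqs hrp
    have hps := h1 (a := (true, true)) (b := (false, true)) rfl rfl (by simp) (by simp)
      hrp.symm hqs
    have hqr := h1 (a := (true, false)) (b' := (false, true)) rfl rfl (by simp) (by simp)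
      hqs hrp.symm
    exact ⟨(h2 rfl rfl (by simp) (by simp) hps hqr.symm).symm,
      h2 rfl rfl (by simp) (by simp) hqr.symm hps⟩
  rintro ⟨_ | _, _ | _⟩ ⟨_ | _, _ | _⟩ ⟨_ | _, _ | _⟩ ⟨_ | _, _ | _⟩ ha ha' hb hb' hab hab' <;>
    simp only [Set.mem_ofPred_eq, ne_eq, reduceCtorEq, not_true_eq_false, not_false_eq_true]
      at ha ha' hb hb'
  all_goals first
    | exact hab
    | exact hab'
    | exact (e1 hab hab').1
    | exact (e2 hab hab').1
    | exact (e1 hab' hab).2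
    | exact (e2 hab' hab).2

/-- For crossing cuts of a connected graph the four quadrants are thin, so the claim reduces to the
quotient with four vertices. -/
theorem ThinCut.symmDiff (hG : G.Connected) {X Y : Set V} (hX : G.ThinCut X) (hY : G.ThinCut Y)
    (hXY : Crosses X Y) : G.ThinCut {x | ¬ (x ∈ X ↔ x ∈ Y)} := by
  classical
  obtain ⟨⟨a, haX, haY⟩, ⟨b, hbX, hbY⟩, ⟨c, hcY, hcX⟩, ⟨d, hd⟩⟩ := hXY
  simp only [Set.mem_compl_iff, Set.mem_union, not_or] at hd
  let κ : V → Bool × Bool := fun x => (decide (x ∈ X), decide (x ∈ Y))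
  have hκ : ∀ k, G.ThinCut (κ ⁻¹' {k}) := by
    rintro ⟨_ | _, _ | _⟩
    · convert hX.compl.inter hG hY.compl (not_not.2 haX) (not_not.2 haY) using 1
      ext x
      simp [κ]
    · convert hY.sdiff hG hX hbY hbX using 1
      ext x
      simp [κ, and_comm]
    · convert hX.sdiff hG hY hcX hcY using 1
      ext x
      simp [κ]
    · convert hX.inter hG hY hd.1 hd.2 using 1
      ext x
      simp [κ]
  convert ThinCut.preimage_quot hκ (thinCut_symmDiff_bool
    (ThinCut.of_preimage_quot ?_) (ThinCut.of_preimage_quot ?_)) using 1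
  · ext x
    simp [κ]
  · convert hX using 1
    ext x
    simp [κ]
  · convert hY using 1
    ext x
    simp [κ]

theorem isBrittle_of_thinCut (h : ∀ X, G.ThinCut X) : G.IsBrittle := by
  intro a b a' b' hab hab' h1 h2
  refine h {a, a'} (Or.inl rfl) (Or.inr rfl) ?_ ?_ hab hab'
  · rintro (rfl | rfl)
    · exact G.irrefl hab
    · exact h2 rfl
  · rintro (rfl | rfl)
    · exact h1 rfl
    · exact G.irrefl hab'

/-- If some vertex `u₀` has a non-neighbour, connectedness gives an induced path `u₀ w v`. An edge
avoiding `w` would, compared with the edges of this path, force `u₀` to be adjacent to `v`. So `w`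
is on every edge. -/
theorem IsBrittle.eq_top_or_eq_starGraph (h : G.IsBrittle) (hG : G.Connected) :
    G = ⊤ ∨ ∃ c, G = starGraph c := by
  by_cases htop : G = ⊤
  · exact Or.inl htop
  obtain ⟨u₀, v₀, hne, hnadj⟩ : ∃ u v, u ≠ v ∧ ¬ G.Adj u v := by
    by_contra hcon
    push Not at hcon
    refine htop ?_
    ext u v
    exact ⟨fun h => h.ne, fun h => hcon u v h⟩
  obtain ⟨w, hw, v, hv, hwv⟩ := hG.exists_adj_mem_notMem (X := {x | x = u₀ ∨ G.Adj u₀ x})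
    (Or.inl rfl) (fun h => h.elim (fun e => hne e.symm) hnadj)
  have huv : ¬ G.Adj u₀ v := fun h => hv (Or.inr h)
  have hvu : v ≠ u₀ := fun e => hv (Or.inl e)
  have huw : G.Adj u₀ w := hw.resolve_left (by
    rintro rfl
    exact huv hwv)
  refine Or.inr ⟨w, ?_⟩
  have hedge : ∀ x y, G.Adj x y → x = w ∨ y = w := by
    intro x y hxy
    by_contra hcon
    push Not at hcon
    obtain ⟨hxw, hyw⟩ := hcon
    have hu : ∀ y, G.Adj u₀ y → y ≠ w → False := fun y hy hyw =>
      huv (h u₀ y w v hy hwv hvu.symm hyw.symm)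
    by_cases hxu : x = u₀
    · exact hu y (hxu ▸ hxy) hyw
    by_cases hyu : y = u₀
    · exact hu x (hyu ▸ hxy.symm) hxw
    exact hu y (h u₀ w x y huw hxy (Ne.symm hyu) hxw) hyw
  have hstar : ∀ x, x ≠ w → G.Adj x w := by
    intro x hx
    obtain ⟨x', rfl, y, hy, hxy⟩ := hG.exists_adj_mem_notMem (X := {x}) rfl hx.symm
    exact ((hedge _ _ hxy).resolve_left hx) ▸ hxy
  ext x y
  rw [starGraph_adj]
  constructor
  · intro hxy
    refine ⟨hxy.ne, ?_⟩
    have := hedge x y hxy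
    tauto
  · rintro ⟨hne, rfl | rfl⟩
    · exact (hstar _ hne.symm).symm
    · exact hstar _ hne

/-- If every split is crossed by another one, and there is a split, then all cuts are thin. -/
theorem Connected.isBrittle_of_forall_crosses [Finite V] (hG : G.Connected)
    (hsplit : ∃ X : Set V, X.Nontrivial ∧ Xᶜ.Nontrivial ∧ G.ThinCut X)
    (hcross : ∀ X : Set V, X.Nontrivial → Xᶜ.Nontrivial → G.ThinCut X →
      ∃ Y, G.ThinCut Y ∧ Crosses X Y) : G.IsBrittle := by
  classical
  -- a set of two vertices that is a split
  obtain ⟨M₀, hM₀⟩ : ∃ M : Set V, (∀ W ⊆ M, G.ThinCut W) ∧ M.Nontrivial ∧ Mᶜ.Nonempty := by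
    obtain ⟨X, ⟨hX1, hX2, hX3⟩, hmin⟩ := Set.exists_min_image
      {X : Set V | X.Nontrivial ∧ Xᶜ.Nontrivial ∧ G.ThinCut X} Set.ncard (Set.toFinite _) hsplit
    obtain ⟨Y, hY, ⟨a, haX, haY⟩, ⟨b, hbX, hbY⟩, ⟨c, hcY, hcX⟩, ⟨d, hd⟩⟩ := hcross X hX1 hX2 hX3
    simp only [Set.mem_compl_iff, Set.mem_union, not_or] at hd
    -- `X` is a smallest split, and a crossing cut divides it into two smaller thin sets, which must
    -- be single vertices.
    have key : ∀ Z ⊂ X, G.ThinCut Z → Z.Subsingleton := by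
      intro Z hZX hZ
      by_contra hcon
      rw [Set.not_subsingleton_iff] at hcon
      have := hmin Z ⟨hcon, hX2.mono (Set.compl_subset_compl.2 hZX.subset), hZ⟩
      have := Set.ncard_lt_ncard hZX
      omega
    have h1 := key (X ∩ Y) ⟨Set.inter_subset_left, fun h => hbY (h hbX).2⟩
      (hX3.inter hG hY hd.1 hd.2)
    have h2 := key (X \ Y) ⟨Set.sdiff_subset, fun h => (h haX).2 haY⟩
      (hX3.sdiff hG hY hcX hcY)
    refine ⟨X, fun W hW => ?_, hX1, hX2.nonempty⟩
    by_cases ha : a ∈ W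
    · by_cases hb : b ∈ W
      · convert hX3
        refine hW.antisymm fun x hx => ?_
        by_cases hxY : x ∈ Y
        · rwa [h1 ⟨hx, hxY⟩ ⟨haX, haY⟩]
        · rwa [h2 ⟨hx, hxY⟩ ⟨hbX, hbY⟩]
      · refine thinCut_of_subsingleton fun x hx y hy => ?_
        have key' : ∀ x ∈ W, x = a := fun x hx => by
          by_cases hxY : x ∈ Y
          · exact h1 ⟨hW hx, hxY⟩ ⟨haX, haY⟩
          · exact absurd (h2 ⟨hW hx, hxY⟩ ⟨hbX, hbY⟩ ▸ hx) hb
        rw [key' x hx, key' y hy]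
    · refine thinCut_of_subsingleton fun x hx y hy => ?_
      have key' : ∀ x ∈ W, x = b := fun x hx => by
        by_cases hxY : x ∈ Y
        · exact absurd (h1 ⟨hW hx, hxY⟩ ⟨haX, haY⟩ ▸ hx) ha
        · exact h2 ⟨hW hx, hxY⟩ ⟨hbX, hbY⟩
      rw [key' x hx, key' y hy]
  -- Take a largest proper set `M` all of whose subsets are thin. If it misses only one vertex, each
  -- cut has a side inside `M` and all cuts are thin. Otherwise `M` is a split, and a cut crossing
  -- it is used to enlarge it.
  obtain ⟨M, ⟨hM, hM1, hM2⟩, hmax⟩ := Set.exists_max_image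
    {M : Set V | (∀ W ⊆ M, G.ThinCut W) ∧ M.Nontrivial ∧ Mᶜ.Nonempty} Set.ncard
    (Set.toFinite _) ⟨M₀, hM₀⟩
  by_cases hM3 : Mᶜ.Nontrivial
  swap
  · rw [Set.not_nontrivial_iff] at hM3
    refine isBrittle_of_thinCut fun X => ?_
    obtain ⟨n, hn⟩ := hM2
    by_cases hnX : n ∈ X
    · rw [← thinCut_compl]
      refine hM _ fun x hx => ?_
      by_contra hxM
      exact hx (hM3 hn hxM ▸ hnX)
    · refine hM _ fun x hx => ?_
      by_contra hxM
      exact hnX (hM3 hn hxM ▸ hx)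
  exfalso
  -- Among the cuts crossing `M`, `Y` has the fewest vertices outside `M`. If there is more than
  -- one, `Y \ M` is a split, and a cut crossing it contradicts this choice.
  obtain ⟨Y, ⟨hY, ⟨a, haM, haY⟩, ⟨b, hbM, hbY⟩, ⟨c, hcY, hcM⟩, ⟨d, hd⟩⟩, hYmin⟩ :=
    Set.exists_min_image {Y : Set V | G.ThinCut Y ∧ Crosses M Y} (fun Y => (Y \ M).ncard)
      (Set.toFinite _) (hcross M hM1 hM3 (hM M subset_rfl))
  simp only [Set.mem_compl_iff, Set.mem_union, not_or] at hd
  by_cases hN : (Y \ M).Nontrivial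
  · -- a smaller intersection
    have key : ∀ Z, G.ThinCut Z → (∃ x ∈ Y \ M, x ∈ Z) → (∃ x ∈ Y \ M, x ∉ Z) →
        (∃ x ∈ M ∩ Y, x ∈ Z) → (∃ x, x ∉ M ∧ x ∉ Y ∧ x ∉ Z) → False := by
      rintro Z hZ ⟨p, hp, hpZ⟩ ⟨q, hq, hqZ⟩ ⟨r, hr, hrZ⟩ ⟨s, hsM, hsY, hsZ⟩
      have := hYmin (Y ∩ Z) ⟨hY.inter hG hZ hsY hsZ, ⟨r, hr.1, hr.2, hrZ⟩,
        ⟨b, hbM, fun h => hbY h.1⟩, ⟨p, ⟨hp.1, hpZ⟩, hp.2⟩,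
        ⟨s, fun h => h.elim hsM fun h => hsY h.1⟩⟩
      have hlt : ((Y ∩ Z) \ M).ncard < (Y \ M).ncard := by
        refine Set.ncard_lt_ncard ⟨fun x hx => ⟨hx.1.1, hx.2⟩, fun h => ?_⟩
        exact hqZ (h hq).1.2
      omega
    have hN1 : (Y \ M)ᶜ.Nontrivial := hM1.mono fun x hx h => h.2 hx
    obtain ⟨Z, hZ, hNZ⟩ := hcross (Y \ M) hN hN1 (hY.sdiff hG (hM M subset_rfl) hbY hbM)
    -- When `Z` misses both `M ∩ Y` and everything outside `M ∪ Y`, it must meet `M`, and `Z ∪ M` is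
    -- a thin cut to which `key` applies.
    have key2 : ∀ Z, G.ThinCut Z → Crosses (Y \ M) Z → (∀ x ∈ M ∩ Y, x ∉ Z) →
        (∀ x, x ∉ M → x ∉ Y → x ∉ Z) → False := by
      rintro Z hZ ⟨⟨p, hp, hpZ⟩, ⟨q, hq, hqZ⟩, ⟨r, hrZ, hr⟩, -⟩ hA hN2
      have hrM : r ∈ M := by
        by_contra hrM
        by_cases hrY : r ∈ Y
        · exact hr ⟨hrY, hrM⟩
        · exact hN2 r hrM hrY hrZ
      refine key (Z ∪ M) (hZ.union hG (hM M subset_rfl) hrZ hrM) ⟨p, hp, Or.inl hpZ⟩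
        ⟨q, hq, fun h => h.elim hqZ hq.2⟩ ⟨a, ⟨haM, haY⟩, Or.inr haM⟩
        ⟨d, hd.1, hd.2, fun h => h.elim (hN2 d hd.1 hd.2) hd.1⟩
    have hNZ' : Crosses (Y \ M) Zᶜ := hNZ.symm.compl_left.symm
    by_cases h1 : ∃ x ∈ M ∩ Y, x ∈ Z
    · by_cases h2 : ∃ x, x ∉ M ∧ x ∉ Y ∧ x ∉ Z
      · obtain ⟨⟨p, hp, hpZ⟩, ⟨q, hq, hqZ⟩, -⟩ := hNZ
        exact key Z hZ ⟨p, hp, hpZ⟩ ⟨q, hq, hqZ⟩ h1 h2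
      · push Not at h2
        by_cases h3 : ∃ x ∈ M ∩ Y, x ∉ Z
        · obtain ⟨⟨p, hp, hpZ⟩, ⟨q, hq, hqZ⟩, -⟩ := hNZ'
          exact key Zᶜ hZ.compl ⟨p, hp, hpZ⟩ ⟨q, hq, hqZ⟩ h3
            ⟨d, hd.1, hd.2, fun h => h (h2 d hd.1 hd.2)⟩
        · push Not at h3
          exact key2 Zᶜ hZ.compl hNZ' (fun x hx h => h (h3 x hx))
            (fun x hx hx' h => h (h2 x hx hx'))
    · push Not at h1
      by_cases h2 : ∃ x, x ∉ M ∧ x ∉ Y ∧ x ∈ Z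
      · obtain ⟨⟨p, hp, hpZ⟩, ⟨q, hq, hqZ⟩, -⟩ := hNZ'
        obtain ⟨s, hs1, hs2, hs3⟩ := h2
        exact key Zᶜ hZ.compl ⟨p, hp, hpZ⟩ ⟨q, hq, hqZ⟩ ⟨a, ⟨haM, haY⟩, h1 a ⟨haM, haY⟩⟩
          ⟨s, hs1, hs2, fun h => h hs3⟩
      · push Not at h2
        exact key2 Z hZ hNZ h1 h2
  · -- `M` can be enlarged by `c`
    rw [Set.not_nontrivial_iff] at hN
    have hins : ∀ W ⊆ M, G.ThinCut (insert c W) := by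
      intro W hW
      by_cases hWY : ∃ x ∈ W, x ∈ Y
      · obtain ⟨x, hxW, hxY⟩ := hWY
        -- remove `Y ∩ M \ W`, then add `W`
        have h1 : G.ThinCut (Y \ (M \ (Y ∩ W))) :=
          hY.sdiff hG (hM _ Set.sdiff_subset) hbY ⟨hbM, fun h => hbY h.1⟩
        have h2 := h1.union hG (hM W hW) (r := x) ⟨hxY, fun h => h.2 ⟨hxY, hxW⟩⟩ hxW
        convert h2 using 1
        ext y
        simp only [Set.mem_insert_iff, Set.mem_union, Set.mem_sdiff, Set.mem_inter_iff]
        constructor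
        · rintro (rfl | hy)
          · exact Or.inl ⟨hcY, fun h => hcM h.1⟩
          · exact Or.inr hy
        · rintro (⟨hy, hy'⟩ | hy)
          · by_cases hyM : y ∈ M
            · refine Or.inr ?_
              by_contra hyW
              exact hy' ⟨hyM, fun h => hyW h.2⟩
            · exact Or.inl (hN ⟨hy, hyM⟩ ⟨hcY, hcM⟩)
          · exact Or.inr hy
      · push Not at hWY
        rcases W.eq_empty_or_nonempty with rfl | ⟨x, hx⟩
        · refine thinCut_of_subsingleton ?_
          simp
        -- Since `Y \ M = {c}` and `W` avoids `Y`, the set `insert c W` is the symmetric difference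
        -- of `Y` and the subset `Y ∩ M ∪ W` of `M`.
        have hcr : Crosses Y (Y ∩ M ∪ W) := ⟨⟨a, haY, Or.inl ⟨haY, haM⟩⟩,
          ⟨c, hcY, fun h => h.elim (fun h => hcM h.2) fun h => hcM (hW h)⟩,
          ⟨x, Or.inr hx, hWY x hx⟩, ⟨d, fun h => ?_⟩⟩
        · convert hY.symmDiff hG (hM (Y ∩ M ∪ W) (Set.union_subset Set.inter_subset_right hW)) hcr
            using 1
          ext y
          simp only [Set.mem_insert_iff, Set.mem_union, Set.mem_inter_iff, Set.mem_ofPred_eq]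
          have hyc : y ∈ Y → y ∉ M → y = c := fun h1 h2 => hN ⟨h1, h2⟩ ⟨hcY, hcM⟩
          have hyW := hWY y
          have hyM := @hW y
          have hcW : c ∉ W := fun h => hcM (hW h)
          constructor
          · rintro (rfl | hy)
            · tauto
            · tauto
          · tauto
        · rcases h with h | h | h
          · exact hd.2 h
          · exact hd.2 h.1
          · exact hd.1 (hW h)
    have := hmax (insert c M) ⟨fun W hW => ?_, hM1.mono (Set.subset_insert _ _),
      ⟨d, fun h => h.elim (fun e => hd.2 (e ▸ hcY)) hd.1⟩⟩
    · rw [Set.ncard_insert_of_notMem hcM] at this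
      omega
    · by_cases hcW : c ∈ W
      · convert hins (W \ {c}) (fun x hx => (hW hx.1).resolve_left hx.2) using 1
        simp [Set.insert_eq_of_mem hcW]
      · exact hM W fun x hx => (hW hx).resolve_left fun e => hcW (e ▸ hx)

end SimpleGraph

/-! ### Strong splits and existence of canonical decompositions. -/

namespace SimpleGraph

section Strong

variable {V : Type u} {W : Type v} {G : SimpleGraph V}

/-- No thin cut crosses `X`. -/
def IsStrong (G : SimpleGraph V) (X : Set V) : Prop := ∀ Y, G.ThinCut Y → ¬ Crosses X Y

theorem IsStrong.compl {X : Set V} (h : G.IsStrong X) : G.IsStrong Xᶜ := by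
  intro Y hY hc
  have := hc.compl_left
  rw [compl_compl] at this
  exact h Y hY this

/-- Strong cuts of a part of a strong split lift to `G`. -/
theorem IsStrong.of_splitPart {X : Set V} (h : G.IsStrong X)
    {S : Set (Option ↥X)} (hS : (G.splitPart X).IsStrong S) : G.IsStrong (sideMap X ⁻¹' S) := by
  intro Y hY hc
  have hconst : ∀ x y, x ∉ X → y ∉ X → (sideMap X x ∈ S ↔ sideMap X y ∈ S) := by
    intro x y hx hy
    rw [sideMap_of_notMem hx, sideMap_of_notMem hy]
  obtain ⟨⟨a, haS, haY⟩, ⟨b, hbS, hbY⟩, ⟨c, hcY, hcS⟩, ⟨d, hd⟩⟩ := hc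
  simp only [Set.mem_compl_iff, Set.mem_union, not_or] at hd
  -- If `Y` does not separate `Xᶜ`, it descends to the part and crosses `S` there.
  by_cases hsat : ∀ x y, x ∉ X → y ∉ X → (x ∈ Y ↔ y ∈ Y)
  · have hpre : Y = sideMap X ⁻¹' (sideMap X '' Y) := by
      refine (Set.subset_preimage_image _ _).antisymm ?_
      rintro x ⟨y, hy, hyx⟩
      by_cases hx : x ∈ X
      · rw [sideMap_of_mem hx, sideMap_eq_some] at hyx
        have hyx : y = x := hyx
        exact hyx ▸ hy
      · rw [sideMap_of_notMem hx, sideMap_eq_none] at hyx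
        exact (hsat x y hx hyx).2 hy
    have hmem : ∀ x, sideMap X x ∈ sideMap X '' Y ↔ x ∈ Y := fun x =>
      (Set.ext_iff.1 hpre x).symm
    refine hS (sideMap X '' Y) ?_ ⟨⟨_, haS, (hmem a).2 haY⟩, ⟨_, hbS, mt (hmem b).1 hbY⟩,
      ⟨_, (hmem c).2 hcY, hcS⟩, ⟨sideMap X d, ?_⟩⟩
    · rw [splitPart_eq_quot]
      refine ThinCut.of_preimage_quot ?_
      rwa [← hpre]
    · rintro (h | h)
      · exact hd.1 h
      · exact hd.2 ((hmem d).1 h)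
  · push Not at hsat
    obtain ⟨p, q, hp, hq, hpY, hqY⟩ : ∃ p q, p ∉ X ∧ q ∉ X ∧ p ∈ Y ∧ q ∉ Y := by
      obtain ⟨x, y, hx, hy, h | h⟩ := hsat
      · exact ⟨x, y, hx, hy, h⟩
      · exact ⟨y, x, hy, hx, h.2, h.1⟩
    -- Now `Y` separates `Xᶜ`. As `X` is strong, `Y` contains `X` or misses it, so two quadrants of
    -- opposite type with respect to `S` lie in `Xᶜ`, where membership in the preimage of `S` is
    -- constant.
    by_cases h1 : ∃ x ∈ X, x ∈ Y
    · obtain ⟨x, hx, hxY⟩ := h1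
      by_cases h2 : ∃ x ∈ X, x ∉ Y
      · obtain ⟨y, hy, hyY⟩ := h2
        exact h Y hY ⟨⟨x, hx, hxY⟩, ⟨y, hy, hyY⟩, ⟨p, hpY, hp⟩, ⟨q, fun h => h.elim hq hqY⟩⟩
      · push Not at h2
        have hb : b ∉ X := fun h => hbY (h2 b h)
        have hd' : d ∉ X := fun h => hd.2 (h2 d h)
        exact hd.1 ((hconst b d hb hd').1 hbS)
    · push Not at h1
      have ha : a ∉ X := fun h => h1 a h haY
      have hc : c ∉ X := fun h => h1 c h hcY
      exact hcS ((hconst a c ha hc).1 haS)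

theorem IsPrime.of_iso [Finite V] {H : SimpleGraph W} (h : G.IsPrime) (hG : G.Connected)
    (φ : G ≃g H) : H.IsPrime := by
  have : Finite W := Finite.of_equiv V φ.toEquiv
  have hH : H.Connected := φ.connected_iff.1 hG
  intro X hX
  obtain ⟨h1, h2, h3⟩ := hH.isSplit_iff.1 hX
  refine h (φ ⁻¹' X) (hG.isSplit_iff.2 ⟨h1.preimage φ.surjective,
    h2.preimage φ.surjective, h3.preimage φ.toEmbedding⟩)

theorem isPrime_of_card_lt_four [Finite V] (h : Nat.card V < 4) : G.IsPrime := by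
  intro X hX
  have h1 := hX.1
  have h2 := hX.2.1
  have h3 := Set.ncard_add_ncard_compl X
  omega

end Strong

namespace SplitDecomposition

variable {V : Type u} {G : SimpleGraph V}

/-- Split along strong splits for as long as possible; strong cuts of the parts lift, so all markers
stay strong in `G`. A part without strong split is prime, or each of its splits is crossed and it is
brittle. -/
theorem exists_strong_decomposition [Finite V] (hG : G.Connected) :
    ∃ D : SplitDecomposition G,
      (∀ z z', D.marked.Adj z z' → G.IsStrong {x | D.toward (D.blockOf z) x = z}) ∧
      ∀ b, (D.blockGraph b).IsPrime ∨ (D.blockGraph b).IsBrittle := by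
  obtain ⟨n, hn⟩ : ∃ n, Nat.card V = n := ⟨_, rfl⟩
  induction n using Nat.strong_induction_on generalizing V with
  | _ n ih =>
  by_cases hs : ∃ X, G.IsSplit X ∧ G.IsStrong X
  · obtain ⟨X, hX, hXs⟩ := hs
    have hlt := card_option_lt_of_isSplit hX
    have hX' : Xᶜᶜ.Nonempty := by simpa using hX.nonempty
    obtain ⟨D₁, hm₁, hb₁⟩ := ih _ (hn ▸ hlt.1) (hG.splitPart hX.nonempty_compl) rfl
    obtain ⟨D₂, hm₂, hb₂⟩ := ih _ (hn ▸ hlt.2) (hG.splitPart hX') rfl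
    refine ⟨split G X hX D₁ D₂, ?_, ?_⟩
    · have h1 : {x | (split G X hX D₁ D₂).toward ((split G X hX D₁ D₂).blockOf
          (Sum.inl (D₁.emb none))) x = Sum.inl (D₁.emb none)} = Xᶜ := by
        ext x
        refine (Sum.inl_injective.eq_iff.trans D₁.toward_blockOf_emb_eq).trans ?_
        exact sideMap_eq_none
      have h2 : {x | (split G X hX D₁ D₂).toward ((split G X hX D₁ D₂).blockOf
          (Sum.inr (D₂.emb none))) x = Sum.inr (D₂.emb none)} = Xᶜᶜ := by
        ext x
        refine (Sum.inr_injective.eq_iff.trans D₂.toward_blockOf_emb_eq).trans ?_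
        exact sideMap_eq_none
      rintro (z | z) (z' | z') h
      · convert hXs.of_splitPart (hm₁ z z' (marked_split_inl.1 h)) using 1
        ext x
        exact Sum.inl_injective.eq_iff
      · obtain ⟨rfl, rfl⟩ := marked_split_inl_inr.1 h
        rw [h1]
        exact hXs.compl
      · obtain ⟨rfl, rfl⟩ := marked_split_inl_inr.1 h.symm
        rw [h2]
        exact hXs.compl.compl
      · convert hXs.compl.of_splitPart (hm₂ z z' (marked_split_inr.1 h)) using 1
        ext x
        exact Sum.inr_injective.eq_iff
    · rintro (b | b)
      · exact (hb₁ b).imp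
          (fun h => h.of_iso (D₁.connected_blockGraph (hG.splitPart hX.nonempty_compl) b)
            (blockGraphIsoInl D₁ D₂ b))
          (fun h => h.of_embedding (blockGraphIsoInl D₁ D₂ b).symm.toEmbedding)
      · exact (hb₂ b).imp
          (fun h => h.of_iso (D₂.connected_blockGraph (hG.splitPart hX') b)
            (blockGraphIsoInr D₁ D₂ b))
          (fun h => h.of_embedding (blockGraphIsoInr D₁ D₂ b).symm.toEmbedding)
  · refine ⟨single G, fun z z' h => absurd h (fun h => h), fun b => ?_⟩
    by_cases hp : G.IsPrime
    · exact Or.inl (hp.of_iso hG (blockGraphIsoSingle G b))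
    · refine Or.inr (IsBrittle.of_embedding ?_ (blockGraphIsoSingle G b).symm.toEmbedding)
      unfold IsPrime at hp
      push Not at hp hs
      obtain ⟨X, hX⟩ := hp
      refine hG.isBrittle_of_forall_crosses ⟨X, hG.isSplit_iff.1 hX⟩ fun X h1 h2 h3 => ?_
      have := hs X (hG.isSplit_iff.2 ⟨h1, h2, h3⟩)
      unfold IsStrong at this
      push Not at this
      exact this

open Classical in
/-- The vertex that represents `x` after the blocks of the neighbour markers `z` and `z'` have been
merged into one. -/
noncomputable def towardMerged (D : SplitDecomposition G) (z z' : D.Vert) (x : V) :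
    D.Vert ⊕ D.Vert :=
  if D.toward (D.blockOf z) x = z then Sum.inr (D.toward (D.blockOf z') x)
  else Sum.inl (D.toward (D.blockOf z) x)

theorem towardMerged_eq_inl {D : SplitDecomposition G} {z z' : D.Vert} {x : V} {a : D.Vert} :
    D.towardMerged z z' x = Sum.inl a ↔ D.toward (D.blockOf z) x = a ∧ a ≠ z := by
  unfold towardMerged
  split_ifs with h
  · simp only [false_iff]
    rintro ⟨rfl, h'⟩
    exact h' h
  · rw [Sum.inl_injective.eq_iff]
    constructor
    · rintro rfl
      exact ⟨rfl, h⟩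
    · exact fun h => h.1

theorem towardMerged_eq_inr {D : SplitDecomposition G} {z z' : D.Vert} (hz : D.marked.Adj z z')
    {x : V} {c : D.Vert} :
    D.towardMerged z z' x = Sum.inr c ↔ D.toward (D.blockOf z') x = c ∧ c ≠ z' := by
  have := D.toward_eq_iff_of_marked hz x
  unfold towardMerged
  split_ifs with h
  · rw [Sum.inr_injective.eq_iff]
    constructor
    · rintro rfl
      exact ⟨rfl, this.1 h⟩
    · exact fun h => h.1
  · simp only [false_iff]
    rintro ⟨rfl, h'⟩
    exact h (this.2 h')

theorem thinCut_towardMerged [Finite V] {D : SplitDecomposition G} {z z' : D.Vert}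
    (hz : D.marked.Adj z z') (k : D.Vert ⊕ D.Vert) :
    G.ThinCut (D.towardMerged z z' ⁻¹' {k}) := by
  rcases k with a | c
  · by_cases ha : a = z
    · intro x _ _ _ hx
      exact absurd ha (towardMerged_eq_inl.1 hx).2
    · convert D.thinCut_toward (D.blockOf z) a using 1
      ext x
      exact towardMerged_eq_inl.trans (and_iff_left ha)
  · by_cases hc : c = z'
    · intro x _ _ _ hx
      exact absurd hc ((towardMerged_eq_inr hz).1 hx).2
    · convert D.thinCut_toward (D.blockOf z') c using 1
      ext x
      exact (towardMerged_eq_inr hz).trans (and_iff_left hc)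

theorem quot_towardMerged_inl {D : SplitDecomposition G} {z z' a a' : D.Vert} :
    (G.quot (D.towardMerged z z')).Adj (Sum.inl a) (Sum.inl a') ↔
      a ≠ z ∧ a' ≠ z ∧ D.blockOf a = D.blockOf z ∧ D.solid.Adj a a' := by
  rw [solid_adj_iff]
  constructor
  · rintro ⟨h0, x, y, hx, hy, hxy⟩
    obtain ⟨rfl, hx⟩ := towardMerged_eq_inl.1 hx
    obtain ⟨rfl, hy⟩ := towardMerged_eq_inl.1 hy
    refine ⟨hx, hy, D.blockOf_toward _ _, ?_, fun e => h0 (congrArg Sum.inl e), x, y, ?_, ?_, hxy⟩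
    all_goals simp only [blockOf_toward]
  · rintro ⟨ha, ha', hb, -, hne, x, y, hx, hy, hxy⟩
    rw [hb] at hx hy
    exact ⟨Sum.inl_injective.ne hne, x, y, towardMerged_eq_inl.2 ⟨hx, ha⟩,
      towardMerged_eq_inl.2 ⟨hy, ha'⟩, hxy⟩

theorem quot_towardMerged_inr {D : SplitDecomposition G} {z z' c c' : D.Vert}
    (hz : D.marked.Adj z z') :
    (G.quot (D.towardMerged z z')).Adj (Sum.inr c) (Sum.inr c') ↔
      c ≠ z' ∧ c' ≠ z' ∧ D.blockOf c = D.blockOf z' ∧ D.solid.Adj c c' := by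
  rw [solid_adj_iff]
  constructor
  · rintro ⟨h0, x, y, hx, hy, hxy⟩
    obtain ⟨rfl, hx⟩ := (towardMerged_eq_inr hz).1 hx
    obtain ⟨rfl, hy⟩ := (towardMerged_eq_inr hz).1 hy
    refine ⟨hx, hy, D.blockOf_toward _ _, ?_, fun e => h0 (congrArg Sum.inr e), x, y, ?_, ?_, hxy⟩
    all_goals simp only [blockOf_toward]
  · rintro ⟨ha, ha', hb, -, hne, x, y, hx, hy, hxy⟩
    rw [hb] at hx hy
    exact ⟨Sum.inr_injective.ne hne, x, y, (towardMerged_eq_inr hz).2 ⟨hx, ha⟩,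
      (towardMerged_eq_inr hz).2 ⟨hy, ha'⟩, hxy⟩

/-- Merging undoes the split: the neighbours of one marker are joined completely to those of the
other. -/
theorem quot_towardMerged_inl_inr [Finite V] {D : SplitDecomposition G} {z z' a c : D.Vert}
    (hz : D.marked.Adj z z') :
    (G.quot (D.towardMerged z z')).Adj (Sum.inl a) (Sum.inr c) ↔
      D.solid.Adj z a ∧ D.solid.Adj z' c := by
  rw [solid_adj_iff, solid_adj_iff]
  have hm := D.toward_eq_iff_of_marked hz
  constructor
  · rintro ⟨-, x, y, hx, hy, hxy⟩
    obtain ⟨rfl, hx⟩ := towardMerged_eq_inl.1 hx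
    obtain ⟨rfl, hy⟩ := (towardMerged_eq_inr hz).1 hy
    have hy' := (hm y).2 hy
    have hx' := not_not.1 (mt (hm x).2 hx)
    exact ⟨⟨(D.blockOf_toward _ _).symm, hx.symm, y, x, hy', rfl, hxy.symm⟩,
      ⟨(D.blockOf_toward _ _).symm, hy.symm, x, y, hx', rfl, hxy⟩⟩
  · rintro ⟨⟨-, hza, y, x, hy, hx, hxy⟩, ⟨-, hzc, x', y', hx', hy', hxy'⟩⟩
    have h1 : D.toward (D.blockOf z) x ≠ z := by
      rw [hx]
      exact hza.symm
    have h2 : D.toward (D.blockOf z') y' ≠ z' := by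
      rw [hy']
      exact hzc.symm
    have h3 : ¬ D.toward (D.blockOf z) x' = z := fun h => (hm x').1 h hx'
    refine ⟨Sum.inl_ne_inr, x, y', towardMerged_eq_inl.2 ⟨hx, hza.symm⟩,
      (towardMerged_eq_inr hz).2 ⟨hy', hzc.symm⟩, ?_⟩
    have hthin := D.thinCut_toward (D.blockOf z) z
    exact (hthin (a := y') (a' := y) (b := x') (b' := x) ((hm y').2 h2) hy h3 h1
      hxy'.symm hxy).symm

/-- Two blocks joined by strong markers cannot be merged into a brittle graph. -/
theorem not_isBrittle_quot_towardMerged [Finite V] {D : SplitDecomposition G} {z z' : D.Vert}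
    (hz : D.marked.Adj z z') (hs : G.IsStrong {x | D.toward (D.blockOf z) x = z}) :
    ¬ (G.quot (D.towardMerged z z')).IsBrittle := by
  intro hQ
  have htwo : ∀ z : D.Vert, ∃ a b : D.Vert, a ≠ z ∧ b ≠ z ∧ a ≠ b ∧ D.blockOf a = D.blockOf z ∧
      D.blockOf b = D.blockOf z := by
    intro z
    have := D.three_le_card_block (D.three_le_card_of_marked hz) (D.blockOf z)
    rw [Nat.card_coe_set_eq] at this
    obtain ⟨a, b, c, ha, hb, hc, hab, hac, hbc⟩ := (Set.two_lt_ncard_iff).1 this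
    by_cases haz : a = z
    · exact ⟨b, c, haz ▸ hab.symm, haz ▸ hac.symm, hbc, hb, hc⟩
    by_cases hbz : b = z
    · exact ⟨a, c, haz, hbz ▸ hbc.symm, hac, ha, hc⟩
    · exact ⟨a, b, haz, hbz, hab, ha, hb⟩
  have hrep : ∀ a z : D.Vert, D.blockOf a = D.blockOf z → ∃ x, D.toward (D.blockOf z) x = a := by
    intro a z e
    rw [← e]
    exact D.exists_toward_eq a
  have hin : ∀ {x}, D.toward (D.blockOf z') x ≠ z' → D.toward (D.blockOf z) x = z :=
    fun {x} h => (D.toward_eq_iff_of_marked hz x).2 h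
  obtain ⟨a₁, a₂, ha₁, ha₂, ha, hab₁, hab₂⟩ := htwo z
  obtain ⟨c₁, c₂, hc₁, hc₂, hc, hcb₁, hcb₂⟩ := htwo z'
  obtain ⟨x₁, hx₁⟩ := hrep a₁ z hab₁
  obtain ⟨x₂, hx₂⟩ := hrep a₂ z hab₂
  obtain ⟨y₁, hy₁⟩ := hrep c₁ z' hcb₁
  obtain ⟨y₂, hy₂⟩ := hrep c₂ z' hcb₂
  have kx₁ : D.towardMerged z z' x₁ = Sum.inl a₁ := towardMerged_eq_inl.2 ⟨hx₁, ha₁⟩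
  have kx₂ : D.towardMerged z z' x₂ = Sum.inl a₂ := towardMerged_eq_inl.2 ⟨hx₂, ha₂⟩
  have ky₁ : D.towardMerged z z' y₁ = Sum.inr c₁ := (towardMerged_eq_inr hz).2 ⟨hy₁, hc₁⟩
  have ky₂ : D.towardMerged z z' y₂ = Sum.inr c₂ := (towardMerged_eq_inr hz).2 ⟨hy₂, hc₂⟩
  -- Each block has two vertices besides the marker. A cut of the merged graph with one of the two
  -- from each block on one side crosses the marked cut, and in a brittle graph it is thin.
  refine hs _ (ThinCut.preimage_quot (thinCut_towardMerged hz)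
    (hQ.thinCut {Sum.inl a₁, Sum.inr c₁})) ⟨⟨y₁, ?_, ?_⟩, ⟨y₂, ?_, ?_⟩, ⟨x₁, ?_, ?_⟩, ⟨x₂, ?_⟩⟩
  · exact hin (hy₁ ▸ hc₁)
  · exact Or.inr ky₁
  · exact hin (hy₂ ▸ hc₂)
  · rw [Set.mem_preimage, ky₂]
    simp [hc.symm]
  · exact Or.inl kx₁
  · exact fun h => ha₁ (hx₁.symm.trans h)
  · rintro (h | h)
    · exact ha₂ (hx₂.symm.trans h)
    · rw [Set.mem_preimage, kx₂] at h
      simp [ha.symm] at h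

theorem isBrittle_quot_towardMerged_of_clique [Finite V] {D : SplitDecomposition G}
    {z z' : D.Vert} (hz : D.marked.Adj z z') (h : D.blockGraph (D.blockOf z) = ⊤)
    (h' : D.blockGraph (D.blockOf z') = ⊤) : (G.quot (D.towardMerged z z')).IsBrittle := by
  have hadj : ∀ {b} {a a' : D.Vert}, D.blockGraph b = ⊤ → D.blockOf a = b → D.blockOf a' = b →
      a ≠ a' → D.solid.Adj a a' := by
    intro b a a' h ha ha' hne
    have : (D.blockGraph b).Adj ⟨a, ha⟩ ⟨a', ha'⟩ := by
      rw [h]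
      exact fun e => hne (congrArg Subtype.val e)
    exact this
  -- The quotient lives on a type with irrelevant vertices, which are isolated. On the valid ones
  -- the merged graph is complete.
  let valid : D.Vert ⊕ D.Vert → Prop := Sum.elim (fun a => D.blockOf a = D.blockOf z ∧ a ≠ z)
    (fun c => D.blockOf c = D.blockOf z' ∧ c ≠ z')
  have h1 : ∀ p q, (G.quot (D.towardMerged z z')).Adj p q → valid p := by
    rintro _ _ ⟨-, x, y, rfl, rfl, -⟩
    rcases e : D.towardMerged z z' x with a | c
    · obtain ⟨rfl, h⟩ := towardMerged_eq_inl.1 e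
      exact ⟨D.blockOf_toward _ _, h⟩
    · obtain ⟨rfl, h⟩ := (towardMerged_eq_inr hz).1 e
      exact ⟨D.blockOf_toward _ _, h⟩
  have h3 : ∀ a c, valid (Sum.inl a) → valid (Sum.inr c) →
      (G.quot (D.towardMerged z z')).Adj (Sum.inl a) (Sum.inr c) := fun a c ha hc =>
    (quot_towardMerged_inl_inr hz).2 ⟨hadj h rfl ha.1 ha.2.symm, hadj h' rfl hc.1 hc.2.symm⟩
  have h2 : ∀ p q, valid p → valid q → p ≠ q → (G.quot (D.towardMerged z z')).Adj p q := by
    rintro (a | c) (a' | c') hp hq hne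
    · exact quot_towardMerged_inl.2 ⟨hp.2, hq.2, hp.1,
        hadj h hp.1 hq.1 fun e => hne (congrArg Sum.inl e)⟩
    · exact h3 a c' hp hq
    · exact (h3 a' c hq hp).symm
    · exact (quot_towardMerged_inr hz).2 ⟨hp.2, hq.2, hp.1,
        hadj h' hp.1 hq.1 fun e => hne (congrArg Sum.inr e)⟩
  intro p q p' q' hpq hpq' hne _
  exact h2 p q' (h1 p q hpq) (h1 q' p' hpq'.symm) hne

theorem isBrittle_of_forall_mem_edge {W : Type v} {H : SimpleGraph W} (c : W)
    (h : ∀ p q, H.Adj p q → p = c ∨ q = c) : H.IsBrittle := by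
  intro a b a' b' hab hab' h1 h2
  rcases h a b hab with rfl | rfl
  · obtain rfl := (h a' b' hab').resolve_right (fun e => h1 e.symm)
    exact hab'
  · obtain rfl := (h a' b' hab').resolve_left h2
    exact hab

/-- Merging a star at its centre `z` with a star at its leaf `z'` gives a star centred at `c`. -/
theorem isBrittle_quot_towardMerged_of_star [Finite V] {D : SplitDecomposition G}
    {z z' : D.Vert} (hz : D.marked.Adj z z')
    (h : D.blockGraph (D.blockOf z) = starGraph ⟨z, rfl⟩)
    {c : ↥{x : D.Vert | D.blockOf x = D.blockOf z'}} (hc : c.1 ≠ z')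
    (h' : D.blockGraph (D.blockOf z') = starGraph c) :
    (G.quot (D.towardMerged z z')).IsBrittle := by
  have hstar : ∀ {b} {c : ↥{x : D.Vert | D.blockOf x = b}}, D.blockGraph b = starGraph c →
      ∀ {a a'}, D.solid.Adj a a' → D.blockOf a = b → a = c.1 ∨ a' = c.1 := by
    intro b c h a a' haa' ha
    have ha' : D.blockOf a' = b := (D.solid_adj_iff.1 haa').1.symm.trans ha
    have : (D.blockGraph b).Adj ⟨a, ha⟩ ⟨a', ha'⟩ := haa'
    rw [h, starGraph_adj] at this
    exact this.2.imp (congrArg Subtype.val) (congrArg Subtype.val)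
  have key : ∀ a d, (G.quot (D.towardMerged z z')).Adj (Sum.inl a) (Sum.inr d) → d = c.1 := by
    intro a d hadj
    exact (hstar h' ((quot_towardMerged_inl_inr hz).1 hadj).2 rfl).resolve_left hc.symm
  refine isBrittle_of_forall_mem_edge (Sum.inr c.1) ?_
  rintro (a | d) (a' | d') hadj
  · obtain ⟨h1, h2, h3, h4⟩ := quot_towardMerged_inl.1 hadj
    exact ((hstar h h4 h3).elim h1 h2).elim
  · exact Or.inr (congrArg Sum.inr (key a d' hadj))
  · exact Or.inl (congrArg Sum.inr (key a' d hadj.symm))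
  · obtain ⟨h1, h2, h3, h4⟩ := (quot_towardMerged_inr hz).1 hadj
    exact (hstar h' h4 h3).imp (congrArg Sum.inr) (congrArg Sum.inr)

/-- Every connected graph has a canonical decomposition. -/
theorem exists_isCanonical [Finite V] (hG : G.Connected) :
    ∃ D : SplitDecomposition G, D.IsCanonical := by
  obtain ⟨D, hs, hb⟩ := exists_strong_decomposition hG
  have hstar : ∀ x y, D.marked.Adj x y → (D.blockGraph (D.blockOf y)).IsBigStar →
      (D.blockGraph (D.blockOf x)).IsBigStarAt ⟨x, rfl⟩ →
      (D.blockGraph (D.blockOf y)).IsBigStarAt ⟨y, rfl⟩ := by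
    rintro x y hxy ⟨c, hc⟩ hx
    by_cases hcy : c.1 = y
    · obtain rfl : c = ⟨y, rfl⟩ := Subtype.ext hcy
      exact hc
    · exact absurd (isBrittle_quot_towardMerged_of_star hxy hx.2 hcy hc.2)
        (not_isBrittle_quot_towardMerged hxy (hs x y hxy))
  refine ⟨D, fun b => ?_, fun x y hxy h => ?_, fun x y hxy hx hy =>
    ⟨hstar x y hxy hy, hstar y x hxy.symm hx⟩⟩
  · by_cases hcard : 3 ≤ Nat.card V
    · have h3 := D.three_le_card_block hcard b
      refine (hb b).imp_right fun h => ?_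
      rcases h.eq_top_or_eq_starGraph (D.connected_blockGraph hG b) with h | ⟨c, h⟩
      · exact Or.inl ⟨h3, h⟩
      · exact Or.inr ⟨c, h3, h⟩
    -- A graph with fewer than three vertices cannot have big blocks; its blocks are prime for lack
    -- of vertices.
    · refine Or.inl (isPrime_of_card_lt_four ?_)
      obtain ⟨φ⟩ := D.exists_blockGraph_embedding hG b
      have := Nat.card_le_card_of_injective φ φ.injective
      omega
  · exact not_isBrittle_quot_towardMerged hxy (hs x y hxy)
      (isBrittle_quot_towardMerged_of_clique hxy h.1.2 h.2.2)

end SplitDecomposition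

end SimpleGraph

/-! ### Three legs yield the net or co-(3K₂). -/

namespace SimpleGraph

section Matrix

variable {V : Type u} {α : Type v} {β : Type w} {G : SimpleGraph V}

/-- `A` is the adjacency matrix of the subgraph of `G` induced on the vertices `φ a`. -/
def Represents (G : SimpleGraph V) (φ : α → V) (A : α → α → Bool) : Prop :=
  ∀ a b, G.Adj (φ a) (φ b) ↔ A a b = true

/-- Local complementation of adjacency matrices. -/
def lcMatrix [DecidableEq α] (A : α → α → Bool) (x a b : α) : Bool :=
  decide (a ≠ b) && (A a b ^^ (A x a && A x b))

theorem Represents.localComplement [DecidableEq α] {φ : α → V} {A : α → α → Bool}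
    (hφ : Function.Injective φ) (h : G.Represents φ A) (x : α) :
    (G.localComplement (φ x)).Represents φ (lcMatrix A x) := by
  intro a b
  rw [localComplement_adj, h a b, h x a, h x b, hφ.ne_iff, lcMatrix]
  by_cases hab : a = b <;> cases A a b <;> cases A x a <;> cases A x b <;> simp [hab, Xor]

theorem Represents.isVertexMinor {φ : α → V} {A : α → α → Bool} (hφ : Function.Injective φ)
    (h : G.Represents φ A) {H : SimpleGraph β} {e : β → α} (he : Function.Injective e)
    (hH : ∀ a b, H.Adj a b ↔ A (e a) (e b) = true) : H.IsVertexMinor G :=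
  .of_embedding ⟨⟨φ ∘ e, hφ.comp he⟩, fun {a b} => (h (e a) (e b)).trans (hH a b).symm⟩

/-- The adjacency matrix of three pairs of vertices, the legs. The first vertex of a leg is active,
the second one is active if `q i`, the two are adjacent if `p i`, and the active vertices of
different legs are adjacent if `A i j`. -/
def legMatrix (A : Fin 3 → Fin 3 → Bool) (p q : Fin 3 → Bool) (a b : Fin 3 × Bool) : Bool :=
  if a.1 = b.1 then decide (a.2 ≠ b.2) && p a.1
  else A a.1 b.1 && (!a.2 || q a.1) && (!b.2 || q b.1)

/-- The matrix of three legs whose active vertices are all adjacent. The vertices of the leg `i` are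
twins if `r i` is false, otherwise the second one is pendant on the first one. -/
def cliqueLegMatrix (r : Fin 3 → Bool) : Fin 3 × Bool → Fin 3 × Bool → Bool :=
  legMatrix (fun _ _ => true) r (fun i => !r i)

/-- Complementing at an active vertex of the central leg makes the active vertices of the other legs
adjacent to each other. Adjacent twins in those legs become non-adjacent, and an adjacent second
vertex of the central leg becomes pendant. -/
theorem lcMatrix_starLegs : ∀ (r : Fin 3 → Bool) (i : Fin 3) (a b : Fin 3 × Bool),
    lcMatrix (legMatrix (fun j k => decide (j = i ∨ k = i)) (fun j => decide (j ≠ i) || r j)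
      (fun j => decide (j = i) || !r j)) (i, false) a b = cliqueLegMatrix r a b := by
  decide +kernel

/-- Three pendant legs form the net and three twin legs co-(3K₂). For the mixed patterns one
sequence of four complementations at first vertices works: here a single pendant leg leads to the
net; in the next lemma a single twin leg leads to co-(3K₂). -/
theorem lcMatrix_cliqueLegs_of_eq : ∀ (i : Fin 3) (a b : Fin 3 × Bool),
    lcMatrix (lcMatrix (lcMatrix (lcMatrix (cliqueLegMatrix fun j => decide (j = i))
      (i, false)) (i + 1, false)) (i + 2, false)) (i, false) a b =
      cliqueLegMatrix (fun _ => true) a b := by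
  decide +kernel

theorem lcMatrix_cliqueLegs_of_ne : ∀ (i : Fin 3) (a b : Fin 3 × Bool),
    lcMatrix (lcMatrix (lcMatrix (lcMatrix (cliqueLegMatrix fun j => decide (j ≠ i))
      (i, false)) (i + 1, false)) (i + 2, false)) (i, false) a b =
      cliqueLegMatrix (fun _ => false) a b := by
  decide +kernel

theorem Represents.isVertexMinor_of_cliqueLegs {φ : Fin 3 × Bool → V} (hφ : Function.Injective φ)
    {r : Fin 3 → Bool} (h : G.Represents φ (cliqueLegMatrix r)) :
    co3K2.IsVertexMinor G ∨ netGraph.IsVertexMinor G := by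
  have hco : ∀ {G : SimpleGraph V}, G.Represents φ (cliqueLegMatrix fun _ => false) →
      co3K2.IsVertexMinor G := fun h =>
    h.isVertexMinor hφ (e := ![(0, false), (0, true), (1, false), (1, true), (2, false), (2, true)])
      (by decide) (by decide +kernel)
  have hnet : ∀ {G : SimpleGraph V}, G.Represents φ (cliqueLegMatrix fun _ => true) →
      netGraph.IsVertexMinor G := fun h =>
    h.isVertexMinor hφ (e := ![(0, false), (1, false), (2, false), (0, true), (1, true), (2, true)])
      (by decide) (by decide +kernel)
  have hcases : ∀ r : Fin 3 → Bool, (r = fun _ => false) ∨ (r = fun _ => true) ∨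
      ∃ i, (r = fun j => decide (j = i)) ∨ r = fun j => decide (j ≠ i) := by
    decide +kernel
  have hle : ∀ x y z w : V, ((((G.localComplement x).localComplement y).localComplement z
      ).localComplement w).LocallyEquivalent G := fun x y z w =>
    LocallyEquivalent.symm (((LocallyEquivalent.localComplement .refl x).localComplement
      y).localComplement z |>.localComplement w)
  have hstep := fun i => (((h.localComplement hφ (i, false)).localComplement hφ
    (i + 1, false)).localComplement hφ (i + 2, false)).localComplement hφ (i, false)
  rcases hcases r with rfl | rfl | ⟨i, rfl | rfl⟩
  · exact Or.inl (hco h)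
  · exact Or.inr (hnet h)
  · refine Or.inr (IsVertexMinor.of_locallyEquivalent (hnet fun a b => ?_) (hle (φ (i, false))
      (φ (i + 1, false)) (φ (i + 2, false)) (φ (i, false))))
    rw [← lcMatrix_cliqueLegs_of_eq i]
    exact hstep i a b
  · refine Or.inl (IsVertexMinor.of_locallyEquivalent (hco fun a b => ?_) (hle (φ (i, false))
      (φ (i + 1, false)) (φ (i + 2, false)) (φ (i, false))))
    rw [← lcMatrix_cliqueLegs_of_ne i]
    exact hstep i a b

theorem Represents.isVertexMinor_of_starLegs {φ : Fin 3 × Bool → V} (hφ : Function.Injective φ)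
    {r : Fin 3 → Bool} {i : Fin 3}
    (h : G.Represents φ (legMatrix (fun j k => decide (j = i ∨ k = i))
      (fun j => decide (j ≠ i) || r j) (fun j => decide (j = i) || !r j))) :
    co3K2.IsVertexMinor G ∨ netGraph.IsVertexMinor G := by
  have hle : (G.localComplement (φ (i, false))).LocallyEquivalent G :=
    (LocallyEquivalent.localComplement .refl _).symm
  refine (Represents.isVertexMinor_of_cliqueLegs (G := G.localComplement (φ (i, false))) hφ
    (r := r) fun a b => ?_).imp
    (fun h => h.of_locallyEquivalent hle) (fun h => h.of_locallyEquivalent hle)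
  rw [← lcMatrix_starLegs r i]
  exact h.localComplement hφ _ a b

/-- Three legs whose active vertices are adjacent to `v` only. -/
theorem Represents.isVertexMinor_of_outerStarLegs {φ : Fin 3 × Bool → V}
    (hφ : Function.Injective φ) {r : Fin 3 → Bool} {v : V}
    (h : G.Represents φ (legMatrix (fun _ _ => false) (fun _ => true) (fun j => !r j)))
    (hv : ∀ a, G.Adj v (φ a) ↔ (!a.2 || !r a.1) = true) :
    co3K2.IsVertexMinor G ∨ netGraph.IsVertexMinor G := by
  have hle : (G.localComplement v).LocallyEquivalent G :=
    (LocallyEquivalent.localComplement .refl _).symm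
  refine (Represents.isVertexMinor_of_cliqueLegs (G := G.localComplement v) hφ
    (r := r) fun a b => ?_).imp
    (fun h => h.of_locallyEquivalent hle) (fun h => h.of_locallyEquivalent hle)
  rw [localComplement_adj, h a b, hv, hv, hφ.ne_iff]
  obtain ⟨i, s⟩ := a
  obtain ⟨j, t⟩ := b
  by_cases hij : i = j
  · subst hij
    cases s <;> cases t <;> cases hr : r i <;> simp [cliqueLegMatrix, legMatrix, Xor, hr]
  · cases s <;> cases t <;> cases hr : r i <;> cases hr' : r j <;>
      simp [cliqueLegMatrix, legMatrix, Xor, hr, hr', hij]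

end Matrix

/-! ### Canonical blocks in the absence of bad paths. -/

section SmallBlocks

variable {V : Type u} {G : SimpleGraph V}

theorem isBrittle_of_card_le_three [Finite V] (h : Nat.card V ≤ 3) : G.IsBrittle := by
  refine isBrittle_of_thinCut fun X => ?_
  by_cases hX : X.Subsingleton
  · exact thinCut_of_subsingleton hX
  · rw [← thinCut_compl]
    refine thinCut_of_subsingleton ?_
    rw [Set.not_subsingleton_iff, ← Set.one_lt_ncard_iff_nontrivial] at hX
    have := Set.ncard_add_ncard_compl X
    rw [← Set.ncard_le_one_iff_subsingleton]
    omega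

theorem isBrittle_top : (⊤ : SimpleGraph V).IsBrittle := fun _ _ _ _ _ _ h _ => h

theorem isBrittle_starGraph (c : V) : (starGraph c).IsBrittle :=
  SplitDecomposition.isBrittle_of_forall_mem_edge c fun _ _ h => (starGraph_adj.1 h).2

theorem IsBigStarAt.unique [Finite V] {c c' : V} (h : G.IsBigStarAt c) (h' : G.IsBigStarAt c') :
    c = c' := by
  by_contra hne
  have h1 : ∀ x, x = c ∨ x = c' := by
    intro x
    by_contra hx
    push Not at hx
    have h2 : G.Adj x c := by
      rw [h.2, starGraph_adj]
      exact ⟨hx.1, Or.inr rfl⟩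
    rw [h'.2, starGraph_adj] at h2
    exact h2.2.elim hx.2 hne
  have h2 : (Set.univ : Set V) ⊆ {c, c'} := fun x _ => h1 x
  have h3 := Set.ncard_le_ncard h2
  rw [Set.ncard_univ, Set.ncard_pair hne] at h3
  have := h.1
  omega

namespace SplitDecomposition

/-- Blocks embed in `G` and inherit the absence of bad paths, so a prime block has at most three
vertices; cliques and stars are brittle anyway. -/
theorem IsCanonical.isBrittle_blockGraph [Finite V] {D : SplitDecomposition G}
    (hD : D.IsCanonical) (hG : G.Connected) (hbad : G.NoBadPath) (b : D.Block) :
    (D.blockGraph b).IsBrittle := by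
  rcases hD.1 b with h | h | ⟨c, h⟩
  · obtain ⟨φ⟩ := D.exists_blockGraph_embedding hG b
    exact isBrittle_of_card_le_three
      ((hbad.of_embedding φ).card_le_of_isPrime (D.connected_blockGraph hG b) h)
  · rw [h.2]
    exact isBrittle_top
  · rw [h.2]
    exact isBrittle_starGraph c

theorem IsCanonical.isBigClique_or_isBigStar [Finite V] {D : SplitDecomposition G}
    (hD : D.IsCanonical) (hG : G.Connected) (hbad : G.NoBadPath) (hcard : 3 ≤ Nat.card V)
    (b : D.Block) : (D.blockGraph b).IsBigClique ∨ (D.blockGraph b).IsBigStar := by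
  have h3 := D.three_le_card_block hcard b
  rcases (hD.isBrittle_blockGraph hG hbad b).eq_top_or_eq_starGraph
    (D.connected_blockGraph hG b) with h | ⟨c, h⟩
  · exact Or.inl ⟨h3, h⟩
  · exact Or.inr ⟨c, h3, h⟩

theorem IsCanonical.hasThinOrder [Finite V] {D : SplitDecomposition G} (hD : D.IsCanonical)
    (hG : G.Connected) (hdh : G.IsDistanceHereditary) (hpath : D.tree.IsPathGraph) :
    G.HasThinOrder :=
  (slim_of_isPathGraph hpath).hasThinOrder (hD.isBrittle_blockGraph hG hdh.noBadPath)

end SplitDecomposition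

end SmallBlocks

end SimpleGraph

/-! ### From three markers in a block to an obstruction. -/

namespace SimpleGraph

namespace SplitDecomposition

variable {V : Type u} {G : SimpleGraph V}

/-- Any block that distinguishes `x` from `y` decides their adjacency, provided both have an edge
leaving their class; this is `adj_of_quot_adj` for `toward`. -/
theorem adj_iff_solid_toward [Finite V] (D : SplitDecomposition G) {b : D.Block} {x y : V}
    (hxy : D.toward b x ≠ D.toward b y) : G.Adj x y ↔
      D.solid.Adj (D.toward b x) (D.toward b y) ∧
      (∃ x', G.Adj x x' ∧ D.toward b x' ≠ D.toward b x) ∧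
      ∃ y', G.Adj y y' ∧ D.toward b y' ≠ D.toward b y := by
  rw [solid_adj_iff, blockOf_toward, blockOf_toward]
  constructor
  · intro h
    exact ⟨⟨rfl, quot_adj_of_adj h hxy⟩, ⟨y, h, hxy.symm⟩, ⟨x, h.symm, hxy⟩⟩
  · rintro ⟨⟨-, h⟩, ⟨x', hx, hx'⟩, ⟨y', hy, hy'⟩⟩
    exact adj_of_quot_adj (D.thinCut_toward b) hx hx' hy hy' h

/-- Each vertex of a block has a representative that is adjacent to a vertex represented by another
vertex of the block. -/
theorem exists_representative [Finite V] (D : SplitDecomposition G) (hG : G.Connected)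
    (hcard : 3 ≤ Nat.card V) (w : D.Vert) : ∃ x, D.toward (D.blockOf w) x = w ∧
      ∃ y, G.Adj x y ∧ D.toward (D.blockOf w) y ≠ w := by
  have h3 := D.three_le_card_block hcard (D.blockOf w)
  have : Nontrivial ↥{z : D.Vert | D.blockOf z = D.blockOf w} := by
    rw [← Finite.one_lt_card_iff_nontrivial]
    omega
  obtain ⟨⟨w', hw'⟩, hne⟩ := exists_ne (⟨w, rfl⟩ : ↥{z : D.Vert | D.blockOf z = D.blockOf w})
  obtain ⟨x, hx⟩ := D.exists_toward_eq w
  obtain ⟨y, hy⟩ := D.exists_toward_eq w'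
  have hyw : D.toward (D.blockOf w) y ≠ w := by
    intro e
    rw [← (hw' : D.blockOf w' = D.blockOf w), hy] at e
    exact hne (Subtype.ext e)
  obtain ⟨x, hx, y, hy, hxy⟩ := hG.exists_adj_mem_notMem
    (X := {x | D.toward (D.blockOf w) x = w}) hx hyw
  exact ⟨x, hx, y, hxy, hy⟩

/-- Two vertices of the block of `z'`, the first one a neighbour of `z'`, the second one a neighbour
of `z'` if `q`, and the two are adjacent if `p`. -/
structure IsLeg (D : SplitDecomposition G) (z' : D.Vert) (p q : Bool) (c : Bool → D.Vert) :
    Prop where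
  blockOf : ∀ s, D.blockOf (c s) = D.blockOf z'
  ne : c false ≠ c true
  ne_marker : ∀ s, c s ≠ z'
  adj : D.solid.Adj (c false) (c true) ↔ p = true
  active : ∀ s, D.solid.Adj z' (c s) ↔ (!s || q) = true

theorem exists_three_le_card_block [Finite V] (D : SplitDecomposition G) (z c : D.Vert)
    (hcard : 3 ≤ Nat.card V) :
    ∃ d, D.blockOf d = D.blockOf z ∧ d ≠ z ∧ d ≠ c := by
  have h3 := D.three_le_card_block hcard (D.blockOf z)
  rw [Nat.card_coe_set_eq] at h3
  obtain ⟨d, hd, hd'⟩ := Set.exists_mem_notMem_of_ncard_lt_ncard (s := {z, c})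
    (t := {w | D.blockOf w = D.blockOf z}) (by
      have := Set.ncard_insert_le z {c}
      rw [Set.ncard_singleton] at this
      omega)
  simp only [Set.mem_insert_iff, Set.mem_singleton_iff, not_or] at hd'
  exact ⟨d, hd, hd'⟩

theorem blockGraph_adj {D : SplitDecomposition G} {b : D.Block}
    {H : SimpleGraph ↥{x : D.Vert | D.blockOf x = b}} (h : D.blockGraph b = H) {c d : D.Vert}
    (hc : D.blockOf c = b) (hd : D.blockOf d = b) :
    D.solid.Adj c d ↔ H.Adj ⟨c, hc⟩ ⟨d, hd⟩ := by
  rw [← h]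
  rfl

/-- The three possible blocks behind a marker give the three shapes of legs: a clique gives adjacent
twins, a star centred at the marker gives non-adjacent twins, and any other star gives its centre
with a pendant vertex. -/
theorem exists_isLeg_of_isBigClique [Finite V] {D : SplitDecomposition G} {z : D.Vert}
    (hcard : 3 ≤ Nat.card V) (h : (D.blockGraph (D.blockOf z)).IsBigClique) :
    ∃ c, D.IsLeg z true true c := by
  obtain ⟨d, hd, hdz, -⟩ := D.exists_three_le_card_block z z hcard
  obtain ⟨e, he, hez, hed⟩ := D.exists_three_le_card_block z d hcard
  have hadj : ∀ {c d}, D.blockOf c = D.blockOf z → D.blockOf d = D.blockOf z → c ≠ d →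
      D.solid.Adj c d := by
    intro c d hc hd hne
    rw [blockGraph_adj h.2 hc hd]
    exact fun e => hne (congrArg Subtype.val e)
  refine ⟨fun s => bif s then e else d, ?_, hed.symm, ?_, ?_, ?_⟩
  · rintro (_ | _)
    · exact hd
    · exact he
  · rintro (_ | _)
    · exact hdz
    · exact hez
  · exact iff_of_true (hadj hd he hed.symm) rfl
  · rintro (_ | _)
    · exact iff_of_true (hadj rfl hd hdz.symm) rfl
    · exact iff_of_true (hadj rfl he hez.symm) rfl

theorem exists_isLeg_of_isBigStarAt [Finite V] {D : SplitDecomposition G} {z : D.Vert}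
    (hcard : 3 ≤ Nat.card V) (h : (D.blockGraph (D.blockOf z)).IsBigStarAt ⟨z, rfl⟩) :
    ∃ c, D.IsLeg z false true c := by
  obtain ⟨d, hd, hdz, -⟩ := D.exists_three_le_card_block z z hcard
  obtain ⟨e, he, hez, hed⟩ := D.exists_three_le_card_block z d hcard
  refine ⟨fun s => bif s then e else d, ?_, hed.symm, ?_, ?_, ?_⟩
  · rintro (_ | _)
    · exact hd
    · exact he
  · rintro (_ | _)
    · exact hdz
    · exact hez
  · simp [blockGraph_adj h.2 hd he, hdz, hez]
  · rintro (_ | _)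
    · simp [blockGraph_adj h.2 rfl hd, hdz.symm]
    · simp [blockGraph_adj h.2 rfl he, hez.symm]

theorem exists_isLeg_of_isBigStar [Finite V] {D : SplitDecomposition G} {z : D.Vert}
    (hcard : 3 ≤ Nat.card V) (h : (D.blockGraph (D.blockOf z)).IsBigStar)
    (h' : ¬ (D.blockGraph (D.blockOf z)).IsBigStarAt ⟨z, rfl⟩) :
    ∃ c, D.IsLeg z true false c := by
  obtain ⟨⟨d, hd⟩, h⟩ := h
  have hdz : d ≠ z := by
    rintro rfl
    exact h' h
  obtain ⟨e, he, hez, hed⟩ := D.exists_three_le_card_block z d hcard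
  refine ⟨fun s => bif s then e else d, ?_, hed.symm, ?_, ?_, ?_⟩
  · rintro (_ | _)
    · exact hd
    · exact he
  · rintro (_ | _)
    · exact hdz
    · exact hez
  · simp [blockGraph_adj h.2 hd he, hed.symm]
  · rintro (_ | _)
    · simp [blockGraph_adj h.2 rfl hd, hdz.symm]
    · simp [blockGraph_adj h.2 rfl he, hdz.symm, hed]

theorem isBigStarAt_of_eq {D : SplitDecomposition G} {b b' : D.Block} (e : b = b') {w : D.Vert}
    {hw : D.blockOf w = b} (h : (D.blockGraph b).IsBigStarAt ⟨w, hw⟩) :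
    (D.blockGraph b').IsBigStarAt ⟨w, hw.trans e⟩ := by
  subst e
  exact h

/-- The vertices of `G` that represent three legs attached to the markers `z i` of a block. -/
theorem exists_represents_of_isLeg [Finite V] {D : SplitDecomposition G} (hG : G.Connected)
    (hcard : 3 ≤ Nat.card V) {z z' : Fin 3 → D.Vert} (hz : Function.Injective z)
    (hb : ∀ i j, D.blockOf (z i) = D.blockOf (z j)) (hm : ∀ i, D.marked.Adj (z i) (z' i))
    {p q : Fin 3 → Bool} {c : Fin 3 → Bool → D.Vert} (hc : ∀ i, D.IsLeg (z' i) (p i) (q i) (c i))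
    {A : Fin 3 → Fin 3 → Bool}
    (hA : ∀ i j, i ≠ j → (D.solid.Adj (z i) (z j) ↔ A i j = true)) :
    ∃ φ : Fin 3 × Bool → V, Function.Injective φ ∧ G.Represents φ (legMatrix A p q) ∧
      ∀ w, D.blockOf w = D.blockOf (z 0) → (∀ i, w ≠ z i) → ∃ v, ∀ a, G.Adj v (φ a) ↔
        D.solid.Adj w (z a.1) ∧ (!a.2 || q a.1) = true := by
  choose r hr hr' using D.exists_representative hG hcard
  -- The representatives chosen by `r` have an edge leaving their class, so adjacency within the
  -- block of the leg is faithful.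
  let φ : Fin 3 × Bool → V := fun a => r (c a.1 a.2)
  have htow : ∀ a : Fin 3 × Bool, D.toward (D.blockOf (z' a.1)) (φ a) = c a.1 a.2 := by
    intro a
    rw [← (hc a.1).blockOf a.2]
    exact hr _
  have hblock : ∀ a : Fin 3 × Bool, D.toward (D.blockOf (z 0)) (φ a) = z a.1 := by
    intro a
    rw [hb 0 a.1, D.toward_eq_iff_of_marked (hm a.1), htow]
    exact (hc a.1).ne_marker a.2
  -- A representative has an edge through the marked edge exactly when its vertex in the leg is a
  -- neighbour of the marker `z' i`.
  have hactive : ∀ a : Fin 3 × Bool,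
      (∃ y, G.Adj (φ a) y ∧ D.toward (D.blockOf (z 0)) y ≠ D.toward (D.blockOf (z 0)) (φ a)) ↔
        (!a.2 || q a.1) = true := by
    intro a
    rw [← (hc a.1).active a.2, hblock, hb 0 a.1]
    have hout : ∀ y, D.toward (D.blockOf (z a.1)) y ≠ z a.1 ↔
        D.toward (D.blockOf (z' a.1)) y = z' a.1 := fun y => by
      have := D.toward_eq_iff_of_marked (hm a.1) y
      tauto
    constructor
    · rintro ⟨y, hy, hyz⟩
      rw [hout] at hyz
      have := (D.adj_iff_solid_toward (b := D.blockOf (z' a.1)) (x := y) (y := φ a) (by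
        rw [hyz, htow]
        exact ((hc a.1).ne_marker a.2).symm)).1 hy.symm
      rw [hyz, htow] at this
      exact this.1
    · intro h
      refine ⟨r (z' a.1), ?_, (hout _).2 (hr _)⟩
      refine (D.adj_iff_solid_toward (b := D.blockOf (z' a.1)) ?_).2 ⟨?_, ?_, ?_⟩
      · rw [htow, hr]
        exact (hc a.1).ne_marker a.2
      · rw [htow, hr]
        exact h.symm
      · rw [← (hc a.1).blockOf a.2]
        obtain ⟨y, hy⟩ := hr' (c a.1 a.2)
        exact ⟨y, hy.1, by rw [hr]; exact hy.2⟩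
      · rw [hr]
        exact hr' _
  refine ⟨φ, ?_, ?_, ?_⟩
  · intro a a' e
    have h1 : a.1 = a'.1 := hz (by rw [← hblock, ← hblock, e])
    have h2 := htow a
    rw [e, h1, htow] at h2
    refine Prod.ext h1 ?_
    have := (hc a'.1).ne
    rcases a with ⟨i, _ | _⟩ <;> rcases a' with ⟨j, _ | _⟩
    · rfl
    · exact absurd h2.symm this
    · exact absurd h2 this
    · rfl
  · rintro ⟨i, s⟩ ⟨j, t⟩
    by_cases hij : i = j
    · subst hij
      have hself : G.Adj (φ (i, false)) (φ (i, true)) ↔ p i = true := by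
        rw [← (hc i).adj]
        have h1 := htow (i, false)
        have h2 := htow (i, true)
        have hn : ∀ s, ∃ x', G.Adj (φ (i, s)) x' ∧ D.toward (D.blockOf (z' i)) x' ≠
            c i s := by
          intro s
          rw [← (hc i).blockOf s]
          exact hr' (c i s)
        rw [D.adj_iff_solid_toward (b := D.blockOf (z' i)) (by rw [h1, h2]; exact (hc i).ne),
          h1, h2]
        exact and_iff_left ⟨hn false, hn true⟩
      rcases s with _ | _ <;> rcases t with _ | _
      · simp [legMatrix]
      · simpa [legMatrix] using hself
      · rw [adj_comm]
        simpa [legMatrix] using hself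
      · simp [legMatrix]
    · rw [D.adj_iff_solid_toward (b := D.blockOf (z 0)) (by
        rw [hblock, hblock]
        exact hz.ne hij), hactive, hactive, hblock, hblock, hA i j hij]
      simp [legMatrix, hij, and_assoc]
  · intro w hw hwz
    have hrw : D.toward (D.blockOf (z 0)) (r w) = w := by
      rw [← hw]
      exact hr w
    refine ⟨r w, fun a => ?_⟩
    rw [D.adj_iff_solid_toward (b := D.blockOf (z 0)) (by
      rw [hrw, hblock]
      exact hwz _), hactive, hblock, hrw]
    refine and_congr_right fun _ => and_iff_right ?_
    rw [← hw]
    exact hr' w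

/-- A block with three markers is a clique, a star centred at one of them, or a star centred
elsewhere. Canonicity excludes one type of neighbour each time: no clique next to a clique, no star
centred at its marker behind a leaf marker, and only such stars or cliques behind a central one. The
remaining legs fit the three leg lemmas. In the last case the vertex `v` standing for the centre
sees all active vertices and is complemented at. -/
theorem IsCanonical.isVertexMinor_of_not_slim [Finite V] {D : SplitDecomposition G}
    (hD : D.IsCanonical) (hG : G.Connected) (hbad : G.NoBadPath) (h : ¬ D.Slim ∅) :
    co3K2.IsVertexMinor G ∨ netGraph.IsVertexMinor G := by
  classical
  obtain ⟨z, z', hz, hb, hm⟩ := exists_three_markers h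
  have hcard := D.three_le_card_of_marked (hm 0)
  have hblocks := hD.isBigClique_or_isBigStar hG hbad hcard
  have hne : ∀ i j, i ≠ j → z i ≠ z j := fun i j hij => hz.ne hij
  rcases hblocks (D.blockOf (z 0)) with hcl | ⟨⟨w, hw⟩, hst⟩
  · have hleg : ∀ i, ∃ r : Bool, ∃ c, D.IsLeg (z' i) r (!r) c := by
      intro i
      rcases hblocks (D.blockOf (z' i)) with h' | h'
      · exact absurd ⟨hb 0 i ▸ hcl, h'⟩ (hD.2.1 _ _ (hm i))
      · by_cases hc : (D.blockGraph (D.blockOf (z' i))).IsBigStarAt ⟨z' i, rfl⟩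
        · exact ⟨false, exists_isLeg_of_isBigStarAt hcard hc⟩
        · exact ⟨true, exists_isLeg_of_isBigStar hcard h' hc⟩
    choose r c hc using hleg
    obtain ⟨φ, hφ, hrep, -⟩ := exists_represents_of_isLeg hG hcard hz hb hm hc
      (A := fun _ _ => true) (fun i j hij => by
        rw [blockGraph_adj hcl.2 (hb i 0) (hb j 0)]
        exact iff_of_true (fun e => hne i j hij (congrArg Subtype.val e)) rfl)
    exact hrep.isVertexMinor_of_cliqueLegs hφ
  · -- a leg at a marker other than the centre
    have houter : ∀ i, w ≠ z i → ∃ r : Bool, ∃ c, D.IsLeg (z' i) true (!r) c := by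
      intro i hwi
      rcases hblocks (D.blockOf (z' i)) with h' | h'
      · exact ⟨false, exists_isLeg_of_isBigClique hcard h'⟩
      · refine ⟨true, exists_isLeg_of_isBigStar hcard h' fun hc => hwi ?_⟩
        have hst' : (D.blockGraph (D.blockOf (z i))).IsBigStar := by
          rw [hb i 0]
          exact ⟨_, hst⟩
        have h1 := (hD.2.2 _ _ (hm i) hst' h').2 hc
        have hst2 : (D.blockGraph (D.blockOf (z i))).IsBigStarAt ⟨w, hw.trans (hb 0 i)⟩ :=
          isBigStarAt_of_eq (hb 0 i) hst
        exact congrArg Subtype.val (hst2.unique h1)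
    by_cases hwz : ∃ i, w = z i
    · obtain ⟨i, rfl⟩ := hwz
      have hleg : ∀ j, ∃ r : Bool, ∃ c, D.IsLeg (z' j) (decide (j ≠ i) || r)
          (decide (j = i) || !r) c := by
        intro j
        by_cases hji : j = i
        · subst hji
          rcases hblocks (D.blockOf (z' j)) with h' | h'
          · exact ⟨true, by simpa using exists_isLeg_of_isBigClique hcard h'⟩
          · have hst' : (D.blockGraph (D.blockOf (z j))).IsBigStarAt ⟨z j, rfl⟩ :=
              isBigStarAt_of_eq (hb 0 j) hst
            have hc := (hD.2.2 _ _ (hm j) ⟨_, hst'⟩ h').1 hst'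
            exact ⟨false, by simpa using exists_isLeg_of_isBigStarAt hcard hc⟩
        · obtain ⟨r, c, hc⟩ := houter j (hne i j (Ne.symm hji))
          exact ⟨r, c, by simpa [hji] using hc⟩
      choose r c hc using hleg
      obtain ⟨φ, hφ, hrep, -⟩ := exists_represents_of_isLeg hG hcard hz hb hm hc
        (A := fun j k => decide (j = i ∨ k = i)) (fun j k hjk => by
          rw [blockGraph_adj hst.2 (hb j 0) (hb k 0), starGraph_adj]
          simp [hz.eq_iff, hjk])
      exact hrep.isVertexMinor_of_starLegs hφ
    · push Not at hwz
      choose r c hc using fun i => houter i (hwz i)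
      obtain ⟨φ, hφ, hrep, hv⟩ := exists_represents_of_isLeg hG hcard hz hb hm hc
        (A := fun _ _ => false) (fun j k hjk => by
          rw [blockGraph_adj hst.2 (hb j 0) (hb k 0), starGraph_adj]
          simp [(hwz j).symm, (hwz k).symm])
      obtain ⟨v, hv⟩ := hv w hw hwz
      refine hrep.isVertexMinor_of_outerStarLegs hφ (v := v) fun a => (hv a).trans ?_
      refine and_iff_right ?_
      rw [blockGraph_adj hst.2 hw (hb a.1 0), starGraph_adj]
      simp [hwz]

end SplitDecomposition

end SimpleGraph
-- The equivalence.
theorem mainTheorem2 {V : Type*} [Fintype V] [Nontrivial V] (G : SimpleGraph V)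
    (hG : G.Connected) :
    List.TFAE [
      G.IsDistanceHereditary ∧
        ∃ D : SimpleGraph.SplitDecomposition G, D.IsCanonical ∧ D.tree.IsPathGraph,
      G.IsDistanceHereditary ∧
        ∀ D : SimpleGraph.SplitDecomposition G, D.IsCanonical → D.tree.IsPathGraph,
      G.linearRankWidth = 1,
      ∃ T : SimpleGraph V, T.IsCaterpillar ∧ G.LocallyEquivalent T,
      ∃ n : ℕ, G.IsVertexMinor (SimpleGraph.pathGraph n),
      ¬ SimpleGraph.co3K2.IsVertexMinor G ∧ ¬ SimpleGraph.netGraph.IsVertexMinor G ∧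
        ¬ (SimpleGraph.cycleGraph 5).IsVertexMinor G] := by
  have hthin := SimpleGraph.linearRankWidth_eq_one_iff hG
  tfae_have 3 → 6 := fun h =>
    ⟨fun hm => SimpleGraph.not_hasThinOrder_co3K2 ((hthin.1 h).of_isVertexMinor hm),
      fun hm => SimpleGraph.not_hasThinOrder_netGraph ((hthin.1 h).of_isVertexMinor hm),
      fun hm => SimpleGraph.not_hasThinOrder_cycleGraph ((hthin.1 h).of_isVertexMinor hm)⟩
  tfae_have 6 → 2 := by
    rintro ⟨hco, hnet, hcyc⟩
    have hbad := SimpleGraph.noBadPath_of_not_isVertexMinor hcyc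
    refine ⟨hbad.isDistanceHereditary, fun D hD => ?_⟩
    by_contra hpath
    exact (hD.isVertexMinor_of_not_slim hG hbad fun hs => hpath hs.isPathGraph_tree).elim hco hnet
  tfae_have 2 → 1 := by
    rintro ⟨hdh, h⟩
    obtain ⟨D, hD⟩ := SimpleGraph.SplitDecomposition.exists_isCanonical hG
    exact ⟨hdh, D, hD, h D hD⟩
  tfae_have 1 → 3 := fun ⟨hdh, _, hD, hpath⟩ => hthin.2 (hD.hasThinOrder hG hdh hpath)
  tfae_have 3 → 4 := fun h => (hthin.1 h).exists_isCaterpillar hG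
  tfae_have 4 → 3 := fun ⟨_, hT, hGT⟩ => hthin.2 (hT.hasThinOrder.of_locallyEquivalent hGT.symm)
  tfae_have 3 → 5 := fun h => (hthin.1 h).exists_isVertexMinor_pathGraph hG
  tfae_have 5 → 3 := fun ⟨n, hn⟩ =>
    hthin.2 ((SimpleGraph.hasThinOrder_pathGraph n).of_isVertexMinor hn)
  tfae_finish
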